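/- Let $G$ be a finite-dimensional (Hausdorff) Lie group acting smoothly and properly on a second countable Hausdorff smooth manifold $Q$ of dimension $n$ (without boundary), with isotropy groups $G_q$. Let $S^*Q=(T^*Q\setminus 0)/\mathbb{R}_{+}$ be the cosphere bundle, the quotient of the cotangent bundle without its zero section by the positive dilations of the fibres, with the lifted action $g\cdot[\alpha_q]=[\alpha_q\circ T_{gq}g^{-1}]$. Assume that no orbit with non-trivial isotropy is open in $Q$. Consider the following conditions on the action of $G$ on $Q$. (a) The action is free almost everywhere: the set of points with non-trivial isotropy group has measure zero. (b) The connected components of the orbits with non-trivial isotropy are isolated: every connected component $C$ of such an orbit has an open neighbourhood in which all points outside $C$ have trivial isotropy. (b$'$) The connected components of the orbits of non-maximal dimension are isolated: every connected component $C$ of such an orbit has an open neighbourhood in which all points outside $C$ lie on orbits of maximal dimension. (c) For every non-trivial isotropy group $H$, with Lie algebra $\mathfrak{h}\subseteq\mathfrak{g}$, the action $h\cdot[\xi]=[\operatorname{Ad}_h\xi]$ of $H$ on $(\mathfrak{g}/\mathfrak{h})\setminus\{0\}$ is free. Call the action almost semifree if (a), (b) and (c) hold. Then: 1. the lifted action on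 $S^*Q$ is free if and only if the action on $Q$ is almost semifree; 2. if the lifted action on $S^*Q$ is free, then (a), (b$'$) and (c) hold; 3. if $G$ is connected, the lifted action on $S^*Q$ is free if and only if (a), (b$'$) and (c) hold. -/

import Mathlib

open scoped Manifold ContDiff

/-! ### The cosphere bundle and the lifted action -/

section Cosphere

/-- The cotangent bundle `T^*Q` of an `n`-dimensional manifold, as a set of pairs `(q, α)` with
`α` a linear form on `T_q Q`. -/
abbrev CotangentBundle (n : ℕ) (Q : Type*) [TopologicalSpace Q]
    [ChartedSpace (EuclideanSpace ℝ (Fin n)) Q] : Type _ :=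
  Bundle.TotalSpace (EuclideanSpace ℝ (Fin n) →L[ℝ] ℝ)
    (fun q : Q => TangentSpace (𝓡 n) q →L[ℝ] ℝ)

/-- `T^*Q` without its zero section. -/
def PuncturedCotangentBundle (n : ℕ) (Q : Type*) [TopologicalSpace Q]
    [ChartedSpace (EuclideanSpace ℝ (Fin n)) Q] : Type _ :=
  {p : CotangentBundle n Q // p.snd ≠ 0}

/-- The orbit relation of the dilations of the fibres by positive reals. -/
def cosphereSetoid (n : ℕ) (Q : Type*) [TopologicalSpace Q]
    [ChartedSpace (EuclideanSpace ℝ (Fin n)) Q] : Setoid (PuncturedCotangentBundle n Q) where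
  r p p' := ∃ r : ℝ, 0 < r ∧ p'.1 = ⟨p.1.proj, r • p.1.snd⟩
  iseqv := by
    refine ⟨fun p => ⟨1, one_pos, by simp⟩, ?_, ?_⟩
    · rintro ⟨⟨q, a⟩, ha⟩ ⟨⟨q', a'⟩, ha'⟩ ⟨r, hr, h⟩
      cases h
      refine ⟨r⁻¹, inv_pos.2 hr, ?_⟩
      simp [smul_smul, hr.ne']
    · rintro ⟨⟨q, a⟩, ha⟩ ⟨⟨q', a'⟩, ha'⟩ ⟨⟨q'', a''⟩, ha''⟩ ⟨r, hr, h⟩ ⟨s, hs, h'⟩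
      cases h
      cases h'
      exact ⟨s * r, mul_pos hs hr, by simp [smul_smul]⟩

/-- The cosphere bundle `S^*Q = (T^*Q ∖ 0) / ℝ_+`. -/
def CosphereBundle (n : ℕ) (Q : Type*) [TopologicalSpace Q]
    [ChartedSpace (EuclideanSpace ℝ (Fin n)) Q] : Type _ :=
  Quotient (cosphereSetoid n Q)

variable {n : ℕ} {Q : Type*} [TopologicalSpace Q] [ChartedSpace (EuclideanSpace ℝ (Fin n)) Q]
  {G : Type*} [Group G] [MulAction G Q]

theorem CotangentBundle.ext' {p p' : CotangentBundle n Q} (h : p.proj = p'.proj)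
    (h' : ∀ v : EuclideanSpace ℝ (Fin n), (p.snd v : ℝ) = p'.snd v) : p = p' := by
  obtain ⟨q, a⟩ := p
  obtain ⟨q', a'⟩ := p'
  cases h
  congr 1
  exact ContinuousLinearMap.ext h'

/-- The differential `T_{g q} Q → T_q Q` of `g⁻¹` at `g q`. -/
noncomputable def invDiff (n : ℕ) {Q : Type*} [TopologicalSpace Q]
    [ChartedSpace (EuclideanSpace ℝ (Fin n)) Q] {G : Type*} [Group G] [MulAction G Q]
    (g : G) (q : Q) : TangentSpace (𝓡 n) (g • q) →L[ℝ] TangentSpace (𝓡 n) q :=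
  mfderiv (𝓡 n) (𝓡 n) (fun x : Q => g⁻¹ • x) (g • q)

/-- The natural left lift of the action to the cotangent bundle:
`g · (q, α) = (g q, α ∘ T_{g q} g⁻¹)`. -/
noncomputable def cotangentLift (g : G) (p : CotangentBundle n Q) : CotangentBundle n Q :=
  ⟨g • p.proj, p.snd.comp (invDiff n g p.proj)⟩

theorem invDiff_one (q : Q) (v : EuclideanSpace ℝ (Fin n)) :
    (invDiff n (1 : G) q v : EuclideanSpace ℝ (Fin n)) = v := by
  have h : (fun x : Q => (1 : G)⁻¹ • x) = id := by
    funext x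
    simp
  unfold invDiff
  rw [h, mfderiv_id]
  rfl

theorem invDiff_mul (hs : ∀ g : G, MDifferentiable (𝓡 n) (𝓡 n) (fun x : Q => g • x))
    (g g' : G) (q : Q) (v : EuclideanSpace ℝ (Fin n)) :
    (invDiff n (g * g') q v : EuclideanSpace ℝ (Fin n)) =
      invDiff n g' q (invDiff n g (g' • q) v) := by
  have h : (fun x : Q => (g * g')⁻¹ • x) = (fun x : Q => g'⁻¹ • x) ∘ (fun x : Q => g⁻¹ • x) := by
    funext x
    simp [mul_smul]
  have e : (g * g') • q = g • g' • q := mul_smul g g' q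
  have e' : g⁻¹ • g • g' • q = g' • q := inv_smul_smul g _
  unfold invDiff
  rw [h, e, mfderiv_comp (g • g' • q) (I' := 𝓡 n) (hs _ _) (hs _ _), e']
  rfl

theorem invDiff_inv_apply (hs : ∀ g : G, MDifferentiable (𝓡 n) (𝓡 n) (fun x : Q => g • x))
    (g : G) (q : Q) (v : EuclideanSpace ℝ (Fin n)) :
    (invDiff n g q (invDiff n g⁻¹ (g • q) v) : EuclideanSpace ℝ (Fin n)) = v := by
  rw [← invDiff_mul hs, inv_mul_cancel]
  exact invDiff_one q v

theorem cotangentLift_one (p : CotangentBundle n Q) : cotangentLift (1 : G) p = p :=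
  CotangentBundle.ext' (one_smul G _) fun v => congrArg p.snd (invDiff_one (G := G) p.proj v)

theorem cotangentLift_mul (hs : ∀ g : G, MDifferentiable (𝓡 n) (𝓡 n) (fun x : Q => g • x))
    (g g' : G) (p : CotangentBundle n Q) :
    cotangentLift (g * g') p = cotangentLift g (cotangentLift g' p) :=
  CotangentBundle.ext' (mul_smul g g' _) fun v => congrArg p.snd (invDiff_mul hs g g' p.proj v)

theorem cotangentLift_ne (hs : ∀ g : G, MDifferentiable (𝓡 n) (𝓡 n) (fun x : Q => g • x))
    (g : G) (p : CotangentBundle n Q) (hp : p.snd ≠ 0) : (cotangentLift g p).snd ≠ 0 := by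
  intro h
  apply hp
  refine ContinuousLinearMap.ext fun v => ?_
  have h1 := congrArg p.snd (invDiff_inv_apply hs g p.proj v)
  have h2 : (cotangentLift g p).snd (invDiff n g⁻¹ (g • p.proj) v) = 0 := by
    rw [h]
    rfl
  exact h1.symm.trans h2

theorem contMDiffSMul_mdifferentiable (d n : ℕ) (G Q : Type*) [Group G] [TopologicalSpace G]
    [ChartedSpace (EuclideanSpace ℝ (Fin d)) G] [TopologicalSpace Q]
    [ChartedSpace (EuclideanSpace ℝ (Fin n)) Q] [MulAction G Q]
    [ContMDiffSMul (𝓡 d) (𝓡 n) ∞ G Q] (g : G) :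
    MDifferentiable (𝓡 n) (𝓡 n) (fun x : Q => g • x) := by
  have h : ContMDiff (𝓡 n) (𝓡 n) ∞ (fun x : Q => g • x) :=
    (ContMDiffSMul.contMDiff_smul (I := 𝓡 d) (I' := 𝓡 n) (n := ∞) (G := G) (M := Q)).comp
      (contMDiff_const.prodMk contMDiff_id)
  exact h.mdifferentiable (by simp)

/-- The lifted action `g · [α_q] = [g · α_q]` on the cosphere bundle. -/
noncomputable def cosphereLift
    (hs : ∀ g : G, MDifferentiable (𝓡 n) (𝓡 n) (fun x : Q => g • x)) (g : G) :
    CosphereBundle n Q → CosphereBundle n Q :=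
  Quotient.map (fun p => ⟨cotangentLift g p.1, cotangentLift_ne hs g p.1 p.2⟩) (by
    rintro ⟨⟨q, a⟩, ha⟩ ⟨⟨q', a'⟩, ha'⟩ ⟨r, hr, h⟩
    cases h
    exact ⟨r, hr, rfl⟩)

/-- The lift of a smooth action on `Q` to an action on `S^*Q`. -/
@[reducible]
noncomputable def cosphereAction (d n : ℕ) (G Q : Type*) [Group G] [TopologicalSpace G]
    [ChartedSpace (EuclideanSpace ℝ (Fin d)) G] [TopologicalSpace Q]
    [ChartedSpace (EuclideanSpace ℝ (Fin n)) Q] [MulAction G Q]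
    [ContMDiffSMul (𝓡 d) (𝓡 n) ∞ G Q] : MulAction G (CosphereBundle n Q) where
  smul g x := cosphereLift (contMDiffSMul_mdifferentiable d n G Q) g x
  one_smul x := by
    induction x using Quotient.inductionOn with
    | h p => exact congrArg (Quotient.mk _) (Subtype.ext (cotangentLift_one p.1))
  mul_smul g g' x := by
    induction x using Quotient.inductionOn with
    | h p =>
      exact congrArg (Quotient.mk _) (Subtype.ext
        (cotangentLift_mul (contMDiffSMul_mdifferentiable d n G Q) g g' p.1))

/-- An action is free if all its isotropy groups are trivial. -/
def IsFreeAction (G X : Type*) [Group G] [MulAction G X] : Prop :=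
  ∀ x : X, MulAction.stabilizer G x = ⊥

/-- The lift to `S^*Q` of the action of `G` on `Q` is free. -/
def CosphereLiftIsFree (d n : ℕ) (G Q : Type*) [Group G] [TopologicalSpace G]
    [ChartedSpace (EuclideanSpace ℝ (Fin d)) G] [TopologicalSpace Q]
    [ChartedSpace (EuclideanSpace ℝ (Fin n)) Q] [MulAction G Q]
    [ContMDiffSMul (𝓡 d) (𝓡 n) ∞ G Q] : Prop :=
  letI := cosphereAction d n G Q
  IsFreeAction G (CosphereBundle n Q)

end Cosphere

/-! ### Lie algebras of subgroups and the isotropy representation -/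

section LieAlgebra

variable (d : ℕ) {G : Type*} [Group G] [TopologicalSpace G]
  [ChartedSpace (EuclideanSpace ℝ (Fin d)) G]

/-- The adjoint action `Ad_g` on the Lie algebra `T_1 G`: the differential at `1` of
`x ↦ g x g⁻¹`. -/
noncomputable def Ad (g : G) : GroupLieAlgebra (𝓡 d) G →L[ℝ] GroupLieAlgebra (𝓡 d) G :=
  mfderiv (𝓡 d) (𝓡 d) (fun x : G => g * x * g⁻¹) 1

/-- `γ` is a curve in `G` through `1`, with values in `H`, and with velocity `ξ` at time `0`. -/
def IsVelocityAtOne (H : Subgroup G) (γ : ℝ → G) (ξ : GroupLieAlgebra (𝓡 d) G) : Prop :=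
  γ 0 = 1 ∧ (∀ t, γ t ∈ H) ∧ MDifferentiableAt 𝓘(ℝ, ℝ) (𝓡 d) γ 0 ∧
    (mfderiv 𝓘(ℝ, ℝ) (𝓡 d) γ 0 (1 : ℝ) : EuclideanSpace ℝ (Fin d)) = ξ

theorem isVelocityAtOne_zero (H : Subgroup G) : IsVelocityAtOne d H (fun _ => 1) 0 := by
  refine ⟨rfl, fun _ => H.one_mem, mdifferentiableAt_const, ?_⟩
  rw [mfderiv_const]
  rfl

theorem IsVelocityAtOne.smul {H : Subgroup G} {γ : ℝ → G} {ξ : GroupLieAlgebra (𝓡 d) G}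
    (hγ : IsVelocityAtOne d H γ ξ) (c : ℝ) :
    IsVelocityAtOne d H (fun t => γ (c * t)) (c • ξ) := by
  obtain ⟨h0, hH, hd, rfl⟩ := hγ
  have hc : HasDerivAt (fun t : ℝ => c * t) c 0 := by
    simpa using (hasDerivAt_id (0 : ℝ)).const_mul c
  have hc' : MDifferentiableAt 𝓘(ℝ, ℝ) 𝓘(ℝ, ℝ) (fun t : ℝ => c * t) 0 :=
    hc.differentiableAt.mdifferentiableAt
  have e : c * 0 = 0 := mul_zero c
  have hd' : MDifferentiableAt 𝓘(ℝ, ℝ) (𝓡 d) γ (c * 0) := by rwa [e]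
  refine ⟨by simp [h0], fun t => hH _, ?_, ?_⟩
  · exact hd'.comp (0 : ℝ) hc'
  · have h := mfderiv_comp (I' := 𝓘(ℝ, ℝ)) (0 : ℝ) hd' hc'
    have h' := DFunLike.congr_fun h (1 : ℝ)
    refine h'.trans ?_
    have h2 : (mfderiv 𝓘(ℝ, ℝ) 𝓘(ℝ, ℝ) (fun t : ℝ => c * t) 0 (1 : ℝ) : ℝ) = c • (1 : ℝ) := by
      rw [mfderiv_eq_fderiv]
      exact (fderiv_apply_one_eq_deriv.trans hc.deriv).trans (mul_one c).symm
    refine (congrArg (mfderiv 𝓘(ℝ, ℝ) (𝓡 d) γ (c * 0)) h2).trans ?_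
    refine (ContinuousLinearMap.map_smul _ c (1 : ℝ)).trans ?_
    rw [e]
    rfl

variable [LieGroup (𝓡 d) ∞ G]

theorem mfderiv_mul_at_one {a b : G} (ha : a = 1) (hb : b = 1)
    (u v : EuclideanSpace ℝ (Fin d)) :
    (mfderiv ((𝓡 d).prod (𝓡 d)) (𝓡 d) (fun p : G × G => p.1 * p.2) (a, b) (u, v) :
      EuclideanSpace ℝ (Fin d)) = u + v := by
  subst ha hb
  have hm : MDifferentiableAt ((𝓡 d).prod (𝓡 d)) (𝓡 d) (fun p : G × G => p.1 * p.2)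
      ((1 : G), (1 : G)) := (contMDiff_mul (𝓡 d) ∞).mdifferentiable (by simp) _
  have h1 : (fun z : G => z * (1 : G)) = id := by
    funext z
    simp
  have h2 : (fun z : G => (1 : G) * z) = id := by
    funext z
    simp
  have h := mfderiv_prod_eq_add_apply (v := ((u, v) : EuclideanSpace ℝ (Fin d) × _)) hm
  dsimp only at h
  rw [h1, h2, mfderiv_id] at h
  exact h

theorem IsVelocityAtOne.mul {H : Subgroup G} {γ γ' : ℝ → G} {ξ ξ' : GroupLieAlgebra (𝓡 d) G}
    (hγ : IsVelocityAtOne d H γ ξ) (hγ' : IsVelocityAtOne d H γ' ξ') :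
    IsVelocityAtOne d H (fun t => γ t * γ' t) (ξ + ξ') := by
  obtain ⟨h0, hH, hd, rfl⟩ := hγ
  obtain ⟨h0', hH', hd', rfl⟩ := hγ'
  have hm : MDifferentiableAt ((𝓡 d).prod (𝓡 d)) (𝓡 d) (fun p : G × G => p.1 * p.2)
      (γ 0, γ' 0) := (contMDiff_mul (𝓡 d) ∞).mdifferentiable (by simp) _
  have hp := hd.prodMk hd'
  refine ⟨by simp [h0, h0'], fun t => H.mul_mem (hH t) (hH' t), ?_, ?_⟩
  · exact hm.comp (0 : ℝ) hp
  · have h := mfderiv_comp (I' := (𝓡 d).prod (𝓡 d)) (0 : ℝ) hm hp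
    have h' := DFunLike.congr_fun h (1 : ℝ)
    refine h'.trans ?_
    rw [mfderiv_prodMk hd hd']
    exact mfderiv_mul_at_one d h0 h0' _ _

theorem IsVelocityAtOne.conj {H : Subgroup G} {γ : ℝ → G} {ξ : GroupLieAlgebra (𝓡 d) G}
    (hγ : IsVelocityAtOne d H γ ξ) {h : G} (hh : h ∈ H) :
    IsVelocityAtOne d H (fun t => h * γ t * h⁻¹) (Ad d h ξ) := by
  obtain ⟨h0, hH, hd, rfl⟩ := hγ
  have hs : ContMDiff (𝓡 d) (𝓡 d) ∞ (fun x : G => h * x * h⁻¹) :=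
    (contMDiff_mul_right (I := 𝓡 d) (n := ∞) (a := h⁻¹)).comp
      (contMDiff_mul_left (I := 𝓡 d) (n := ∞) (a := h))
  have hc : MDifferentiableAt (𝓡 d) (𝓡 d) (fun x : G => h * x * h⁻¹) (γ 0) :=
    hs.mdifferentiable (by simp) _
  refine ⟨by simp [h0], fun t => H.mul_mem (H.mul_mem hh (hH t)) (H.inv_mem hh), ?_, ?_⟩
  · exact hc.comp (0 : ℝ) hd
  · have h' := DFunLike.congr_fun (mfderiv_comp (I' := 𝓡 d) (0 : ℝ) hc hd) (1 : ℝ)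
    refine h'.trans ?_
    unfold Ad
    rw [← h0]
    rfl

/-- The Lie algebra `𝔥 ⊆ 𝔤 = T_1 G` of a closed subgroup `H`: the velocities at `1` of the
curves in `H`. -/
noncomputable def subgroupLieAlgebra (H : Subgroup G) :
    Submodule ℝ (GroupLieAlgebra (𝓡 d) G) where
  carrier := {ξ | ∃ γ : ℝ → G, IsVelocityAtOne d H γ ξ}
  zero_mem' := ⟨_, isVelocityAtOne_zero d H⟩
  add_mem' := fun ⟨_, h⟩ ⟨_, h'⟩ => ⟨_, h.mul d h'⟩
  smul_mem' := fun c _ ⟨_, h⟩ => ⟨_, h.smul d c⟩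

theorem Ad_mem_subgroupLieAlgebra (H : Subgroup G) {h : G} (hh : h ∈ H)
    {ξ : GroupLieAlgebra (𝓡 d) G} (hξ : ξ ∈ subgroupLieAlgebra d H) :
    Ad d h ξ ∈ subgroupLieAlgebra d H :=
  let ⟨_, hv⟩ := hξ
  ⟨_, hv.conj d hh⟩

/-- The induced adjoint representation `h · [ξ] = [Ad_h ξ]` of `H` on `𝔤 / 𝔥`. -/
noncomputable def quotientAd (H : Subgroup G) (h : H) :
    (GroupLieAlgebra (𝓡 d) G ⧸ subgroupLieAlgebra d H) →ₗ[ℝ]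
      (GroupLieAlgebra (𝓡 d) G ⧸ subgroupLieAlgebra d H) :=
  Submodule.mapQ _ _ (Ad d (h : G)).toLinearMap
    fun _ hξ => Ad_mem_subgroupLieAlgebra d H h.2 hξ

end LieAlgebra

/-! ### Almost semifree actions -/

section AlmostSemifree

/-- A subset of an `n`-dimensional manifold has measure zero if its image in each preferred chart
is a Lebesgue null set. -/
def IsNullInManifold (n : ℕ) {Q : Type*} [TopologicalSpace Q]
    [ChartedSpace (EuclideanSpace ℝ (Fin n)) Q] (S : Set Q) : Prop :=
  ∀ x : Q, MeasureTheory.volume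
    (chartAt (EuclideanSpace ℝ (Fin n)) x ''
      ((chartAt (EuclideanSpace ℝ (Fin n)) x).source ∩ S)) = 0

/-- The dimension of the orbit of `q`, which is diffeomorphic to `G / G_q`. -/
noncomputable def orbitDim (d : ℕ) (G : Type*) {Q : Type*} [Group G] [TopologicalSpace G]
    [ChartedSpace (EuclideanSpace ℝ (Fin d)) G] [LieGroup (𝓡 d) ∞ G] [MulAction G Q]
    (q : Q) : ℕ :=
  Module.finrank ℝ
    (GroupLieAlgebra (𝓡 d) G ⧸ subgroupLieAlgebra d (MulAction.stabilizer G q))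

/-- Some orbit has a larger dimension than the orbit of `q`. -/
def OrbitHasNonMaximalDim (d : ℕ) (G : Type*) {Q : Type*} [Group G] [TopologicalSpace G]
    [ChartedSpace (EuclideanSpace ℝ (Fin d)) G] [LieGroup (𝓡 d) ∞ G] [MulAction G Q]
    (q : Q) : Prop :=
  ∃ q' : Q, orbitDim d G q < orbitDim d G q'

/-- The connected components of the orbits in the union `S` of a family of orbits are isolated:
the component of the orbit of each `q ∈ S` through `q` has an open neighbourhood that contains
no other points of `S`. -/
def HasIsolatedOrbitComponents (G : Type*) {Q : Type*} [Group G] [TopologicalSpace Q]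
    [MulAction G Q] (S : Set Q) : Prop :=
  ∀ q ∈ S, ∃ U : Set Q, IsOpen U ∧ connectedComponentIn (MulAction.orbit G q) q ⊆ U ∧
    U ∩ S ⊆ connectedComponentIn (MulAction.orbit G q) q

/-- The action is free almost everywhere, the connected components of the orbits contained in `S`
are isolated, and every non-trivial isotropy group `H` acts freely on `(𝔤 / 𝔥) ∖ {0}`. -/
structure IsAlmostSemifreeAlong (d n : ℕ) (G Q : Type*) [Group G] [TopologicalSpace G]
    [ChartedSpace (EuclideanSpace ℝ (Fin d)) G] [LieGroup (𝓡 d) ∞ G] [TopologicalSpace Q]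
    [ChartedSpace (EuclideanSpace ℝ (Fin n)) Q] [MulAction G Q] (S : Set Q) : Prop where
  free_ae : IsNullInManifold n {q : Q | MulAction.stabilizer G q ≠ ⊥}
  isolated : HasIsolatedOrbitComponents G S
  free_quotient : ∀ q : Q, MulAction.stabilizer G q ≠ ⊥ →
    ∀ (h : MulAction.stabilizer G q)
      (x : GroupLieAlgebra (𝓡 d) G ⧸ subgroupLieAlgebra d (MulAction.stabilizer G q)),
      x ≠ 0 → quotientAd d (MulAction.stabilizer G q) h x = x → h = 1

/-- Almost semifree: the orbits required to have isolated components are those with non-trivial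
isotropy, that is, the orbits on which the action is not free. -/
def IsAlmostSemifree (d n : ℕ) (G Q : Type*) [Group G] [TopologicalSpace G]
    [ChartedSpace (EuclideanSpace ℝ (Fin d)) G] [LieGroup (𝓡 d) ∞ G] [TopologicalSpace Q]
    [ChartedSpace (EuclideanSpace ℝ (Fin n)) Q] [MulAction G Q] : Prop :=
  IsAlmostSemifreeAlong d n G Q {q : Q | MulAction.stabilizer G q ≠ ⊥}

/-- Almost semifree in the dimensional sense: the orbits required to have isolated components are
those of non-maximal dimension. -/
def IsAlmostSemifreeDim (d n : ℕ) (G Q : Type*) [Group G] [TopologicalSpace G]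
    [ChartedSpace (EuclideanSpace ℝ (Fin d)) G] [LieGroup (𝓡 d) ∞ G] [TopologicalSpace Q]
    [ChartedSpace (EuclideanSpace ℝ (Fin n)) Q] [MulAction G Q] : Prop :=
  IsAlmostSemifreeAlong d n G Q {q : Q | OrbitHasNonMaximalDim d G q}

end AlmostSemifree

/-! Everything passes through one condition, `IsotropyFixesNoVector`: no element `h ≠ 1` of an
isotropy group fixes a non-zero tangent vector at the point. If `h` fixes a ray of covectors at `q`,
then `h` fixes `q` and scales a covector by a positive factor. Properness makes the isotropy group
compact, so the factor is `1`. A linear map fixes a non-zero vector exactly when its transpose does,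
so freeness of the lift is this condition (`cosphereLiftIsFree_iff_isotropyFixesNoVector`).

The condition implies (a), (b), (c). The differential of the orbit map identifies `𝔤 / 𝔥`
equivariantly with the tangent space of the orbit, so (c) is the restriction of the condition to
orbit directions. Near `(h, q)` with `h ≠ 1`, the invertibility of `1 - T_q h` pushes all fixed
points into the orbit of `q` (`eventually_mem_orbit_of_smul_eq`). Properness and the absence of
small subgroups turn this into isolation: stabilizer elements of points tending to `q` have powers
that accumulate at some `h ≠ 1` fixing `q`. Thus the non-free points near `q` lie in one orbit. It
is not open, so it has lower dimension and is locally null; second countability gives (a).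

Conversely, suppose `h ≠ 1` fixes a tangent vector `v`. Averaging over the compact isotropy group
linearizes the action near `q`, which yields a curve of `h`-fixed points with velocity `v`
(`exists_curve_of_fixedPoints`). By (b) the curve stays in the orbit, so `v` is tangent to it, and
(c) gives `v = 0`.

For (b'), a free orbit has the largest possible dimension `d`, so (b) implies (b'). If `G` is
connected, (c) prevents a non-trivial isotropy group from having zero Lie algebra, for then `Ad_h`
would fix only zero, which forces `h = 1` (`eq_one_of_adjoint_fixes_only_zero`). Since (a) provides
a free orbit, non-trivial isotropy then means non-maximal dimension, and (b') implies (b). -/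

/-! ### The constant rank theorem -/

section ConstantRank

open Filter Topology Module

variable {A E : Type*} [NormedAddCommGroup A] [NormedSpace ℝ A]
  [NormedAddCommGroup E] [NormedSpace ℝ E]

/-- Project onto the range of `B`, then apply a linear section of `B`. Thus `B ∘ σ` projects onto
the range of `B`, and `σ ∘ B` is a projection with the kernel of `B`. -/
theorem ContinuousLinearMap.exists_generalizedInverse [FiniteDimensional ℝ E] (B : A →L[ℝ] E) :
    ∃ σ : E →L[ℝ] A, (∀ x, B (σ (B x)) = B x) ∧ ∀ y, σ (B (σ y)) = σ y := by
  obtain ⟨r, hr⟩ := B.toLinearMap.rangeRestrict.exists_rightInverse_of_surjective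
    (LinearMap.range_rangeRestrict _)
  obtain ⟨p, hp⟩ := B.range.subtype.exists_leftInverse_of_injective B.range.ker_subtype
  have h1 : ∀ y, B (r y) = y := fun y => congrArg Subtype.val (DFunLike.congr_fun hr y)
  have h2 : ∀ y : B.range, p (y : E) = y := fun y => DFunLike.congr_fun hp y
  refine ⟨LinearMap.toContinuousLinearMap (r ∘ₗ p), fun x => ?_, fun y => ?_⟩
  · change B (r (p (B x))) = B x
    rw [h1]
    exact congrArg Subtype.val (h2 ⟨B x, x, rfl⟩)
  · change r (p (B (r (p y)))) = r (p y)
    rw [h1, h2]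

/-- Since `σ` is injective on the range of `B`, the hypothesis gives `ker C ≤ ker B`; the rank bound
makes the two dimensions agree. -/
theorem LinearMap.ker_le_ker_of_comp_eq [FiniteDimensional ℝ A] {C B : A →ₗ[ℝ] E} {σ : E →ₗ[ℝ] A}
    (hσ : ∀ x, B (σ (B x)) = B x) (h : ∀ x, σ (C x) = σ (B x))
    (hr : finrank ℝ (LinearMap.range C) ≤ finrank ℝ (LinearMap.range B)) :
    LinearMap.ker B ≤ LinearMap.ker C := by
  have hle : LinearMap.ker C ≤ LinearMap.ker B := by
    intro x hx
    have : C x = 0 := hx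
    have h2 : σ (B x) = 0 := by rw [← h x, this, map_zero]
    show B x = 0
    rw [← hσ x, h2, map_zero]
  have h1 := C.finrank_range_add_finrank_ker
  have h2 := B.finrank_range_add_finrank_ker
  rw [Submodule.eq_of_le_of_finrank_le hle (by omega)]

/-- The segment from `p w` to `w` has direction in `K`, so `G` has zero derivative along it. -/
theorem eventually_eq_of_fderiv_eq_zero_on {G : A → E} {K : Submodule ℝ A} {p : A →L[ℝ] A}
    (hG : ∀ᶠ w in 𝓝 (0 : A), DifferentiableAt ℝ G w)
    (hK : ∀ᶠ w in 𝓝 (0 : A), ∀ v ∈ K, fderiv ℝ G w v = 0) (hp : ∀ w, w - p w ∈ K) :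
    ∀ᶠ w in 𝓝 (0 : A), G w = G (p w) := by
  obtain ⟨ε, hε, hb⟩ := Metric.eventually_nhds_iff_ball.1 (hG.and hK)
  have h1 : ∀ᶠ w in 𝓝 (0 : A), p w ∈ Metric.ball (0 : A) ε := by
    apply p.continuous.continuousAt.eventually_mem
    rw [map_zero]
    exact Metric.ball_mem_nhds _ hε
  filter_upwards [h1, Metric.ball_mem_nhds (0 : A) hε] with w hw1 hw2
  have hseg : ∀ t ∈ Set.Icc (0 : ℝ) 1, p w + t • (w - p w) ∈ Metric.ball (0 : A) ε := by
    intro t ht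
    exact (convex_ball (0 : A) ε).add_smul_sub_mem hw1 hw2 ht
  have hd : ∀ t ∈ Set.Icc (0 : ℝ) 1,
      HasDerivAt (fun t : ℝ => G (p w + t • (w - p w))) 0 t := by
    intro t ht
    obtain ⟨hd, hz⟩ := hb _ (hseg t ht)
    have hl : HasDerivAt (fun t : ℝ => p w + t • (w - p w)) (w - p w) t := by
      simpa using ((hasDerivAt_id t).smul_const (w - p w)).const_add (p w)
    have := hd.hasFDerivAt.comp_hasDerivAt t hl
    rwa [hz _ (hp w)] at this
  have := constant_of_has_deriv_right_zero (f := fun t : ℝ => G (p w + t • (w - p w)))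
    (a := 0) (b := 1) (fun t ht => (hd t ht).continuousAt.continuousWithinAt)
    (fun t ht => (hd t ⟨ht.1, ht.2.le⟩).hasDerivWithinAt) 1 ⟨zero_le_one, le_rfl⟩
  simpa using this

/-- The constant rank theorem. -/
theorem ContDiffAt.exists_constantRank_normalForm [FiniteDimensional ℝ A]
    [FiniteDimensional ℝ E] {f : A → E} {u₀ : A} {B : A →L[ℝ] E}
    (hf : ContDiffAt ℝ 1 f u₀) (hB : HasFDerivAt f B u₀)
    (hr : ∀ᶠ u in 𝓝 u₀, finrank ℝ (fderiv ℝ f u).range ≤ finrank ℝ B.range) :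
    ∃ (σ : E →L[ℝ] A) (c : A → A), (∀ x, B (σ (B x)) = B x) ∧ (∀ y, σ (B (σ y)) = σ y) ∧
      ContDiffAt ℝ 1 c 0 ∧ c 0 = u₀ ∧ HasFDerivAt c (ContinuousLinearMap.id ℝ A) 0 ∧
      (∀ᶠ u in 𝓝 u₀, f u = f (c (σ (f u - f u₀)))) ∧
      ∀ᶠ w in 𝓝 (0 : A), B w = 0 → f (c w) = f u₀ := by
  obtain ⟨σ, hσ1, hσ2⟩ := B.exists_generalizedInverse
  -- Straightening coordinates: the component of `u - u₀` along `ker B` is kept and the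
  -- complementary one is replaced by `σ (f u - f u₀)`. The derivative at `u₀` is the identity, and
  -- `c` below is the local inverse.
  let Ψ : A → A := fun u => σ (f u - f u₀) + ((u - u₀) - σ (B (u - u₀)))
  have hΨ0 : Ψ u₀ = 0 := by simp [Ψ]
  have hΨc : ContDiffAt ℝ 1 Ψ u₀ := by
    have h1 : ContDiffAt ℝ 1 (fun u => u - u₀) u₀ := contDiffAt_id.sub contDiffAt_const
    exact (σ.contDiff.contDiffAt.comp u₀ (hf.sub contDiffAt_const)).add
      (h1.sub (σ.contDiff.contDiffAt.comp u₀ (B.contDiff.contDiffAt.comp u₀ h1)))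
  have hΨd : HasFDerivAt Ψ ((ContinuousLinearEquiv.refl ℝ A : A ≃L[ℝ] A) : A →L[ℝ] A) u₀ := by
    have h1 : HasFDerivAt (fun u => u - u₀) (ContinuousLinearMap.id ℝ A) u₀ :=
      (hasFDerivAt_id u₀).sub_const u₀
    have h := (σ.hasFDerivAt.comp u₀ (hB.sub_const (f u₀))).add
      (h1.sub (σ.hasFDerivAt.comp u₀ (B.hasFDerivAt.comp u₀ h1)))
    rw [ContinuousLinearMap.comp_id, add_sub_cancel] at h
    exact h
  let c : A → A := hΨc.localInverse hΨd one_ne_zero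
  have hc1 : ContDiffAt ℝ 1 c 0 := hΨ0 ▸ hΨc.to_localInverse hΨd one_ne_zero
  have hc0 : c 0 = u₀ := by
    have := hΨc.localInverse_apply_image hΨd one_ne_zero
    rwa [hΨ0] at this
  have hs := hΨc.hasStrictFDerivAt' hΨd one_ne_zero
  have hleft : ∀ᶠ u in 𝓝 u₀, c (Ψ u) = u := hs.eventually_left_inverse
  have hright : ∀ᶠ w in 𝓝 (0 : A), Ψ (c w) = w := by
    have := hs.eventually_right_inverse
    rwa [hΨ0] at this
  have hcd : HasFDerivAt c (ContinuousLinearMap.id ℝ A) 0 := by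
    have := hs.to_localInverse.hasFDerivAt
    rw [hΨ0] at this
    exact this
  have hcc : Tendsto c (𝓝 0) (𝓝 u₀) := by
    have := hc1.continuousAt.tendsto
    rwa [hc0] at this
  have hEΨ : ∀ u, σ (B (Ψ u)) = σ (f u - f u₀) := by
    intro u
    simp only [Ψ, map_add, map_sub, hσ1, hσ2]
    simp
  have hΨt : Tendsto Ψ (𝓝 u₀) (𝓝 0) := by
    have := hΨc.continuousAt.tendsto
    rwa [hΨ0] at this
  have hGc : ContDiffAt ℝ 1 (fun w => f (c w)) 0 := by
    apply ContDiffAt.comp (0 : A) _ hc1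
    rwa [hc0]
  have hfe : ∀ᶠ u in 𝓝 u₀, DifferentiableAt ℝ f u :=
    (hf.eventually (by simp)).mono fun u hu => hu.differentiableAt one_ne_zero
  have hce : ∀ᶠ w in 𝓝 (0 : A), DifferentiableAt ℝ c w :=
    (hc1.eventually (by simp)).mono fun u hu => hu.differentiableAt one_ne_zero
  have hG1 : ∀ᶠ w in 𝓝 (0 : A), DifferentiableAt ℝ (fun w => f (c w)) w :=
    (hGc.eventually (by simp)).mono fun u hu => hu.differentiableAt one_ne_zero
  -- In the new coordinates `σ ∘ f` is affine with linear part `σ ∘ B`. As the rank of `f ∘ c` does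
  -- not exceed that of `B`, its derivative must kill `ker B` at every nearby point.
  have hG2 : ∀ᶠ w in 𝓝 (0 : A), ∀ v ∈ LinearMap.ker B.toLinearMap,
      fderiv ℝ (fun w => f (c w)) w v = 0 := by
    filter_upwards [hcc.eventually hfe, hce, hcc.eventually hr, hright.eventually_nhds, hG1]
      with w h1 h2 h3 h4 h5 v hv
    have hchain : fderiv ℝ (fun w => f (c w)) w = (fderiv ℝ f (c w)).comp (fderiv ℝ c w) :=
      fderiv_comp w h1 h2
    refine LinearMap.ker_le_ker_of_comp_eq (C := (fderiv ℝ (fun w => f (c w)) w).toLinearMap)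
      (B := B.toLinearMap) (σ := σ.toLinearMap) hσ1 ?_ ?_ hv
    · intro x
      have e : (fun w => σ (B w)) =ᶠ[𝓝 w] fun w => σ (f (c w) - f u₀) := by
        filter_upwards [h4] with w hw
        rw [← hEΨ, hw]
      have d1 : HasFDerivAt (fun w => σ (B w)) (σ.comp B) w :=
        (σ.comp B).hasFDerivAt
      have d2 : HasFDerivAt (fun w => σ (f (c w) - f u₀))
          (σ.comp (fderiv ℝ (fun w => f (c w)) w)) w :=
        σ.hasFDerivAt.comp w (h5.hasFDerivAt.sub_const _)
      have := d1.unique (d2.congr_of_eventuallyEq e)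
      exact (DFunLike.congr_fun this x).symm
    · refine le_trans (Submodule.finrank_mono ?_) h3
      rw [hchain]
      rintro _ ⟨x, rfl⟩
      exact ⟨fderiv ℝ c w x, rfl⟩
  have hG := eventually_eq_of_fderiv_eq_zero_on (p := σ.comp B) hG1 hG2 (fun w => by
    show B (w - σ (B w)) = 0
    rw [map_sub, hσ1, sub_self])
  refine ⟨σ, c, hσ1, hσ2, hc1, hc0, hcd, ?_, ?_⟩
  · filter_upwards [hleft, hΨt.eventually hG] with u h1 h2
    rw [h1] at h2
    rw [← hEΨ]
    exact h2
  · filter_upwards [hG] with w h1 hw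
    rw [h1]
    simp [hw, hc0]

/-- The image of a map of constant rank is tangent to the range of the derivative. -/
theorem tangent_of_constantRank {f : A → E} {u₀ : A} {B : A →L[ℝ] E} {σ : E →L[ℝ] A} {c : A → A}
    (hB : HasFDerivAt f B u₀) (hc0 : c 0 = u₀)
    (hc : HasFDerivAt c (ContinuousLinearMap.id ℝ A) 0)
    (h : ∀ᶠ u in 𝓝 u₀, f u = f (c (σ (f u - f u₀)))) {ε : ℝ} (hε : 0 < ε) :
    ∀ᶠ u in 𝓝 u₀, ‖(f u - f u₀) - B (σ (f u - f u₀))‖ ≤ ε * ‖f u - f u₀‖ := by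
  -- Since `f u` is the value of `f ∘ c` at `σ (f u - f u₀)`, the expansion of `f ∘ c` at `0` has an
  -- error controlled by the displacement of the image itself, not by `u - u₀`.
  have hG : HasFDerivAt (fun w => f (c w)) B 0 := by
    have := (show HasFDerivAt f B (c 0) by rwa [hc0]).comp (0 : A) hc
    rwa [ContinuousLinearMap.comp_id] at this
  have ho := hG.isLittleO
  have ht : Tendsto (fun u => σ (f u - f u₀)) (𝓝 u₀) (𝓝 0) := by
    have h1 : ContinuousAt (fun u => σ (f u - f u₀)) u₀ :=
      σ.continuous.continuousAt.comp (hB.continuousAt.sub continuousAt_const)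
    have := h1.tendsto
    rwa [sub_self, map_zero] at this
  obtain ⟨δ, hδ, hδε⟩ : ∃ δ : ℝ, 0 < δ ∧ δ * ‖σ‖ ≤ ε :=
    ⟨ε / (‖σ‖ + 1), by positivity, by
      rw [div_mul_eq_mul_div, div_le_iff₀ (by positivity)]
      nlinarith [norm_nonneg σ]⟩
  filter_upwards [h, ht.eventually (ho.def hδ)] with u h1 h2
  rw [← h1, hc0, sub_zero] at h2
  calc _ ≤ δ * ‖σ (f u - f u₀)‖ := h2
    _ ≤ δ * (‖σ‖ * ‖f u - f u₀‖) := by gcongr; exact σ.le_opNorm _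
    _ = (δ * ‖σ‖) * ‖f u - f u₀‖ := by ring
    _ ≤ _ := by gcongr

end ConstantRank

/-! ### Maps and neighbourhoods in charts of manifolds without boundary -/

section Charts

open Filter Topology

variable {E : Type*} [NormedAddCommGroup E] [NormedSpace ℝ E]
  {M : Type*} [TopologicalSpace M] [ChartedSpace E M]
  {F : Type*} [NormedAddCommGroup F] [NormedSpace ℝ F]
  {N : Type*} [TopologicalSpace N] [ChartedSpace F N]

theorem eventually_extChartAt_symm_extChartAt {c q : M} (h : q ∈ (extChartAt 𝓘(ℝ, E) c).source) :
    ∀ᶠ x in 𝓝 q, (extChartAt 𝓘(ℝ, E) c).symm (extChartAt 𝓘(ℝ, E) c x) = x :=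
  Filter.mem_of_superset (extChartAt_source_mem_nhds' h) fun _ hx =>
    (extChartAt 𝓘(ℝ, E) c).left_inv hx

theorem extChartAt_target_mem_nhds_of_boundaryless {c q : M}
    (h : q ∈ (extChartAt 𝓘(ℝ, E) c).source) :
    (extChartAt 𝓘(ℝ, E) c).target ∈ 𝓝 (extChartAt 𝓘(ℝ, E) c q) :=
  (isOpen_extChartAt_target c).mem_nhds ((extChartAt 𝓘(ℝ, E) c).map_source h)

theorem eventually_extChartAt_extChartAt_symm {c q : M} (h : q ∈ (extChartAt 𝓘(ℝ, E) c).source) :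
    ∀ᶠ y in 𝓝 (extChartAt 𝓘(ℝ, E) c q),
      extChartAt 𝓘(ℝ, E) c ((extChartAt 𝓘(ℝ, E) c).symm y) = y :=
  Filter.mem_of_superset (extChartAt_target_mem_nhds_of_boundaryless h) fun _ hx =>
    (extChartAt 𝓘(ℝ, E) c).right_inv hx

theorem tendsto_extChartAt_symm {c q : M} (h : q ∈ (extChartAt 𝓘(ℝ, E) c).source) :
    Tendsto (extChartAt 𝓘(ℝ, E) c).symm (𝓝 (extChartAt 𝓘(ℝ, E) c q)) (𝓝 q) := by
  have := (continuousAt_extChartAt_symm' h).tendsto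
  rwa [(extChartAt 𝓘(ℝ, E) c).left_inv h] at this

theorem tendsto_extChartAt {c q : M} (h : q ∈ (extChartAt 𝓘(ℝ, E) c).source) :
    Tendsto (extChartAt 𝓘(ℝ, E) c) (𝓝 q) (𝓝 (extChartAt 𝓘(ℝ, E) c q)) :=
  continuousAt_extChartAt' h

theorem map_extChartAt_symm_nhds_of_boundaryless {c q : M}
    (h : q ∈ (extChartAt 𝓘(ℝ, E) c).source) :
    map (extChartAt 𝓘(ℝ, E) c).symm (𝓝 (extChartAt 𝓘(ℝ, E) c q)) = 𝓝 q := by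
  refine le_antisymm (tendsto_extChartAt_symm h) ?_
  intro s hs
  filter_upwards [tendsto_extChartAt h hs, eventually_extChartAt_symm_extChartAt h] with x h1 h2
  rw [← h2]
  exact h1

theorem contMDiffAt_extChartAt_symm_of_mem [IsManifold 𝓘(ℝ, E) ∞ M] {c q : M}
    (h : q ∈ (extChartAt 𝓘(ℝ, E) c).source) :
    ContMDiffAt 𝓘(ℝ, E) 𝓘(ℝ, E) ∞ (extChartAt 𝓘(ℝ, E) c).symm (extChartAt 𝓘(ℝ, E) c q) :=
  (contMDiffOn_extChartAt_symm c).contMDiffAt (extChartAt_target_mem_nhds_of_boundaryless h)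

theorem contMDiffAt_extChartAt_of_mem [IsManifold 𝓘(ℝ, E) ∞ M] {c q : M}
    (h : q ∈ (extChartAt 𝓘(ℝ, E) c).source) :
    ContMDiffAt 𝓘(ℝ, E) 𝓘(ℝ, E) ∞ (extChartAt 𝓘(ℝ, E) c) q :=
  contMDiffAt_extChartAt' (by rwa [extChartAt_source] at h)

theorem ContMDiffAt.contDiffAt_inCharts [IsManifold 𝓘(ℝ, E) ∞ M] [IsManifold 𝓘(ℝ, F) ∞ N]
    {f : M → N} {c q : M} {c' : N} (h : q ∈ (extChartAt 𝓘(ℝ, E) c).source)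
    (h' : f q ∈ (extChartAt 𝓘(ℝ, F) c').source) (hf : ContMDiffAt 𝓘(ℝ, E) 𝓘(ℝ, F) ∞ f q) :
    ContDiffAt ℝ ∞ (fun y => extChartAt 𝓘(ℝ, F) c' (f ((extChartAt 𝓘(ℝ, E) c).symm y)))
      (extChartAt 𝓘(ℝ, E) c q) := by
  have e : (extChartAt 𝓘(ℝ, E) c).symm (extChartAt 𝓘(ℝ, E) c q) = q :=
    (extChartAt 𝓘(ℝ, E) c).left_inv h
  refine ContMDiffAt.contDiffAt ?_
  have h1 : ContMDiffAt 𝓘(ℝ, E) 𝓘(ℝ, F) ∞ (fun y => f ((extChartAt 𝓘(ℝ, E) c).symm y))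
      (extChartAt 𝓘(ℝ, E) c q) :=
    ContMDiffAt.comp _ (by rwa [e]) (contMDiffAt_extChartAt_symm_of_mem h)
  exact ContMDiffAt.comp _ (contMDiffAt_extChartAt_of_mem (by rwa [e])) h1

theorem MDifferentiableAt.hasFDerivAt_inCharts {f : M → N} {x : M} {y : N}
    (hf : MDifferentiableAt 𝓘(ℝ, E) 𝓘(ℝ, F) f x) (hy : f x = y) :
    HasFDerivAt (fun u => extChartAt 𝓘(ℝ, F) y (f ((extChartAt 𝓘(ℝ, E) x).symm u)))
      (mfderiv 𝓘(ℝ, E) 𝓘(ℝ, F) f x : E →L[ℝ] F) (extChartAt 𝓘(ℝ, E) x x) := by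
  subst hy
  have h := hf.hasMFDerivAt.2
  rw [ModelWithCorners.range_eq_univ] at h
  exact HasFDerivWithinAt.hasFDerivAt (E := E) (F := F) h univ_mem

theorem MDifferentiableAt.hasFDerivAt_inChart {γ : E → N} {x : E} {y : N}
    (hγ : MDifferentiableAt 𝓘(ℝ, E) 𝓘(ℝ, F) γ x) (hy : γ x = y) :
    HasFDerivAt (fun u => extChartAt 𝓘(ℝ, F) y (γ u))
      (mfderiv 𝓘(ℝ, E) 𝓘(ℝ, F) γ x : E →L[ℝ] F) x :=
  hγ.hasFDerivAt_inCharts hy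

end Charts

theorem contMDiff_const_smul_of_contMDiffSMul (d n : ℕ) {G Q : Type*} [Group G]
    [TopologicalSpace G] [ChartedSpace (EuclideanSpace ℝ (Fin d)) G] [TopologicalSpace Q]
    [ChartedSpace (EuclideanSpace ℝ (Fin n)) Q] [MulAction G Q]
    [ContMDiffSMul (𝓡 d) (𝓡 n) ∞ G Q] (g : G) :
    ContMDiff (𝓡 n) (𝓡 n) ∞ (fun x : Q => g • x) :=
  (ContMDiffSMul.contMDiff_smul (I := 𝓡 d) (I' := 𝓡 n) (n := ∞) (G := G) (M := Q)).comp
    (contMDiff_const.prodMk contMDiff_id)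

/-! ### Orbit maps have constant rank -/

section Action

open Filter Topology Module

variable (d n : ℕ) {G Q : Type*} [Group G] [TopologicalSpace G]
  [ChartedSpace (EuclideanSpace ℝ (Fin d)) G] [TopologicalSpace Q]
  [ChartedSpace (EuclideanSpace ℝ (Fin n)) Q] [MulAction G Q]

variable (G) in
/-- The coordinates of the identity of a Lie group in its preferred chart. -/
noncomputable def unitCoord : EuclideanSpace ℝ (Fin d) := extChartAt (𝓡 d) (1 : G) 1

variable (G) in
/-- The inverse of the preferred chart at the identity. -/
noncomputable def unitChartSymm : EuclideanSpace ℝ (Fin d) → G := (extChartAt (𝓡 d) (1 : G)).symm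

variable (G) in
/-- The orbit map of `q` in the chart at the identity and the chart at `c`. -/
noncomputable def orbitMapInCharts (c q : Q) (u : EuclideanSpace ℝ (Fin d)) :
    EuclideanSpace ℝ (Fin n) :=
  extChartAt (𝓡 n) c (unitChartSymm d G u • q)

/-- The differential at `q` of the action of `h`, as an endomorphism if `h` fixes `q`. -/
noncomputable def isotropyDiff (q : Q) (h : G) :
    EuclideanSpace ℝ (Fin n) →L[ℝ] EuclideanSpace ℝ (Fin n) :=
  mfderiv (𝓡 n) (𝓡 n) (fun x : Q => h • x) q

variable (G) in
/-- The differential at the identity of the orbit map of `q`. -/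
noncomputable def orbitDiff (q : Q) : EuclideanSpace ℝ (Fin d) →L[ℝ] EuclideanSpace ℝ (Fin n) :=
  fderiv ℝ (orbitMapInCharts d n G q q) (unitCoord d G)

/-- The action near `(h, q)`, in coordinates. -/
noncomputable def actionInCharts (q : Q) (h : G)
    (p : EuclideanSpace ℝ (Fin d) × EuclideanSpace ℝ (Fin n)) : EuclideanSpace ℝ (Fin n) :=
  extChartAt (𝓡 n) q ((unitChartSymm d G p.1 * h) • (extChartAt (𝓡 n) q).symm p.2)

theorem unitChartSymm_unitCoord : unitChartSymm d G (unitCoord d G) = 1 :=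
  extChartAt_to_inv (I := 𝓡 d) (1 : G)

theorem map_unitChartSymm : map (unitChartSymm d G) (𝓝 (unitCoord d G)) = 𝓝 1 :=
  map_extChartAt_symm_nhds_of_boundaryless (mem_extChartAt_source (1 : G))

theorem tendsto_unitChartSymm : Tendsto (unitChartSymm d G) (𝓝 (unitCoord d G)) (𝓝 1) :=
  (map_unitChartSymm d).le

variable [LieGroup (𝓡 d) ∞ G] [IsManifold (𝓡 n) ∞ Q] [ContMDiffSMul (𝓡 d) (𝓡 n) ∞ G Q]

theorem contMDiffAt_unitChartSymm :
    ContMDiffAt (𝓡 d) (𝓡 d) ∞ (unitChartSymm d G) (unitCoord d G) :=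
  contMDiffAt_extChartAt_symm_of_mem (mem_extChartAt_source (1 : G))

omit [LieGroup (𝓡 d) ∞ G] [IsManifold (𝓡 n) ∞ Q] in
theorem contMDiff_orbitMap (q : Q) : ContMDiff (𝓡 d) (𝓡 n) ∞ (fun g : G => g • q) :=
  (ContMDiffSMul.contMDiff_smul (I := 𝓡 d) (I' := 𝓡 n) (n := ∞) (G := G) (M := Q)).comp
    (contMDiff_id.prodMk contMDiff_const)

omit [LieGroup (𝓡 d) ∞ G] [IsManifold (𝓡 n) ∞ Q] [ContMDiffSMul (𝓡 d) (𝓡 n) ∞ G Q] in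
theorem orbitMapInCharts_unitCoord (c q : Q) :
    orbitMapInCharts d n G c q (unitCoord d G) = extChartAt (𝓡 n) c q := by
  simp [orbitMapInCharts, unitChartSymm_unitCoord]

theorem contDiffAt_orbitMapInCharts {c q : Q} (hq : q ∈ (extChartAt (𝓡 n) c).source) :
    ContDiffAt ℝ ∞ (orbitMapInCharts d n G c q) (unitCoord d G) :=
  ContMDiffAt.contDiffAt_inCharts (f := fun g : G => g • q) (mem_extChartAt_source (1 : G))
    (by simpa using hq) (contMDiff_orbitMap d n q 1)

/-- By equivariance, the orbit map near `g` is the orbit map near `1` preceded by translation by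
`g⁻¹` and followed by the action of `g`. The chain rule bounds its rank by the rank at `1`. -/
theorem finrank_range_fderiv_orbitMapInCharts_le {c q : Q}
    (hq : q ∈ (extChartAt (𝓡 n) c).source) :
    ∀ᶠ u in 𝓝 (unitCoord d G),
      finrank ℝ (fderiv ℝ (orbitMapInCharts d n G c q) u).range ≤
        finrank ℝ (fderiv ℝ (orbitMapInCharts d n G c q) (unitCoord d G)).range := by
  have hcont : Continuous (fun g : G => g • q) := (contMDiff_orbitMap d n q).continuous
  have hu : ∀ᶠ u in 𝓝 (unitCoord d G), u ∈ (extChartAt (𝓡 d) (1 : G)).target :=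
    extChartAt_target_mem_nhds_of_boundaryless (mem_extChartAt_source (1 : G))
  have hs : ∀ᶠ u in 𝓝 (unitCoord d G),
      unitChartSymm d G u • q ∈ (extChartAt (𝓡 n) c).source := by
    have h1 : Tendsto (fun u => unitChartSymm d G u • q) (𝓝 (unitCoord d G)) (𝓝 q) := by
      have := (hcont.tendsto 1).comp (tendsto_unitChartSymm d (G := G))
      rwa [one_smul] at this
    exact h1 (extChartAt_source_mem_nhds' hq)
  filter_upwards [hu, hs] with u hu hs
  set g := unitChartSymm d G u with hg
  have hgs : g ∈ (extChartAt (𝓡 d) (1 : G)).source := (extChartAt (𝓡 d) (1 : G)).map_target hu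
  have hgu : extChartAt (𝓡 d) (1 : G) g = u := (extChartAt (𝓡 d) (1 : G)).right_inv hu
  let τ : EuclideanSpace ℝ (Fin d) → EuclideanSpace ℝ (Fin d) := fun v =>
    extChartAt (𝓡 d) (1 : G) (g⁻¹ * unitChartSymm d G v)
  let a : EuclideanSpace ℝ (Fin n) → EuclideanSpace ℝ (Fin n) := fun y =>
    extChartAt (𝓡 n) c (g • (extChartAt (𝓡 n) c).symm y)
  have hτ : ContDiffAt ℝ ∞ τ u := by
    have := ContMDiffAt.contDiffAt_inCharts (f := fun x : G => g⁻¹ * x) (c' := (1 : G)) hgs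
      (by simp) (contMDiff_mul_left (I := 𝓡 d) (n := ∞) (a := g⁻¹) g)
    rwa [hgu] at this
  have hτu : τ u = unitCoord d G := by
    change extChartAt (𝓡 d) (1 : G) (g⁻¹ * g) = _
    rw [inv_mul_cancel]
    rfl
  have ha : ContDiffAt ℝ ∞ a (extChartAt (𝓡 n) c q) :=
    ContMDiffAt.contDiffAt_inCharts (f := fun x : Q => g • x) hq hs
      (contMDiff_const_smul_of_contMDiffSMul d n g q)
  have hf := contDiffAt_orbitMapInCharts d n (G := G) hq
  have hτc : Tendsto (fun v => g⁻¹ * unitChartSymm d G v) (𝓝 u) (𝓝 1) := by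
    have := topologicalGroup_of_lieGroup (G := G) (𝓡 d) ∞
    have h1 : Tendsto (unitChartSymm d G) (𝓝 u) (𝓝 g) := by
      have := tendsto_extChartAt_symm hgs
      rwa [hgu] at this
    have := h1.const_mul g⁻¹
    rwa [inv_mul_cancel] at this
  have e : orbitMapInCharts d n G c q =ᶠ[𝓝 u]
      fun v => a (orbitMapInCharts d n G c q (τ v)) := by
    have h2 : Tendsto (fun v => (g⁻¹ * unitChartSymm d G v) • q) (𝓝 u) (𝓝 q) := by
      have := (hcont.tendsto 1).comp hτc
      rwa [one_smul] at this
    filter_upwards [hτc (extChartAt_source_mem_nhds (I := 𝓡 d) (1 : G)),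
      h2 (extChartAt_source_mem_nhds' hq)] with v h1 h2
    have e1 : unitChartSymm d G (τ v) = g⁻¹ * unitChartSymm d G v :=
      (extChartAt (𝓡 d) (1 : G)).left_inv h1
    simp only [a, orbitMapInCharts, e1]
    rw [(extChartAt (𝓡 n) c).left_inv h2]
    simp only [mul_smul, smul_inv_smul]
  have hfd : HasFDerivAt (orbitMapInCharts d n G c q)
      (fderiv ℝ (orbitMapInCharts d n G c q) (unitCoord d G)) (τ u) := by
    rw [hτu]
    exact (hf.differentiableAt (by simp)).hasFDerivAt
  have had : HasFDerivAt a (fderiv ℝ a (extChartAt (𝓡 n) c q))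
      (orbitMapInCharts d n G c q (τ u)) := by
    rw [hτu, orbitMapInCharts_unitCoord]
    exact (ha.differentiableAt (by simp)).hasFDerivAt
  have hd := had.comp u (hfd.comp u (hτ.differentiableAt (by simp)).hasFDerivAt)
  rw [(hd.congr_of_eventuallyEq e).fderiv]
  refine le_trans (Submodule.finrank_mono (t := Submodule.map
    (fderiv ℝ a (extChartAt (𝓡 n) c q)).toLinearMap
    (fderiv ℝ (orbitMapInCharts d n G c q) (unitCoord d G)).range) ?_)
    (Submodule.finrank_map_le _ _)
  rintro _ ⟨x, rfl⟩
  exact ⟨_, ⟨fderiv ℝ τ u x, rfl⟩, rfl⟩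

/-- The chart centre `c` may differ from `q`, because null sets are tested in a fixed chart. -/
theorem exists_orbit_normalForm {c q : Q} (hq : q ∈ (extChartAt (𝓡 n) c).source) :
    ∃ (σ : EuclideanSpace ℝ (Fin n) →L[ℝ] EuclideanSpace ℝ (Fin d))
      (k : EuclideanSpace ℝ (Fin d) → EuclideanSpace ℝ (Fin d)),
      (∀ x, fderiv ℝ (orbitMapInCharts d n G c q) (unitCoord d G)
        (σ (fderiv ℝ (orbitMapInCharts d n G c q) (unitCoord d G) x)) =
          fderiv ℝ (orbitMapInCharts d n G c q) (unitCoord d G) x) ∧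
      (∀ y, σ (fderiv ℝ (orbitMapInCharts d n G c q) (unitCoord d G) (σ y)) = σ y) ∧
      ContDiffAt ℝ 1 k 0 ∧ k 0 = unitCoord d G ∧
      HasFDerivAt k (ContinuousLinearMap.id ℝ _) 0 ∧
      (∀ᶠ u in 𝓝 (unitCoord d G), orbitMapInCharts d n G c q u =
        orbitMapInCharts d n G c q
          (k (σ (orbitMapInCharts d n G c q u - orbitMapInCharts d n G c q (unitCoord d G))))) ∧
      ∀ᶠ w in 𝓝 0, fderiv ℝ (orbitMapInCharts d n G c q) (unitCoord d G) w = 0 →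
        orbitMapInCharts d n G c q (k w) = orbitMapInCharts d n G c q (unitCoord d G) :=
  have hf := contDiffAt_orbitMapInCharts d n (G := G) hq
  (hf.of_le (by exact_mod_cast le_top)).exists_constantRank_normalForm
    (hf.differentiableAt (by simp)).hasFDerivAt
    (finrank_range_fderiv_orbitMapInCharts_le d n hq)

end Action

/-! ### The isotropy representation and the tangent space of the orbit -/

section Isotropy

open Filter Topology Module

variable (d n : ℕ) {G Q : Type*} [Group G] [TopologicalSpace G]
  [ChartedSpace (EuclideanSpace ℝ (Fin d)) G] [TopologicalSpace Q]
  [ChartedSpace (EuclideanSpace ℝ (Fin n)) Q] [MulAction G Q]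
  [LieGroup (𝓡 d) ∞ G] [IsManifold (𝓡 n) ∞ Q]

theorem hasFDerivAt_orbitMapInCharts [ContMDiffSMul (𝓡 d) (𝓡 n) ∞ G Q] (q : Q) :
    HasFDerivAt (orbitMapInCharts d n G q q) (orbitDiff d n G q) (unitCoord d G) :=
  ((contDiffAt_orbitMapInCharts d n (mem_extChartAt_source q)).differentiableAt
    (by simp)).hasFDerivAt

omit [LieGroup (𝓡 d) ∞ G] [IsManifold (𝓡 n) ∞ Q] in
theorem hasFDerivAt_smul_inCharts [ContMDiffSMul (𝓡 d) (𝓡 n) ∞ G Q] {q : Q} {h : G} (hq : h • q = q) :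
    HasFDerivAt (fun y => extChartAt (𝓡 n) q (h • (extChartAt (𝓡 n) q).symm y))
      (isotropyDiff n q h) (extChartAt (𝓡 n) q q) :=
  MDifferentiableAt.hasFDerivAt_inCharts
    ((contMDiff_const_smul_of_contMDiffSMul d n h).mdifferentiable (by simp) q) hq

theorem contDiffAt_actionInCharts [ContMDiffSMul (𝓡 d) (𝓡 n) ∞ G Q] {q : Q} {h : G} (hq : h • q = q) :
    ContDiffAt ℝ ∞ (actionInCharts d n q h) (unitCoord d G, extChartAt (𝓡 n) q q) := by
  have e : (extChartAt (𝓡 n) q).symm (extChartAt (𝓡 n) q q) = q := extChartAt_to_inv q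
  refine ContMDiffAt.contDiffAt ?_
  have h1 : ContMDiffAt 𝓘(ℝ, EuclideanSpace ℝ (Fin d) × EuclideanSpace ℝ (Fin n)) (𝓡 d) ∞
      (fun p : EuclideanSpace ℝ (Fin d) × EuclideanSpace ℝ (Fin n) => unitChartSymm d G p.1 * h)
      (unitCoord d G, extChartAt (𝓡 n) q q) :=
    ((contMDiff_mul_right (I := 𝓡 d) (n := ∞) (a := h)) _).comp _
      ((contMDiffAt_unitChartSymm d (G := G)).comp (unitCoord d G, extChartAt (𝓡 n) q q)
        contDiff_fst.contMDiff.contMDiffAt)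
  have h2 : ContMDiffAt 𝓘(ℝ, EuclideanSpace ℝ (Fin d) × EuclideanSpace ℝ (Fin n)) (𝓡 n) ∞
      (fun p : EuclideanSpace ℝ (Fin d) × EuclideanSpace ℝ (Fin n) =>
        (extChartAt (𝓡 n) q).symm p.2) (unitCoord d G, extChartAt (𝓡 n) q q) :=
    (contMDiffAt_extChartAt_symm_of_mem (mem_extChartAt_source q)).comp
      (unitCoord d G, extChartAt (𝓡 n) q q) contDiff_snd.contMDiff.contMDiffAt
  have h3 := (ContMDiffSMul.contMDiff_smul (I := 𝓡 d) (I' := 𝓡 n) (n := ∞) (G := G) (M := Q)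
    (unitChartSymm d G (unitCoord d G) * h,
      (extChartAt (𝓡 n) q).symm (extChartAt (𝓡 n) q q))).comp
    (unitCoord d G, extChartAt (𝓡 n) q q) (h1.prodMk h2)
  refine ContMDiffAt.comp _ ?_ h3
  refine contMDiffAt_extChartAt_of_mem ?_
  simp only [e, unitChartSymm_unitCoord, one_mul, hq]
  exact mem_extChartAt_source q

/-- The two partial derivatives determine the derivative: as `h` fixes `q`, they come from the orbit
map and from the action of `h` alone. Strictness supplies estimates uniform in group elements near
`h`. -/
theorem hasStrictFDerivAt_actionInCharts [ContMDiffSMul (𝓡 d) (𝓡 n) ∞ G Q] {q : Q} {h : G} (hq : h • q = q) :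
    HasStrictFDerivAt (actionInCharts d n q h)
      ((orbitDiff d n G q).coprod (isotropyDiff n q h))
      (unitCoord d G, extChartAt (𝓡 n) q q) := by
  have e : (extChartAt (𝓡 n) q).symm (extChartAt (𝓡 n) q q) = q := extChartAt_to_inv q
  have hs := (contDiffAt_actionInCharts d n hq).hasStrictFDerivAt (by simp)
  have hd := hs.hasFDerivAt
  have h1 := hd.comp (f := fun u => (u, extChartAt (𝓡 n) q q)) (unitCoord d G)
    (hasFDerivAt_prodMk_left _ _)
  have h2 := hd.comp (f := fun y => (unitCoord d G, y)) (extChartAt (𝓡 n) q q)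
    (hasFDerivAt_prodMk_right _ _)
  have e1 : (actionInCharts d n q h ∘ fun u => (u, extChartAt (𝓡 n) q q)) =
      orbitMapInCharts d n G q q := by
    funext u
    simp only [Function.comp, actionInCharts, orbitMapInCharts, e, mul_smul, hq]
  have e2 : (actionInCharts d n q h ∘ fun y => (unitCoord d G, y)) =
      fun y => extChartAt (𝓡 n) q (h • (extChartAt (𝓡 n) q).symm y) := by
    funext u
    simp only [Function.comp, actionInCharts, unitChartSymm_unitCoord, one_mul]
  rw [e1] at h1
  rw [e2] at h2
  have h1' := h1.unique (hasFDerivAt_orbitMapInCharts d n q)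
  have h2' := h2.unique (hasFDerivAt_smul_inCharts d n hq)
  rw [← h1', ← h2', ContinuousLinearMap.coprod_comp_inl_inr]
  exact hs

omit [TopologicalSpace G] [IsManifold (𝓡 n) ∞ Q] in
theorem isotropyDiff_one (q : Q) : isotropyDiff n q (1 : G) = ContinuousLinearMap.id ℝ _ := by
  have h : (fun x : Q => (1 : G) • x) = id := by
    funext x
    simp
  unfold isotropyDiff
  rw [h, mfderiv_id]
  rfl

omit [LieGroup (𝓡 d) ∞ G] [IsManifold (𝓡 n) ∞ Q] in
theorem isotropyDiff_mul [ContMDiffSMul (𝓡 d) (𝓡 n) ∞ G Q] {q : Q} {g h : G} (hg : g • q = q) (hh : h • q = q) :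
    isotropyDiff n q (g * h) = (isotropyDiff n q g).comp (isotropyDiff n q h) := by
  have e : (extChartAt (𝓡 n) q).symm (extChartAt (𝓡 n) q q) = q := extChartAt_to_inv q
  have hgh : (g * h) • q = q := by rw [mul_smul, hh, hg]
  have h1 := hasFDerivAt_smul_inCharts d n hgh
  have h2 : HasFDerivAt (fun y => extChartAt (𝓡 n) q (g • (extChartAt (𝓡 n) q).symm y))
      (isotropyDiff n q g) (extChartAt (𝓡 n) q (h • (extChartAt (𝓡 n) q).symm
        (extChartAt (𝓡 n) q q))) := by
    rw [e, hh]
    exact hasFDerivAt_smul_inCharts d n hg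
  have h3 := h2.comp (f := fun y => extChartAt (𝓡 n) q (h • (extChartAt (𝓡 n) q).symm y)) _
    (hasFDerivAt_smul_inCharts d n hh)
  refine h1.unique (h3.congr_of_eventuallyEq ?_)
  have ht : Tendsto (fun y => h • (extChartAt (𝓡 n) q).symm y) (𝓝 (extChartAt (𝓡 n) q q))
      (𝓝 q) := by
    have := ((contMDiff_const_smul_of_contMDiffSMul d n h).continuous.tendsto q).comp
      (tendsto_extChartAt_symm (mem_extChartAt_source (I := 𝓡 n) q))
    rwa [hh] at this
  filter_upwards [ht.eventually (eventually_extChartAt_symm_extChartAt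
    (mem_extChartAt_source (I := 𝓡 n) q))] with y hy
  simp only [Function.comp, hy, mul_smul]

/-- Strict differentiability is applied to two points with the same group coordinate, so the orbit
directions cancel. -/
theorem eventually_norm_smul_inCharts_sub_le [ContMDiffSMul (𝓡 d) (𝓡 n) ∞ G Q] {q : Q} {h : G} (hq : h • q = q) {ε : ℝ}
    (hε : 0 < ε) :
    ∀ᶠ p : G × (EuclideanSpace ℝ (Fin n) × EuclideanSpace ℝ (Fin n)) in
      𝓝 (h, (extChartAt (𝓡 n) q q, extChartAt (𝓡 n) q q)),
      ‖extChartAt (𝓡 n) q (p.1 • (extChartAt (𝓡 n) q).symm p.2.1) -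
          extChartAt (𝓡 n) q (p.1 • (extChartAt (𝓡 n) q).symm p.2.2) -
          isotropyDiff n q h (p.2.1 - p.2.2)‖ ≤ ε * ‖p.2.1 - p.2.2‖ := by
  have := topologicalGroup_of_lieGroup (G := G) (𝓡 d) ∞
  have hs := (hasStrictFDerivAt_actionInCharts d n hq).isLittleO.def hε
  have hc : Tendsto (fun g : G => g * h⁻¹) (𝓝 h) (𝓝 1) := by
    have : Continuous fun g : G => g * h⁻¹ := by fun_prop
    simpa using this.tendsto h
  have hψ : Tendsto (fun g : G => extChartAt (𝓡 d) (1 : G) (g * h⁻¹)) (𝓝 h)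
      (𝓝 (unitCoord d G)) :=
    (tendsto_extChartAt (E := EuclideanSpace ℝ (Fin d)) (mem_extChartAt_source (1 : G))).comp hc
  have ht : Tendsto (fun p : G × (EuclideanSpace ℝ (Fin n) × EuclideanSpace ℝ (Fin n)) =>
      ((extChartAt (𝓡 d) (1 : G) (p.1 * h⁻¹), p.2.1),
        (extChartAt (𝓡 d) (1 : G) (p.1 * h⁻¹), p.2.2)))
      (𝓝 (h, (extChartAt (𝓡 n) q q, extChartAt (𝓡 n) q q)))
      (𝓝 ((unitCoord d G, extChartAt (𝓡 n) q q), (unitCoord d G, extChartAt (𝓡 n) q q))) := by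
    have h1 := hψ.comp (continuous_fst.tendsto
      (h, (extChartAt (𝓡 n) q q, extChartAt (𝓡 n) q q)))
    have h2 := (continuous_fst.comp continuous_snd).tendsto
      (h, (extChartAt (𝓡 n) q q, extChartAt (𝓡 n) q q))
    have h3 := (continuous_snd.comp continuous_snd).tendsto
      (h, (extChartAt (𝓡 n) q q, extChartAt (𝓡 n) q q))
    exact (h1.prodMk_nhds h2).prodMk_nhds (h1.prodMk_nhds h3)
  have hl := (hc.comp (continuous_fst.tendsto
    (h, (extChartAt (𝓡 n) q q, extChartAt (𝓡 n) q q)))).eventually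
      (eventually_extChartAt_symm_extChartAt (E := EuclideanSpace ℝ (Fin d))
        (mem_extChartAt_source (1 : G)))
  filter_upwards [ht.eventually hs, hl] with p h1 h2
  have e : unitChartSymm d G (extChartAt (𝓡 d) (1 : G) (p.1 * h⁻¹)) * h = p.1 := by
    have : unitChartSymm d G (extChartAt (𝓡 d) (1 : G) (p.1 * h⁻¹)) = p.1 * h⁻¹ := h2
    rw [this, inv_mul_cancel_right]
  simp only [actionInCharts, e] at h1
  simpa [Prod.norm_def] using h1

/-- For `g` near `h`, the uniform estimate bounds the variation at `q` of the action of `g` minus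
the linear map of `h`; this bounds the norm of the difference of derivatives. -/
theorem tendsto_isotropyDiff [ContMDiffSMul (𝓡 d) (𝓡 n) ∞ G Q] {q : Q} {h : G} (hq : h • q = q) :
    Tendsto (isotropyDiff n q) (𝓝[MulAction.stabilizer G q] h) (𝓝 (isotropyDiff n q h)) := by
  rw [Metric.tendsto_nhds]
  intro ε hε
  have h1 := eventually_norm_smul_inCharts_sub_le d n hq (half_pos hε)
  rw [nhds_prod_eq] at h1
  have h2 := h1.curry
  rw [eventually_nhdsWithin_iff]
  filter_upwards [h2] with g hg hgq
  refine lt_of_le_of_lt ?_ (half_lt_self hε)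
  rw [dist_eq_norm]
  have hgq' : g • q = q := hgq
  rw [nhds_prod_eq] at hg
  have hg' : ∀ᶠ y in 𝓝 (extChartAt (𝓡 n) q q),
      ‖(extChartAt (𝓡 n) q (g • (extChartAt (𝓡 n) q).symm y) - isotropyDiff n q h y) -
          (extChartAt (𝓡 n) q (g • (extChartAt (𝓡 n) q).symm (extChartAt (𝓡 n) q q)) -
            isotropyDiff n q h (extChartAt (𝓡 n) q q))‖ ≤
        ε / 2 * ‖y - extChartAt (𝓡 n) q q‖ := by
    filter_upwards [(hg.curry).mono fun y hy => hy.self_of_nhds] with y hy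
    refine le_trans (le_of_eq ?_) hy
    congr 1
    rw [map_sub]
    abel
  have hd := (hasFDerivAt_smul_inCharts d n hgq').sub (isotropyDiff n q h).hasFDerivAt
  exact hd.le_of_lip' (half_pos hε).le hg'

theorem continuous_isotropyDiff [ContMDiffSMul (𝓡 d) (𝓡 n) ∞ G Q] (q : Q) :
    Continuous fun k : MulAction.stabilizer G q => isotropyDiff n q (k : G) := by
  rw [continuous_iff_continuousAt]
  intro k
  have := tendsto_isotropyDiff d n (MulAction.mem_stabilizer_iff.1 k.2)
  exact this.comp (tendsto_nhdsWithin_iff.2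
    ⟨continuous_subtype_val.tendsto k, Eventually.of_forall fun x => x.2⟩)

/-- Differentiate `h • (x • q) = (h * x * h⁻¹) • q` at `x = 1`; the identity holds because `h` fixes
`q`. -/
theorem isotropyDiff_orbitDiff [ContMDiffSMul (𝓡 d) (𝓡 n) ∞ G Q] {q : Q} {h : G} (hq : h • q = q) (ξ : EuclideanSpace ℝ (Fin d)) :
    isotropyDiff n q h (orbitDiff d n G q ξ) = orbitDiff d n G q (Ad d h ξ) := by
  have := topologicalGroup_of_lieGroup (G := G) (𝓡 d) ∞
  have hs : ContMDiff (𝓡 d) (𝓡 d) ∞ (fun x : G => h * x * h⁻¹) :=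
    (contMDiff_mul_right (I := 𝓡 d) (n := ∞) (a := h⁻¹)).comp
      (contMDiff_mul_left (I := 𝓡 d) (n := ∞) (a := h))
  have hκ : HasFDerivAt (fun u => extChartAt (𝓡 d) (1 : G) (h * unitChartSymm d G u * h⁻¹))
      (Ad d h : EuclideanSpace ℝ (Fin d) →L[ℝ] EuclideanSpace ℝ (Fin d)) (unitCoord d G) :=
    MDifferentiableAt.hasFDerivAt_inCharts (hs.mdifferentiable (by simp) (1 : G)) (by simp)
  have hκu : extChartAt (𝓡 d) (1 : G) (h * unitChartSymm d G (unitCoord d G) * h⁻¹) =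
      unitCoord d G := by
    rw [unitChartSymm_unitCoord, mul_one, mul_inv_cancel]
    rfl
  have hf := hasFDerivAt_orbitMapInCharts d n (G := G) q
  have h1 : HasFDerivAt (orbitMapInCharts d n G q q) (orbitDiff d n G q)
    (extChartAt (𝓡 d) (1 : G) (h * unitChartSymm d G (unitCoord d G) * h⁻¹)) := by rwa [hκu]
  have h2 := h1.comp (f := fun u => extChartAt (𝓡 d) (1 : G) (h * unitChartSymm d G u * h⁻¹))
    _ hκ
  have h3 : HasFDerivAt (fun y => extChartAt (𝓡 n) q (h • (extChartAt (𝓡 n) q).symm y))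
      (isotropyDiff n q h) (orbitMapInCharts d n G q q (unitCoord d G)) := by
    rw [orbitMapInCharts_unitCoord]
    exact hasFDerivAt_smul_inCharts d n hq
  have h4 := h3.comp _ hf
  have hcont : Continuous (fun g : G => g • q) := (contMDiff_orbitMap d n q).continuous
  have t1 : Tendsto (fun u => unitChartSymm d G u • q) (𝓝 (unitCoord d G)) (𝓝 q) := by
    have := (hcont.tendsto 1).comp (tendsto_unitChartSymm d (G := G))
    rwa [one_smul] at this
  have t2 : Tendsto (fun u => h * unitChartSymm d G u * h⁻¹) (𝓝 (unitCoord d G)) (𝓝 1) := by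
    have := ((tendsto_unitChartSymm d (G := G)).const_mul h).mul_const h⁻¹
    simpa using this
  have h5 := h2.congr_of_eventuallyEq (f₁ := (fun y => extChartAt (𝓡 n) q
      (h • (extChartAt (𝓡 n) q).symm y)) ∘ orbitMapInCharts d n G q q) (by
    filter_upwards [t1.eventually (eventually_extChartAt_symm_extChartAt
      (mem_extChartAt_source (I := 𝓡 n) q)), t2.eventually (eventually_extChartAt_symm_extChartAt
      (mem_extChartAt_source (I := 𝓡 d) (1 : G)))] with u hu1 hu2
    have hu3 : unitChartSymm d G (extChartAt (𝓡 d) (1 : G) (h * unitChartSymm d G u * h⁻¹)) =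
      h * unitChartSymm d G u * h⁻¹ := hu2
    have hq' : h⁻¹ • q = q := inv_smul_eq_iff.2 hq.symm
    simp only [Function.comp, orbitMapInCharts, hu1, hu3, mul_smul, hq'])
  exact DFunLike.congr_fun (h4.unique h5) ξ

/-- Near `1` this is the constant rank estimate. It moves to `h₀` because `g` and `g * h₀⁻¹` send
`q` to the same point. -/
theorem eventually_tangent_orbit [ContMDiffSMul (𝓡 d) (𝓡 n) ∞ G Q] {q : Q} {σ : EuclideanSpace ℝ (Fin n) →L[ℝ] EuclideanSpace ℝ (Fin d)}
    {k : EuclideanSpace ℝ (Fin d) → EuclideanSpace ℝ (Fin d)} (hk0 : k 0 = unitCoord d G)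
    (hk : HasFDerivAt k (ContinuousLinearMap.id ℝ _) 0)
    (h : ∀ᶠ u in 𝓝 (unitCoord d G), orbitMapInCharts d n G q q u =
        orbitMapInCharts d n G q q
          (k (σ (orbitMapInCharts d n G q q u - orbitMapInCharts d n G q q (unitCoord d G)))))
    {h₀ : G} (hq : h₀ • q = q) {ε : ℝ} (hε : 0 < ε) :
    ∀ᶠ g in 𝓝 h₀, ‖extChartAt (𝓡 n) q (g • q) - extChartAt (𝓡 n) q q -
        orbitDiff d n G q (σ (extChartAt (𝓡 n) q (g • q) - extChartAt (𝓡 n) q q))‖ ≤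
      ε * ‖extChartAt (𝓡 n) q (g • q) - extChartAt (𝓡 n) q q‖ := by
  have := topologicalGroup_of_lieGroup (G := G) (𝓡 d) ∞
  have ht := tangent_of_constantRank (hasFDerivAt_orbitMapInCharts d n q) hk0 hk h hε
  have h1 : ∀ᶠ g in 𝓝 (1 : G), ‖extChartAt (𝓡 n) q (g • q) - extChartAt (𝓡 n) q q -
        orbitDiff d n G q (σ (extChartAt (𝓡 n) q (g • q) - extChartAt (𝓡 n) q q))‖ ≤
      ε * ‖extChartAt (𝓡 n) q (g • q) - extChartAt (𝓡 n) q q‖ := by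
    rw [← map_unitChartSymm d, eventually_map]
    filter_upwards [ht] with u hu
    rwa [orbitMapInCharts_unitCoord] at hu
  have hc : Tendsto (fun g : G => g * h₀⁻¹) (𝓝 h₀) (𝓝 1) := by
    have : Continuous fun g : G => g * h₀⁻¹ := by fun_prop
    simpa using this.tendsto h₀
  filter_upwards [hc.eventually h1] with g hg
  have hq' : h₀⁻¹ • q = q := inv_smul_eq_iff.2 hq.symm
  rwa [mul_smul, hq'] at hg

/-- In the normal form the orbit map is constant along the kernel of its derivative, so the
straightened line `t • ξ` gives a curve in the stabilizer for small `t`. -/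
theorem exists_isVelocityAtOne_of_orbitDiff_eq_zero [ContMDiffSMul (𝓡 d) (𝓡 n) ∞ G Q] {q : Q}
    {ξ : EuclideanSpace ℝ (Fin d)} (hξ : orbitDiff d n G q ξ = 0) :
    ∃ γ : ℝ → G, IsVelocityAtOne d (MulAction.stabilizer G q) γ ξ := by
  obtain ⟨σ, k, -, -, hk1, hk0, hkd, -, hz⟩ :=
    exists_orbit_normalForm d n (G := G) (mem_extChartAt_source (I := 𝓡 n) q)
  let c : ℝ → G := fun t => unitChartSymm d G (k (t • ξ))
  have hline : HasFDerivAt (fun t : ℝ => t • ξ)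
      (ContinuousLinearMap.toSpanSingleton ℝ ξ) 0 :=
    (ContinuousLinearMap.toSpanSingleton ℝ ξ).hasFDerivAt
  have hc0 : c 0 = 1 := by
    change unitChartSymm d G (k ((0 : ℝ) • ξ)) = 1
    rw [zero_smul, hk0, unitChartSymm_unitCoord]
  have hline0 : HasFDerivAt k (ContinuousLinearMap.id ℝ _)
      ((0 : ℝ) • ξ) := by
    rwa [zero_smul]
  have hkl := hline0.comp (0 : ℝ) hline
  have hkt : Tendsto (fun t : ℝ => k (t • ξ)) (𝓝 0) (𝓝 (unitCoord d G)) := by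
    have := hkl.continuousAt.tendsto
    rwa [Function.comp, zero_smul, hk0] at this
  have hct : Tendsto c (𝓝 0) (𝓝 1) := (tendsto_unitChartSymm d).comp hkt
  have hcH : ∀ᶠ t in 𝓝 (0 : ℝ), c t ∈ MulAction.stabilizer G q := by
    have hcont : Continuous (fun g : G => g • q) := (contMDiff_orbitMap d n q).continuous
    have t1 : Tendsto (fun t => c t • q) (𝓝 0) (𝓝 q) := by
      have := (hcont.tendsto 1).comp hct
      rwa [one_smul] at this
    have t2 : Tendsto (fun t : ℝ => t • ξ) (𝓝 0) (𝓝 0) := by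
      have := hline.continuousAt.tendsto
      rwa [zero_smul] at this
    filter_upwards [t1.eventually (extChartAt_source_mem_nhds (I := 𝓡 n) q), t2.eventually hz]
      with t h1 h2
    refine MulAction.mem_stabilizer_iff.2 ((extChartAt (𝓡 n) q).injOn h1
      (mem_extChartAt_source q) ?_)
    have h3 : orbitDiff d n G q (t • ξ) = 0 := by
      rw [map_smul, hξ, smul_zero]
    have := h2 h3
    rwa [orbitMapInCharts_unitCoord] at this
  classical
  -- `IsVelocityAtOne` asks for values in the subgroup at all times, while the curve is only known
  -- to lie there near `0`; it is replaced by `1` wherever it leaves.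
  let γ : ℝ → G := fun t => if c t ∈ MulAction.stabilizer G q then c t else 1
  have hγc : γ =ᶠ[𝓝 0] c := hcH.mono fun t ht => if_pos ht
  have hγ0 : γ 0 = 1 := hγc.self_of_nhds.trans hc0
  have hcd : MDifferentiableAt 𝓘(ℝ, ℝ) (𝓡 d) c 0 := by
    have h1 : MDifferentiableAt (𝓡 d) (𝓡 d) (unitChartSymm d G) (k ((0 : ℝ) • ξ)) := by
      rw [zero_smul, hk0]
      exact (contMDiffAt_unitChartSymm d).mdifferentiableAt (by simp)
    exact h1.comp (0 : ℝ) hkl.differentiableAt.mdifferentiableAt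
  have hγd : MDifferentiableAt 𝓘(ℝ, ℝ) (𝓡 d) γ 0 := hcd.congr_of_eventuallyEq hγc
  refine ⟨γ, hγ0, fun t => ?_, hγd, ?_⟩
  · by_cases h : c t ∈ MulAction.stabilizer G q
    · simp only [γ, if_pos h, h]
    · simp only [γ, if_neg h, one_mem]
  · have h2 := MDifferentiableAt.hasFDerivAt_inChart hγd hγ0
    have h3 : HasFDerivAt (fun u : ℝ => extChartAt (𝓡 d) (1 : G) (γ u))
        ((ContinuousLinearMap.id ℝ _).comp (ContinuousLinearMap.toSpanSingleton ℝ ξ)) 0 := by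
      refine hkl.congr_of_eventuallyEq ?_
      filter_upwards [hγc, hkt.eventually (extChartAt_target_mem_nhds_of_boundaryless
        (mem_extChartAt_source (I := 𝓡 d) (1 : G)))] with t ht1 ht2
      rw [ht1]
      exact (extChartAt (𝓡 d) (1 : G)).right_inv ht2
    exact (DFunLike.congr_fun (h3.unique h2) (1 : ℝ)).symm.trans (one_smul ℝ ξ)

/-- The orbit map is constant along a curve in the stabilizer, and the converse is the preceding
construction. Hence `orbitDiff` embeds `𝔤 / 𝔥` into the tangent space at `q`. -/
theorem mem_subgroupLieAlgebra_stabilizer_iff [ContMDiffSMul (𝓡 d) (𝓡 n) ∞ G Q] (q : Q) (ξ : GroupLieAlgebra (𝓡 d) G) :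
    ξ ∈ subgroupLieAlgebra d (MulAction.stabilizer G q) ↔ orbitDiff d n G q ξ = 0 := by
  have hf := hasFDerivAt_orbitMapInCharts d n (G := G) q
  constructor
  · rintro ⟨γ, h0, hH, hd, rfl⟩
    have h1 := MDifferentiableAt.hasFDerivAt_inChart hd h0
    have h2 : HasFDerivAt (orbitMapInCharts d n G q q) (orbitDiff d n G q)
        (extChartAt (𝓡 d) (1 : G) (γ 0)) := by
      rw [h0]
      exact hf
    have h3 := h2.comp (f := fun u : ℝ => extChartAt (𝓡 d) (1 : G) (γ u)) _ h1
    have h4 : HasFDerivAt (fun _ : ℝ => extChartAt (𝓡 n) q q) (0 : ℝ →L[ℝ] _) (0 : ℝ) :=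
      hasFDerivAt_const _ _
    have ht : Tendsto γ (𝓝 0) (𝓝 1) := by
      have := hd.continuousAt.tendsto
      rwa [h0] at this
    have h5 := h4.unique (h3.congr_of_eventuallyEq (by
      filter_upwards [ht.eventually (eventually_extChartAt_symm_extChartAt
        (mem_extChartAt_source (I := 𝓡 d) (1 : G)))] with t ht
      have e : unitChartSymm d G (extChartAt (𝓡 d) (1 : G) (γ t)) = γ t := ht
      have := MulAction.mem_stabilizer_iff.1 (hH t)
      simp only [Function.comp, orbitMapInCharts, e, this]))
    exact (DFunLike.congr_fun h5 (1 : ℝ)).symm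
  · exact exists_isVelocityAtOne_of_orbitDiff_eq_zero d n

end Isotropy

/-! ### Freeness of the lift as absence of fixed tangent vectors -/

section FreeLift

open Filter Topology Module

/-- Both sides say that `L - id` is singular: a fixed functional is one that annihilates its range.
-/
theorem ContinuousLinearMap.exists_fixed_iff_exists_fixed_dual {E : Type*} [NormedAddCommGroup E]
    [NormedSpace ℝ E] [FiniteDimensional ℝ E] (L : E →L[ℝ] E) :
    (∃ v, v ≠ 0 ∧ L v = v) ↔ ∃ α : E →L[ℝ] ℝ, α ≠ 0 ∧ ∀ v, α (L v) = α v := by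
  let T : E →ₗ[ℝ] E := L.toLinearMap - LinearMap.id
  have hT : ∀ v, T v = L v - v := fun v => rfl
  constructor
  · rintro ⟨v, hv, hLv⟩
    have h1 : ¬ Function.Injective T := fun h => hv (h (by rw [hT, hLv, map_zero, sub_self]))
    have h2 : LinearMap.range T < ⊤ := by
      rw [lt_top_iff_ne_top, Ne, LinearMap.range_eq_top, ← LinearMap.injective_iff_surjective]
      exact h1
    obtain ⟨f, hf, hle⟩ := Submodule.exists_le_ker_of_lt_top _ h2
    refine ⟨LinearMap.toContinuousLinearMap f, fun h => hf ?_, fun w => ?_⟩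
    · ext w
      exact DFunLike.congr_fun h w
    · have : f (T w) = 0 := hle ⟨w, rfl⟩
      rw [hT, map_sub, sub_eq_zero] at this
      exact this
  · rintro ⟨α, hα, h⟩
    have h1 : ¬ Function.Surjective T := by
      intro hs
      apply hα
      ext w
      obtain ⟨u, rfl⟩ := hs w
      rw [hT, map_sub, h, sub_self]
      rfl
    rw [← LinearMap.injective_iff_surjective, ← LinearMap.ker_eq_bot] at h1
    obtain ⟨v, hv, hv0⟩ := Submodule.exists_mem_ne_zero_of_ne_bot h1
    exact ⟨v, hv0, sub_eq_zero.1 hv⟩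

theorem isCompact_stabilizer_of_properSMul {G X : Type*} [Group G] [MulAction G X]
    [TopologicalSpace G] [TopologicalSpace X] [ProperSMul G X] (q : X) :
    IsCompact (MulAction.stabilizer G q : Set G) := by
  have h := ProperSMul.isCompact_setOfPred_inter_nonempty (G := G) (isCompact_singleton (x := q))
    (isCompact_singleton (x := q))
  convert h using 1
  ext g
  simp [MulAction.mem_stabilizer_iff, eq_comm]

/-- No isotropy group has a non-trivial element that fixes a non-zero tangent vector. -/
def IsotropyFixesNoVector (n : ℕ) (G Q : Type*) [Group G] [TopologicalSpace Q]
    [ChartedSpace (EuclideanSpace ℝ (Fin n)) Q] [MulAction G Q] : Prop :=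
  ∀ (q : Q) (h : G), h • q = q → h ≠ 1 → ∀ v, isotropyDiff n q h v = v → v = 0

theorem invDiff_of_smul_eq {n : ℕ} {G Q : Type*} [Group G] [TopologicalSpace Q]
    [ChartedSpace (EuclideanSpace ℝ (Fin n)) Q] [MulAction G Q] {q : Q} {h : G} (hq : h • q = q)
    (v : EuclideanSpace ℝ (Fin n)) :
    (invDiff n h q v : EuclideanSpace ℝ (Fin n)) = isotropyDiff n q h⁻¹ v := by
  unfold invDiff isotropyDiff
  rw [hq]
  rfl

variable (d n : ℕ) {G Q : Type*} [Group G] [TopologicalSpace G]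
  [ChartedSpace (EuclideanSpace ℝ (Fin d)) G] [TopologicalSpace Q]
  [ChartedSpace (EuclideanSpace ℝ (Fin n)) Q] [MulAction G Q]

theorem isotropyDiff_inv_apply_apply [ContMDiffSMul (𝓡 d) (𝓡 n) ∞ G Q] {q : Q} {h : G}
    (hq : h • q = q) (v : EuclideanSpace ℝ (Fin n)) :
    isotropyDiff n q h⁻¹ (isotropyDiff n q h v) = v := by
  have hq' : h⁻¹ • q = q := inv_smul_eq_iff.2 hq.symm
  have := isotropyDiff_mul d n hq' hq
  rw [inv_mul_cancel, isotropyDiff_one] at this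
  exact (DFunLike.congr_fun this v).symm

theorem isotropyDiff_apply_inv_apply [ContMDiffSMul (𝓡 d) (𝓡 n) ∞ G Q] {q : Q} {h : G}
    (hq : h • q = q) (v : EuclideanSpace ℝ (Fin n)) :
    isotropyDiff n q h (isotropyDiff n q h⁻¹ v) = v := by
  have hq' : h⁻¹ • q = q := inv_smul_eq_iff.2 hq.symm
  simpa using isotropyDiff_inv_apply_apply d n hq' v

theorem isotropyFixesNoVector_of_cosphereLiftIsFree [ContMDiffSMul (𝓡 d) (𝓡 n) ∞ G Q]
    (H : CosphereLiftIsFree d n G Q) : IsotropyFixesNoVector n G Q := by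
  intro q h hq h1 v hv
  by_contra hv0
  have hv' : isotropyDiff n q h⁻¹ v = v := by
    conv_lhs => rw [← hv]
    exact isotropyDiff_inv_apply_apply d n hq v
  obtain ⟨α, hα, hαL⟩ :=
    (isotropyDiff n q h⁻¹).exists_fixed_iff_exists_fixed_dual.1 ⟨v, hv0, hv'⟩
  let _ := cosphereAction d n G Q
  let p : PuncturedCotangentBundle n Q := ⟨⟨q, α⟩, hα⟩
  let x : CosphereBundle n Q := Quotient.mk (cosphereSetoid n Q) p
  have hmem : h ∈ MulAction.stabilizer G x := by
    have e : cotangentLift h p.1 = p.1 := by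
      refine CotangentBundle.ext' hq fun w => ?_
      exact (congrArg α (invDiff_of_smul_eq hq w)).trans (hαL w)
    exact congrArg (Quotient.mk (cosphereSetoid n Q)) (Subtype.ext e)
  rw [H] at hmem
  exact h1 (Subgroup.mem_bot.1 hmem)

variable [LieGroup (𝓡 d) ∞ G] [IsManifold (𝓡 n) ∞ Q]

theorem exists_norm_isotropyDiff_le [ContMDiffSMul (𝓡 d) (𝓡 n) ∞ G Q] [ProperSMul G Q] (q : Q) :
    ∃ C : ℝ, 0 ≤ C ∧ ∀ h : G, h • q = q → ‖isotropyDiff n q h‖ ≤ C := by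
  have hK : CompactSpace (MulAction.stabilizer G q) :=
    isCompact_iff_compactSpace.1 (isCompact_stabilizer_of_properSMul q)
  obtain ⟨C, hC⟩ := isCompact_univ.exists_bound_of_continuousOn
    (continuous_isotropyDiff d n (G := G) q).continuousOn
  exact ⟨max C 0, le_max_right _ _, fun h hq => (hC ⟨h, hq⟩ trivial).trans (le_max_left _ _)⟩

/-- Compactness of the isotropy group bounds its representation. If the factor were below `1`,
iterating the relation would express `α` as a quantity tending to zero. The same argument for `h⁻¹`
excludes factors above `1`. -/
theorem eq_one_of_dual_eigenvalue [ContMDiffSMul (𝓡 d) (𝓡 n) ∞ G Q] [ProperSMul G Q] {q : Q}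
    {h : G} (hq : h • q = q) {α : EuclideanSpace ℝ (Fin n) →L[ℝ] ℝ} (hα : α ≠ 0) {r : ℝ}
    (hr : 0 < r) (H : ∀ v, α v = r * α (isotropyDiff n q h v)) : r = 1 := by
  obtain ⟨C, hC0, hC⟩ := exists_norm_isotropyDiff_le d n (G := G) q
  have key : ∀ g : G, g • q = q → ∀ s : ℝ, 0 < s →
      (∀ v, α v = s * α (isotropyDiff n q g v)) → 1 ≤ s := by
    intro g hg s hs Hs
    by_contra! hlt
    have hpow : ∀ k : ℕ, g ^ k • q = q := by
      intro k
      exact (MulAction.stabilizer G q).pow_mem (MulAction.mem_stabilizer_iff.2 hg) k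
    have hk : ∀ (k : ℕ) v, α v = s ^ k * α (isotropyDiff n q (g ^ k) v) := by
      intro k
      induction k with
      | zero => intro v; simp [isotropyDiff_one]
      | succ k ih =>
        intro v
        rw [pow_succ', pow_succ, isotropyDiff_mul d n (hpow k) hg, Hs, ih]
        simp [mul_assoc]
    obtain ⟨v, hv⟩ : ∃ v, α v ≠ 0 := by
      by_contra! h0
      exact hα (ContinuousLinearMap.ext h0)
    have hb : ∀ k : ℕ, |α v| ≤ s ^ k * (‖α‖ * (C * ‖v‖)) := by
      intro k
      rw [hk k v, abs_mul, abs_of_pos (pow_pos hs k)]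
      gcongr
      refine (α.le_opNorm _).trans ?_
      gcongr
      exact ((isotropyDiff n q (g ^ k)).le_opNorm v).trans (by gcongr; exact hC _ (hpow k))
    have ht : Tendsto (fun k : ℕ => s ^ k * (‖α‖ * (C * ‖v‖))) atTop (𝓝 0) := by
      simpa using (tendsto_pow_atTop_nhds_zero_of_lt_one hs.le hlt).mul_const (‖α‖ * (C * ‖v‖))
    have := ge_of_tendsto' ht hb
    exact hv (abs_eq_zero.1 (le_antisymm this (abs_nonneg _)))
  have hq' : h⁻¹ • q = q := inv_smul_eq_iff.2 hq.symm
  refine le_antisymm ?_ (key h hq r hr H)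
  have := key h⁻¹ hq' r⁻¹ (inv_pos.2 hr) fun v => by
    rw [H (isotropyDiff n q h⁻¹ v), isotropyDiff_apply_inv_apply d n hq,
      inv_mul_cancel_left₀ hr.ne']
  exact (one_le_inv₀ hr).1 this

theorem cosphereLiftIsFree_of_isotropyFixesNoVector [ContMDiffSMul (𝓡 d) (𝓡 n) ∞ G Q]
    [ProperSMul G Q] (H : IsotropyFixesNoVector n G Q) : CosphereLiftIsFree d n G Q := by
  let _ := cosphereAction d n G Q
  intro x
  induction x using Quotient.inductionOn with
  | h p =>
    obtain ⟨⟨q, α⟩, hα⟩ := p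
    rw [Subgroup.eq_bot_iff_forall]
    intro h hh
    by_contra h1
    obtain ⟨r, hr, e⟩ := Quotient.exact
      (show Quotient.mk (cosphereSetoid n Q) ⟨cotangentLift h ⟨q, α⟩, _⟩ =
        Quotient.mk (cosphereSetoid n Q) ⟨⟨q, α⟩, hα⟩ from hh)
    have hq : h • q = q := (congrArg Bundle.TotalSpace.proj e).symm
    have hv : ∀ v : EuclideanSpace ℝ (Fin n), α v = r * α (isotropyDiff n q h⁻¹ v) := by
      intro v
      have := congrArg (fun p : CotangentBundle n Q => (p.snd (v : EuclideanSpace ℝ (Fin n)) : ℝ)) e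
      exact this.trans (congrArg (fun w => r * α w) (invDiff_of_smul_eq hq v))
    have hq' : h⁻¹ • q = q := inv_smul_eq_iff.2 hq.symm
    have hr1 := eq_one_of_dual_eigenvalue d n hq' hα hr hv
    obtain ⟨v, hv0, hvL⟩ := (isotropyDiff n q h⁻¹).exists_fixed_iff_exists_fixed_dual.2
      ⟨α, hα, fun v => ((hv v).trans (by rw [hr1, one_mul]; rfl)).symm⟩
    exact hv0 (H q h⁻¹ hq' (inv_ne_one.2 h1) v hvL)

theorem cosphereLiftIsFree_iff_isotropyFixesNoVector [ContMDiffSMul (𝓡 d) (𝓡 n) ∞ G Q]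
    [ProperSMul G Q] : CosphereLiftIsFree d n G Q ↔ IsotropyFixesNoVector n G Q :=
  ⟨isotropyFixesNoVector_of_cosphereLiftIsFree d n,
    cosphereLiftIsFree_of_isotropyFixesNoVector d n⟩

/-- The equivariant embedding of `𝔤 / 𝔥` given by `orbitDiff` translates condition (c) into a
statement about vectors tangent to the orbit. -/
theorem quotientAd_fixes_only_zero_iff [ContMDiffSMul (𝓡 d) (𝓡 n) ∞ G Q] {q : Q}
    (h : MulAction.stabilizer G q) :
    (∀ x : GroupLieAlgebra (𝓡 d) G ⧸ subgroupLieAlgebra d (MulAction.stabilizer G q),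
      quotientAd d (MulAction.stabilizer G q) h x = x → x = 0) ↔
    ∀ ξ : EuclideanSpace ℝ (Fin d), isotropyDiff n q (h : G) (orbitDiff d n G q ξ) =
      orbitDiff d n G q ξ → orbitDiff d n G q ξ = 0 := by
  have hq : (h : G) • q = q := h.2
  have h1 : ∀ ξ : GroupLieAlgebra (𝓡 d) G,
      quotientAd d (MulAction.stabilizer G q) h (Submodule.Quotient.mk ξ) =
        Submodule.Quotient.mk ξ ↔
      isotropyDiff n q (h : G) (orbitDiff d n G q ξ) = orbitDiff d n G q ξ := by
    intro ξ
    refine Iff.trans ?_ (Eq.congr (isotropyDiff_orbitDiff d n hq ξ) rfl).symm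
    refine (Submodule.Quotient.eq (subgroupLieAlgebra d (MulAction.stabilizer G q))
      (x := Ad d (h : G) ξ)).trans ?_
    rw [mem_subgroupLieAlgebra_stabilizer_iff d n]
    refine Iff.trans ?_ sub_eq_zero
    exact Eq.congr (map_sub (orbitDiff d n G q) _ _) rfl
  have h2 : ∀ ξ : GroupLieAlgebra (𝓡 d) G,
      (Submodule.Quotient.mk ξ : GroupLieAlgebra (𝓡 d) G ⧸
        subgroupLieAlgebra d (MulAction.stabilizer G q)) = 0 ↔ orbitDiff d n G q ξ = 0 := by
    intro ξ
    rw [Submodule.Quotient.mk_eq_zero, mem_subgroupLieAlgebra_stabilizer_iff d n]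
  constructor
  · intro H ξ hξ
    exact (h2 ξ).1 (H _ ((h1 ξ).2 hξ))
  · intro H x
    obtain ⟨ξ, rfl⟩ := Submodule.Quotient.mk_surjective _ x
    intro hx
    exact (h2 ξ).2 (H ξ ((h1 ξ).1 hx))

end FreeLift

/-! ### Fixed points near a point with non-trivial isotropy -/

section Slice

open Filter Topology Module

variable (d n : ℕ) {G Q : Type*} [Group G] [TopologicalSpace G]
  [ChartedSpace (EuclideanSpace ℝ (Fin d)) G] [TopologicalSpace Q]
  [ChartedSpace (EuclideanSpace ℝ (Fin n)) Q] [MulAction G Q]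
  [LieGroup (𝓡 d) ∞ G] [IsManifold (𝓡 n) ∞ Q]

theorem LinearMap.mem_of_map_mem_of_injective {E : Type*} [AddCommGroup E] [Module ℝ E]
    [FiniteDimensional ℝ E] {T : E →ₗ[ℝ] E} (hT : Function.Injective T) {R : Submodule ℝ E}
    (hR : ∀ x ∈ R, T x ∈ R) {x : E} (hx : T x ∈ R) : x ∈ R := by
  have hle : R.map T ≤ R := by
    rintro _ ⟨y, hy, rfl⟩
    exact hR y hy
  have he : R.map T = R := Submodule.eq_of_le_of_finrank_le hle
    (LinearEquiv.finrank_eq (Submodule.equivMapOfInjective T hT R)).le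
  rw [← he] at hx
  obtain ⟨y, hy, hyx⟩ := hx
  rwa [← hT hyx]

/-- Put `T = 1 - T_q h`. It is injective and preserves the orbit directions, so it stays injective
modulo them. If `g` near `h` fixes the slice point at `δ`, then `T δ` agrees with the displacement
of `q` under `g` up to `ε ‖δ‖`. That displacement is almost tangent to the orbit, so `T δ` nearly
vanishes modulo orbit directions, which forces `δ = 0`. -/
theorem eventually_fixed_slice_eq_zero [ContMDiffSMul (𝓡 d) (𝓡 n) ∞ G Q] {q : Q} {h : G}
    (hq : h • q = q) (hL : ∀ v, isotropyDiff n q h v = v → v = 0)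
    {D : Submodule ℝ (EuclideanSpace ℝ (Fin n))} (hD : Disjoint (orbitDiff d n G q).range D) :
    ∀ᶠ p : G × D in 𝓝 (h, 0),
      p.1 • (extChartAt (𝓡 n) q).symm (extChartAt (𝓡 n) q q + p.2) =
        (extChartAt (𝓡 n) q).symm (extChartAt (𝓡 n) q q + p.2) → p.2 = 0 := by
  have e : (extChartAt (𝓡 n) q).symm (extChartAt (𝓡 n) q q) = q := extChartAt_to_inv q
  obtain ⟨σ, k, -, -, -, hk0, hkd, hnf, -⟩ :=
    exists_orbit_normalForm d n (G := G) (mem_extChartAt_source (I := 𝓡 n) q)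
  set B := orbitDiff d n G q with hB
  set L := isotropyDiff n q h with hLdef
  let T := ContinuousLinearMap.id ℝ (EuclideanSpace ℝ (Fin n)) - L
  let P := ContinuousLinearMap.id ℝ (EuclideanSpace ℝ (Fin n)) - B.comp σ
  have hT : ∀ v, T v = v - L v := fun v => rfl
  have hP : ∀ v, P v = v - B (σ v) := fun v => rfl
  have hTi : Function.Injective T.toLinearMap := by
    rw [← LinearMap.ker_eq_bot, LinearMap.ker_eq_bot']
    intro v hv
    exact hL v (sub_eq_zero.1 hv).symm
  have hTR : ∀ x ∈ B.range, T.toLinearMap x ∈ B.range := by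
    rintro _ ⟨ξ, rfl⟩
    refine B.range.sub_mem ⟨ξ, rfl⟩ ⟨Ad d h ξ, ?_⟩
    exact (isotropyDiff_orbitDiff d n hq ξ).symm
  -- `P` vanishes exactly on the orbit directions, so `S` represents `T` on the slice modulo those
  -- directions.
  let S : D →ₗ[ℝ] EuclideanSpace ℝ (Fin n) := (P.comp (T.comp D.subtypeL)).toLinearMap
  have hS : LinearMap.ker S = ⊥ := by
    rw [LinearMap.ker_eq_bot']
    intro δ hδ
    have h1 : T δ = B (σ (T δ)) := sub_eq_zero.1 hδ
    have h2 : (δ : EuclideanSpace ℝ (Fin n)) ∈ B.range :=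
      LinearMap.mem_of_map_mem_of_injective hTi hTR ⟨σ (T δ), h1.symm⟩
    exact Subtype.ext (Submodule.disjoint_def.1 hD _ h2 δ.2)
  obtain ⟨K, hK0, hK⟩ := S.exists_antilipschitzWith hS
  -- `K` is the expansion constant of `S`, and `ε * (‖P‖ + ‖T‖ + 1)` will bound `‖S δ‖ / ‖δ‖`; their
  -- product must be below `1`.
  obtain ⟨ε, hε, hε1, hεK⟩ : ∃ ε : ℝ, 0 < ε ∧ ε ≤ 1 ∧ K * (ε * (‖P‖ + ‖T‖ + 1)) < 1 := by
    refine ⟨min 1 (1 / (2 * (K * (‖P‖ + ‖T‖ + 1)))), by positivity, min_le_left _ _, ?_⟩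
    have hc : 0 < (K : ℝ) * (‖P‖ + ‖T‖ + 1) := by positivity
    calc _ = min 1 (1 / (2 * (K * (‖P‖ + ‖T‖ + 1)))) * (K * (‖P‖ + ‖T‖ + 1)) := by ring
      _ ≤ (1 / (2 * (K * (‖P‖ + ‖T‖ + 1)))) * (K * (‖P‖ + ‖T‖ + 1)) := by
          gcongr
          exact min_le_right _ _
      _ = 1 / 2 := by field_simp
      _ < 1 := by norm_num
  have hst := eventually_norm_smul_inCharts_sub_le d n hq hε
  have htan := eventually_tangent_orbit d n hk0 hkd hnf hq hε
  have c1 : Tendsto (fun p : G × D => (p.1, (extChartAt (𝓡 n) q q + (p.2 : EuclideanSpace ℝ (Fin n)),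
      extChartAt (𝓡 n) q q))) (𝓝 (h, 0))
      (𝓝 (h, (extChartAt (𝓡 n) q q, extChartAt (𝓡 n) q q))) := by
    have : Continuous (fun p : G × D => (p.1, (extChartAt (𝓡 n) q q +
      (p.2 : EuclideanSpace ℝ (Fin n)), extChartAt (𝓡 n) q q))) := by fun_prop
    simpa using this.tendsto (h, 0)
  have c2 : Tendsto (fun p : G × D => extChartAt (𝓡 n) q q + (p.2 : EuclideanSpace ℝ (Fin n)))
      (𝓝 (h, 0)) (𝓝 (extChartAt (𝓡 n) q q)) := by
    have : Continuous (fun p : G × D => extChartAt (𝓡 n) q q +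
      (p.2 : EuclideanSpace ℝ (Fin n))) := by fun_prop
    simpa using this.tendsto (h, 0)
  filter_upwards [c1.eventually hst, (continuous_fst.tendsto (h, (0 : D))).eventually htan,
    c2.eventually (eventually_extChartAt_extChartAt_symm (mem_extChartAt_source (I := 𝓡 n) q))]
    with ⟨g, δ⟩ h1 h2 h3 hfix
  simp only at h1 h2 h3 hfix ⊢
  rw [hfix, h3, e, add_sub_cancel_left] at h1
  set z := extChartAt (𝓡 n) q (g • q) - extChartAt (𝓡 n) q q with hz
  have h1' : ‖T δ - z‖ ≤ ε * ‖δ‖ := by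
    refine le_trans (le_of_eq ?_) h1
    congr 1
    rw [hT, hz]
    abel
  have h2' : ‖P z‖ ≤ ε * ‖z‖ := h2
  have h4 : ‖z‖ ≤ (‖T‖ + 1) * ‖δ‖ := by
    calc ‖z‖ = ‖T δ - (T δ - z)‖ := by rw [sub_sub_cancel]
      _ ≤ ‖T δ‖ + ‖T δ - z‖ := norm_sub_le _ _
      _ ≤ ‖T‖ * ‖δ‖ + 1 * ‖δ‖ := by
          gcongr
          · exact T.le_opNorm _
          · exact h1'.trans (by gcongr)
      _ = _ := by ring
  have h5 : ‖S δ‖ ≤ ε * (‖P‖ + ‖T‖ + 1) * ‖δ‖ := by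
    calc ‖S δ‖ = ‖P (T δ - z) + P z‖ := by rw [← map_add, sub_add_cancel]; rfl
      _ ≤ ‖P (T δ - z)‖ + ‖P z‖ := norm_add_le _ _
      _ ≤ ‖P‖ * (ε * ‖δ‖) + ε * ((‖T‖ + 1) * ‖δ‖) := by
          gcongr
          · exact (P.le_opNorm _).trans (by gcongr)
          · exact h2'.trans (by gcongr)
      _ = _ := by ring
  have h6 : ‖δ‖ ≤ K * ‖S δ‖ := by
    have := hK.le_mul_dist δ 0
    simpa using this
  by_contra hδ
  have hpos : 0 < ‖δ‖ := norm_pos_iff.2 hδ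
  have h7 : ‖δ‖ ≤ (K * (ε * (‖P‖ + ‖T‖ + 1))) * ‖δ‖ := by
    refine h6.trans ?_
    rw [mul_assoc (K : ℝ)]
    gcongr
  nlinarith

/-- The derivative sends `(ξ, δ)` to the sum of an orbit direction and a slice direction, hence is
onto. Only surjectivity matters: the orbit parameters may be redundant. -/
theorem map_smul_slice_nhds [ContMDiffSMul (𝓡 d) (𝓡 n) ∞ G Q] {q : Q}
    {D : Submodule ℝ (EuclideanSpace ℝ (Fin n))} (hD : Codisjoint (orbitDiff d n G q).range D) :
    map (fun p : EuclideanSpace ℝ (Fin d) × D =>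
      unitChartSymm d G p.1 • (extChartAt (𝓡 n) q).symm (extChartAt (𝓡 n) q q + p.2))
      (𝓝 (unitCoord d G, 0)) = 𝓝 q := by
  have e : (extChartAt (𝓡 n) q).symm (extChartAt (𝓡 n) q q) = q := extChartAt_to_inv q
  have hs := hasStrictFDerivAt_actionInCharts d n (one_smul G q)
  rw [isotropyDiff_one] at hs
  let j : EuclideanSpace ℝ (Fin d) × D → EuclideanSpace ℝ (Fin d) × EuclideanSpace ℝ (Fin n) :=
    fun p => (p.1, extChartAt (𝓡 n) q q + (p.2 : EuclideanSpace ℝ (Fin n)))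
  have hj0 : j (unitCoord d G, 0) = (unitCoord d G, extChartAt (𝓡 n) q q) := by simp [j]
  have hj : HasStrictFDerivAt j ((ContinuousLinearMap.fst ℝ _ D).prod
      (D.subtypeL.comp (ContinuousLinearMap.snd ℝ (EuclideanSpace ℝ (Fin d)) D)))
      (unitCoord d G, 0) :=
    hasStrictFDerivAt_fst.prodMk
      ((D.subtypeL.hasStrictFDerivAt.comp _ hasStrictFDerivAt_snd).const_add _)
  rw [← hj0] at hs
  have hc := hs.comp _ hj
  have hm := hc.map_nhds_eq_of_surj (by
    rw [LinearMap.range_eq_top]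
    intro y
    obtain ⟨b, hb, δ, hδ, rfl⟩ := Submodule.mem_sup.1
      ((codisjoint_iff.1 hD).symm ▸ Submodule.mem_top : y ∈ (orbitDiff d n G q).range ⊔ D)
    obtain ⟨ξ, rfl⟩ := hb
    exact ⟨(ξ, ⟨δ, hδ⟩), rfl⟩)
  have hv : actionInCharts d n q (1 : G) (j (unitCoord d G, 0)) = extChartAt (𝓡 n) q q := by
    simp only [hj0, actionInCharts, unitChartSymm_unitCoord, mul_one, e, one_smul]
  have hct : Tendsto (fun p : EuclideanSpace ℝ (Fin d) × D =>
      unitChartSymm d G p.1 • (extChartAt (𝓡 n) q).symm (extChartAt (𝓡 n) q q + p.2))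
      (𝓝 (unitCoord d G, 0)) (𝓝 q) := by
    have hsm := ContMDiffSMul.continuousSMul (I := 𝓡 d) (I' := 𝓡 n) (G := G) (M := Q) ∞
    have t1 := (tendsto_unitChartSymm d (G := G)).comp
      (continuous_fst.tendsto (unitCoord d G, (0 : D)))
    have t2 : Tendsto (fun p : EuclideanSpace ℝ (Fin d) × D =>
      (extChartAt (𝓡 n) q).symm (extChartAt (𝓡 n) q q + p.2)) (𝓝 (unitCoord d G, 0)) (𝓝 q) := by
      refine (tendsto_extChartAt_symm (mem_extChartAt_source (I := 𝓡 n) q)).comp ?_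
      have : Continuous fun p : EuclideanSpace ℝ (Fin d) × D =>
        extChartAt (𝓡 n) q q + (p.2 : EuclideanSpace ℝ (Fin n)) := by fun_prop
      simpa using this.tendsto (unitCoord d G, 0)
    simpa using t1.smul t2
  rw [hv] at hm
  rw [← map_extChartAt_symm_nhds_of_boundaryless (mem_extChartAt_source (I := 𝓡 n) q), ← hm,
    map_map]
  refine map_congr ?_
  filter_upwards [hct.eventually (eventually_extChartAt_symm_extChartAt
    (mem_extChartAt_source (I := 𝓡 n) q))] with p hp
  simp only [Function.comp, actionInCharts, j, mul_one]
  exact hp.symm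

/-- Write a nearby point as `u • s` with `s` in the slice. If `g` fixes it, then `u⁻¹ * g * u`,
still near `h`, fixes `s`, so `s = q`. -/
theorem eventually_mem_orbit_of_smul_eq [ContMDiffSMul (𝓡 d) (𝓡 n) ∞ G Q] {q : Q} {h : G}
    (hq : h • q = q) (hL : ∀ v, isotropyDiff n q h v = v → v = 0) :
    ∀ᶠ p : G × Q in 𝓝 (h, q), p.1 • p.2 = p.2 → p.2 ∈ MulAction.orbit G q := by
  have := topologicalGroup_of_lieGroup (G := G) (𝓡 d) ∞
  obtain ⟨D, hD⟩ := Submodule.exists_isCompl (orbitDiff d n G q).range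
  have e : (extChartAt (𝓡 n) q).symm (extChartAt (𝓡 n) q q) = q := extChartAt_to_inv q
  have hs := eventually_fixed_slice_eq_zero d n hq hL hD.disjoint
  rw [nhds_prod_eq, ← map_smul_slice_nhds d n hD.codisjoint, ← map_id (f := 𝓝 h),
    prod_map_map_eq', eventually_map]
  have ht : Tendsto (fun p : G × (EuclideanSpace ℝ (Fin d) × D) =>
      ((unitChartSymm d G p.2.1)⁻¹ * p.1 * unitChartSymm d G p.2.1, p.2.2))
      (𝓝 h ×ˢ 𝓝 (unitCoord d G, 0)) (𝓝 (h, 0)) := by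
    have t1 : Tendsto (fun p : G × (EuclideanSpace ℝ (Fin d) × D) => unitChartSymm d G p.2.1)
        (𝓝 h ×ˢ 𝓝 (unitCoord d G, 0)) (𝓝 1) :=
      (tendsto_unitChartSymm d (G := G)).comp
        ((continuous_fst.tendsto (unitCoord d G, (0 : D))).comp tendsto_snd)
    have t2 := (t1.inv.mul tendsto_fst).mul t1
    rw [inv_one, one_mul, mul_one] at t2
    exact t2.prodMk_nhds ((continuous_snd.tendsto (unitCoord d G, (0 : D))).comp tendsto_snd)
  filter_upwards [ht.eventually hs] with p hp hfix
  change p.1 • unitChartSymm d G p.2.1 • (extChartAt (𝓡 n) q).symm _ =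
    unitChartSymm d G p.2.1 • (extChartAt (𝓡 n) q).symm _ at hfix
  change unitChartSymm d G p.2.1 • (extChartAt (𝓡 n) q).symm _ ∈ _
  have : p.2.2 = 0 := by
    apply hp
    rw [mul_smul, mul_smul, hfix, inv_smul_smul]
  rw [this]
  simp only [Submodule.coe_zero, add_zero, e]
  exact MulAction.mem_orbit _ _

end Slice

/-! ### Absence of small subgroups -/

section NoSmallSubgroups

open Filter Topology

variable (d : ℕ) (G : Type*) [Group G] [TopologicalSpace G]
  [ChartedSpace (EuclideanSpace ℝ (Fin d)) G]

theorem hasFDerivAt_sq_inCharts [LieGroup (𝓡 d) ∞ G] :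
    HasFDerivAt (fun u => extChartAt (𝓡 d) (1 : G) (unitChartSymm d G u * unitChartSymm d G u))
      ((2 : ℝ) • ContinuousLinearMap.id ℝ (EuclideanSpace ℝ (Fin d))) (unitCoord d G) := by
  have hm : MDifferentiableAt ((𝓡 d).prod (𝓡 d)) (𝓡 d) (fun p : G × G => p.1 * p.2)
      ((1 : G), (1 : G)) := (contMDiff_mul (𝓡 d) ∞).mdifferentiable (by simp) _
  have hi : MDifferentiableAt (𝓡 d) (𝓡 d) (fun x : G => x) 1 := mdifferentiableAt_id
  have hp : MDifferentiableAt (𝓡 d) ((𝓡 d).prod (𝓡 d)) (fun x : G => (x, x)) 1 :=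
    hi.prodMk hi
  have hd : MDifferentiableAt (𝓡 d) (𝓡 d) (fun x : G => x * x) 1 := hm.comp (f := fun x : G => (x, x)) (1 : G) hp
  have h := MDifferentiableAt.hasFDerivAt_inCharts hd (one_mul 1)
  have e : (mfderiv (𝓡 d) (𝓡 d) (fun x : G => x * x) 1 :
      EuclideanSpace ℝ (Fin d) →L[ℝ] EuclideanSpace ℝ (Fin d)) =
      (2 : ℝ) • ContinuousLinearMap.id ℝ (EuclideanSpace ℝ (Fin d)) := by
    ext1 v
    have h1 := DFunLike.congr_fun (mfderiv_comp (I' := (𝓡 d).prod (𝓡 d))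
      (f := fun x : G => (x, x)) (1 : G) hm hp) v
    refine h1.trans ?_
    rw [mfderiv_prodMk hi hi]
    refine (mfderiv_mul_at_one d rfl rfl _ _).trans ?_
    have h2 : (mfderiv (𝓡 d) (𝓡 d) (fun x : G => x) 1 v : EuclideanSpace ℝ (Fin d)) = v :=
      DFunLike.congr_fun (mfderiv_id (I := 𝓡 d) (x := (1 : G))) v
    refine (congrArg₂ (· + ·) h2 h2).trans ?_
    exact (two_smul ℝ (v : EuclideanSpace ℝ (Fin d))).symm
  rw [← e]
  exact h

/-- Lie groups have no small subgroups. -/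
theorem exists_nhds_one_forall_pow_mem_imp_eq_one [LieGroup (𝓡 d) ∞ G] :
    ∃ V ∈ 𝓝 (1 : G), ∀ g : G, (∀ k : ℕ, g ^ k ∈ V) → g = 1 := by
  have h := (hasFDerivAt_sq_inCharts d G).isLittleO.def (show (0 : ℝ) < 1 / 2 by norm_num)
  obtain ⟨r, hr, hball⟩ := Metric.eventually_nhds_iff_ball.1 h
  have hsq : extChartAt (𝓡 d) (1 : G)
      (unitChartSymm d G (unitCoord d G) * unitChartSymm d G (unitCoord d G)) =
      unitCoord d G := by
    rw [unitChartSymm_unitCoord, one_mul]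
    rfl
  refine ⟨(extChartAt (𝓡 d) (1 : G)).source ∩
    extChartAt (𝓡 d) (1 : G) ⁻¹' Metric.ball (unitCoord d G) r,
    inter_mem (extChartAt_source_mem_nhds _)
      (tendsto_extChartAt (mem_extChartAt_source (1 : G)) (Metric.ball_mem_nhds _ hr)), ?_⟩
  intro g hg
  let a : ℕ → ℝ := fun k => ‖extChartAt (𝓡 d) (1 : G) (g ^ 2 ^ k) - unitCoord d G‖
  -- The derivative of squaring is `2`. With an error of at most `1 / 2`, squaring multiplies the
  -- distance to `1` by at least `3 / 2`, so repeated squares stay in the ball only when this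
  -- distance is zero.
  have ha : ∀ k, 3 / 2 * a k ≤ a (k + 1) := by
    intro k
    have h1 := hball _ (hg (2 ^ k)).2
    have e : unitChartSymm d G (extChartAt (𝓡 d) (1 : G) (g ^ 2 ^ k)) = g ^ 2 ^ k :=
      (extChartAt (𝓡 d) (1 : G)).left_inv (hg (2 ^ k)).1
    rw [e, hsq, ← pow_add, ← mul_two, ← pow_succ] at h1
    set y := extChartAt (𝓡 d) (1 : G) (g ^ 2 ^ k) - unitCoord d G with hy
    set z := extChartAt (𝓡 d) (1 : G) (g ^ 2 ^ (k + 1)) - unitCoord d G with hz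
    have h2 : ‖z - (2 : ℝ) • y‖ ≤ 1 / 2 * ‖y‖ := h1
    have h3 : ‖(2 : ℝ) • y‖ ≤ ‖z‖ + ‖z - (2 : ℝ) • y‖ := by
      have := norm_sub_le z (z - (2 : ℝ) • y)
      rwa [sub_sub_cancel] at this
    rw [norm_smul, Real.norm_ofNat] at h3
    change 3 / 2 * ‖y‖ ≤ ‖z‖
    linarith
  have hak : ∀ k, (3 / 2) ^ k * a 0 ≤ a k := by
    intro k
    induction k with
    | zero => simp
    | succ k ih => exact le_trans (by rw [pow_succ]; linarith) (ha k)
  have hbd : ∀ k, a k < r := fun k => by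
    have := (hg (2 ^ k)).2
    rwa [Set.mem_preimage, mem_ball_iff_norm] at this
  have ha0 : a 0 = 0 := by
    by_contra hne
    have hpos : 0 < a 0 := lt_of_le_of_ne (norm_nonneg _) (Ne.symm hne)
    obtain ⟨k, hk⟩ := pow_unbounded_of_one_lt (r / a 0) (show (1 : ℝ) < 3 / 2 by norm_num)
    have := (div_lt_iff₀ hpos).1 hk
    linarith [hak k, hbd k]
  have h0 : extChartAt (𝓡 d) (1 : G) g = extChartAt (𝓡 d) (1 : G) 1 := by
    have := norm_eq_zero.1 ha0
    rw [pow_zero, pow_one, sub_eq_zero] at this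
    exact this
  have hgs := (hg 1).1
  rw [pow_one] at hgs
  exact (extChartAt (𝓡 d) (1 : G)).injOn hgs (mem_extChartAt_source _) h0

end NoSmallSubgroups

/-! ### Limits of group elements under a proper action -/

section ProperAction

open Filter Topology

variable {G X : Type*} [Group G] [TopologicalSpace G] [TopologicalSpace X]
  [MulAction G X] [ProperSMul G X]

/-- Properness of `(g, x) ↦ (g • x, x)` in ultrafilter form: convergence of points and of their
translates yields a limit of the group elements. -/
theorem exists_limit_of_properSMul (𝒰 : Ultrafilter (G × X)) {x y : X}
    (hx : Tendsto (fun p : G × X => p.2) 𝒰 (𝓝 x))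
    (hy : Tendsto (fun p : G × X => p.1 • p.2) 𝒰 (𝓝 y)) :
    ∃ h : G, h • x = y ∧ (𝒰 : Filter (G × X)) ≤ 𝓝 (h, x) := by
  obtain ⟨⟨h, x'⟩, he, hle⟩ := (ProperSMul.isProperMap_smul_pair (G := G)
    (X := X)).ultrafilter_le_nhds_of_tendsto (hy.prodMk_nhds hx)
  obtain ⟨h1, h2⟩ := Prod.ext_iff.1 he
  simp only at h1 h2
  subst h2
  exact ⟨h, h1, hle⟩

/-- Group elements that bring `x` back near itself accumulate at the stabilizer. A property of orbit
points near `x` can therefore be checked for group elements near each stabilizer element. -/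
theorem eventually_of_forall_stabilizer {x : X} {P : X → Prop}
    (h : ∀ g : G, g • x = x → ∀ᶠ g' in 𝓝 g, P (g' • x)) :
    ∀ᶠ y in 𝓝 x, y ∈ MulAction.orbit G x → P y := by
  by_contra hcon
  rw [not_eventually] at hcon
  let F : Filter G := comap (fun g : G => g • x) (𝓝 x) ⊓ 𝓟 {g | ¬ P (g • x)}
  have hF : F.NeBot := by
    rw [inf_principal_neBot_iff]
    intro s hs
    obtain ⟨t, ht, hts⟩ := mem_comap.1 hs
    obtain ⟨y, hy, hyt⟩ := (hcon.and_eventually ht).exists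
    rw [Classical.not_imp] at hy
    obtain ⟨⟨g, rfl⟩, hP⟩ := hy
    exact ⟨g, hts hyt, hP⟩
  let 𝒰 : Ultrafilter G := Ultrafilter.of F
  have h𝒰 : (𝒰 : Filter G) ≤ F := Ultrafilter.of_le F
  have hy : Tendsto (fun g : G => g • x) 𝒰 (𝓝 x) :=
    tendsto_iff_comap.2 (h𝒰.trans inf_le_left)
  obtain ⟨g, hg, hle⟩ := exists_limit_of_properSMul (𝒰.map fun g : G => (g, x)) (x := x) (y := x)
    (tendsto_map'_iff.2 tendsto_const_nhds) (tendsto_map'_iff.2 hy)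
  have hlim : Tendsto (fun g : G => g) 𝒰 (𝓝 g) := by
    have h1 : Tendsto (fun g : G => (g, x)) 𝒰 (𝓝 (g, x)) := hle
    exact (continuous_fst.tendsto (g, x)).comp h1
  have h1 : ∀ᶠ g' in (𝒰 : Filter G), P (g' • x) := hlim.eventually (h g hg)
  have h2 : ∀ᶠ g' in (𝒰 : Filter G), ¬ P (g' • x) := h𝒰.trans inf_le_right (mem_principal_self _)
  obtain ⟨g', h3, h4⟩ := (h1.and h2).exists
  exact h4 h3

/-- Near a stabilizer element `g`, group elements lie in its open connected component, whose image
is a connected part of the orbit through `x`. -/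
theorem eventually_mem_connectedComponentIn_orbit [LocallyConnectedSpace G] (x : X) :
    ∀ᶠ y in 𝓝 x, y ∈ MulAction.orbit G x →
      y ∈ connectedComponentIn (MulAction.orbit G x) x := by
  refine eventually_of_forall_stabilizer (G := G) fun g hg => ?_
  filter_upwards [isOpen_connectedComponent.mem_nhds (mem_connectedComponent (x := g))] with g' hg'
  have hpre : IsPreconnected ((fun k : G => k • x) '' connectedComponent g) :=
    isPreconnected_connectedComponent.image _ (continuous_id.smul continuous_const).continuousOn
  exact hpre.subset_connectedComponentIn ⟨g, mem_connectedComponent, hg⟩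
    (by rintro _ ⟨k, -, rfl⟩; exact MulAction.mem_orbit x k) ⟨g', hg', rfl⟩

end ProperAction

/-! ### Isolation of the orbits with non-trivial isotropy -/

section Isolation

open Filter Topology

variable (d n : ℕ) {G Q : Type*} [Group G] [TopologicalSpace G]
  [ChartedSpace (EuclideanSpace ℝ (Fin d)) G] [TopologicalSpace Q]
  [ChartedSpace (EuclideanSpace ℝ (Fin n)) Q] [MulAction G Q]
  [LieGroup (𝓡 d) ∞ G] [IsManifold (𝓡 n) ∞ Q]

/-- Otherwise points off the orbit of `q` tend to `q` with non-trivial stabilizer elements.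
Properness gives a limit `h` fixing `q`, and near `(h, q)` fixed points belong to the orbit,
provided that `h ≠ 1`. -/
theorem eventually_stabilizer_eq_bot_of_notMem_orbit [ContMDiffSMul (𝓡 d) (𝓡 n) ∞ G Q]
    [ProperSMul G Q] (H : IsotropyFixesNoVector n G Q) (q : Q) :
    ∀ᶠ x in 𝓝 q, MulAction.stabilizer G x ≠ ⊥ → x ∈ MulAction.orbit G q := by
  obtain ⟨V, hV, hVpow⟩ := exists_nhds_one_forall_pow_mem_imp_eq_one d G
  by_contra hcon
  rw [not_eventually] at hcon
  let Z : Set (G × Q) := {p | p.1 • p.2 = p.2 ∧ p.1 ∉ V ∧ p.2 ∉ MulAction.orbit G q}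
  let F : Filter (G × Q) := comap Prod.snd (𝓝 q) ⊓ 𝓟 Z
  have hF : F.NeBot := by
    rw [inf_principal_neBot_iff]
    intro s hs
    obtain ⟨t, ht, hts⟩ := mem_comap.1 hs
    obtain ⟨x, hx, hxt⟩ := (hcon.and_eventually ht).exists
    rw [Classical.not_imp, Ne, Subgroup.eq_bot_iff_forall] at hx
    push Not at hx
    obtain ⟨⟨g, hg, hg1⟩, hxo⟩ := hx
    -- Passing to a power outside `V` keeps the limiting element away from `1`.
    obtain ⟨k, hk⟩ : ∃ k : ℕ, g ^ k ∉ V := by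
      by_contra! h
      exact hg1 (hVpow g h)
    exact ⟨(g ^ k, x), hts hxt, (MulAction.stabilizer G x).pow_mem hg k, hk, hxo⟩
  let 𝒰 : Ultrafilter (G × Q) := Ultrafilter.of F
  have h𝒰 : (𝒰 : Filter (G × Q)) ≤ F := Ultrafilter.of_le F
  have hZ : ∀ᶠ p in (𝒰 : Filter (G × Q)), p ∈ Z := h𝒰.trans inf_le_right (mem_principal_self _)
  have hx : Tendsto (fun p : G × Q => p.2) 𝒰 (𝓝 q) :=
    tendsto_iff_comap.2 (h𝒰.trans inf_le_left)
  have hy : Tendsto (fun p : G × Q => p.1 • p.2) 𝒰 (𝓝 q) :=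
    hx.congr' (hZ.mono fun p hp => hp.1.symm)
  obtain ⟨h, hq, hle⟩ := exists_limit_of_properSMul 𝒰 hx hy
  have h1 : h ≠ 1 := by
    rintro rfl
    have : ∀ᶠ p in (𝒰 : Filter (G × Q)), p.1 ∈ V :=
      hle ((continuous_fst.tendsto ((1 : G), q)).eventually hV)
    obtain ⟨p, hp1, hp2⟩ := (this.and hZ).exists
    exact hp2.2.1 hp1
  obtain ⟨p, hp1, hp2⟩ := ((show ∀ᶠ p in (𝒰 : Filter (G × Q)), _ from
    hle (eventually_mem_orbit_of_smul_eq d n hq (H q h hq h1))).and hZ).exists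
  exact hp2.2.2 (hp1 hp2.1)

theorem hasIsolatedOrbitComponents_of_isotropyFixesNoVector [ContMDiffSMul (𝓡 d) (𝓡 n) ∞ G Q]
    [ProperSMul G Q] (H : IsotropyFixesNoVector n G Q) :
    HasIsolatedOrbitComponents G {q : Q | MulAction.stabilizer G q ≠ ⊥} := by
  have : LocallyConnectedSpace G :=
    ChartedSpace.locallyConnectedSpace (EuclideanSpace ℝ (Fin d)) G
  intro q _
  -- The neighbourhood must contain the whole component, so the local result is applied at each of
  -- its points `c`, not only at `q`.
  refine ⟨interior {x | MulAction.stabilizer G x ≠ ⊥ →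
    x ∈ connectedComponentIn (MulAction.orbit G q) q}, isOpen_interior, fun c hc => ?_,
    fun x hx => interior_subset hx.1 hx.2⟩
  rw [mem_interior_iff_mem_nhds]
  have e1 : MulAction.orbit G c = MulAction.orbit G q :=
    MulAction.orbit_eq_iff.2 (connectedComponentIn_subset _ _ hc)
  have e2 := connectedComponentIn_eq hc
  filter_upwards [eventually_stabilizer_eq_bot_of_notMem_orbit d n H c,
    eventually_mem_connectedComponentIn_orbit (G := G) c] with x h1 h2 hx
  rw [e2, ← e1]
  exact h2 (h1 hx)

end Isolation

/-! ### Non-open orbits are locally null -/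

section NullOrbits

open Filter Topology Module MeasureTheory

/-- A `C¹` map does not raise Hausdorff dimension, and Lebesgue measure is a multiple of
`n`-dimensional Hausdorff measure. -/
theorem volume_image_eq_zero_of_finrank_lt {R : Type*} [NormedAddCommGroup R] [NormedSpace ℝ R]
    [FiniteDimensional ℝ R] {n : ℕ} (hR : finrank ℝ R < n) {J : R → EuclideanSpace ℝ (Fin n)}
    {s : Set R} (hs : Convex ℝ s) (hJ : ContDiffOn ℝ 1 J s) : volume (J '' s) = 0 := by
  have h1 : dimH (J '' s) ≤ finrank ℝ R :=
    ((hJ.dimH_image_le hs subset_rfl).trans (dimH_mono (Set.subset_univ s))).trans_eq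
      (Real.dimH_univ_eq_finrank R)
  have h2 : dimH (J '' s) < ((n : NNReal) : ENNReal) :=
    h1.trans_lt (by simpa using hR)
  have h3 := hausdorffMeasure_of_dimH_lt h2
  rw [Measure.isAddLeftInvariant_eq_smul (volume : Measure (EuclideanSpace ℝ (Fin n)))
    (Measure.hausdorffMeasure (n : ℝ)), Measure.smul_apply]
  simp only [NNReal.coe_natCast] at h3
  rw [h3, smul_zero]

variable (d n : ℕ) {G Q : Type*} [Group G] [TopologicalSpace G]
  [ChartedSpace (EuclideanSpace ℝ (Fin d)) G] [TopologicalSpace Q]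
  [ChartedSpace (EuclideanSpace ℝ (Fin n)) Q] [MulAction G Q]
  [LieGroup (𝓡 d) ∞ G] [IsManifold (𝓡 n) ∞ Q]

/-- A submersive orbit map covers a neighbourhood of `q`; translation carries this to every point of
the orbit. -/
theorem isOpen_orbit_of_surjective [ContMDiffSMul (𝓡 d) (𝓡 n) ∞ G Q] {c q : Q}
    (hq : q ∈ (extChartAt (𝓡 n) c).source)
    (hs : (fderiv ℝ (orbitMapInCharts d n G c q) (unitCoord d G)).range = ⊤) :
    IsOpen (MulAction.orbit G q) := by
  have hst := (contDiffAt_orbitMapInCharts d n (G := G) hq).hasStrictFDerivAt (by simp)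
  have hm := hst.map_nhds_eq_of_surj hs
  rw [orbitMapInCharts_unitCoord] at hm
  have hcont : Continuous (fun g : G => g • q) := (contMDiff_orbitMap d n q).continuous
  have t1 : Tendsto (fun u => unitChartSymm d G u • q) (𝓝 (unitCoord d G)) (𝓝 q) := by
    have := (hcont.tendsto 1).comp (tendsto_unitChartSymm d (G := G))
    rwa [one_smul] at this
  have hmq : MulAction.orbit G q ∈ 𝓝 q := by
    rw [← map_extChartAt_symm_nhds_of_boundaryless hq, ← hm, map_map, mem_map]
    filter_upwards [t1.eventually (eventually_extChartAt_symm_extChartAt hq)] with u hu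
    change (extChartAt (𝓡 n) c).symm (extChartAt (𝓡 n) c (unitChartSymm d G u • q)) ∈
      MulAction.orbit G q
    rw [hu]
    exact MulAction.mem_orbit _ _
  rw [isOpen_iff_mem_nhds]
  rintro _ ⟨g, rfl⟩
  have ht : Tendsto (fun x : Q => g⁻¹ • x) (𝓝 (g • q)) (𝓝 q) := by
    have := (contMDiff_const_smul_of_contMDiffSMul d n g⁻¹ (Q := Q)).continuous.tendsto (g • q)
    rwa [inv_smul_smul] at this
  filter_upwards [ht hmq] with x hx
  exact (MulAction.orbit_eq_iff.1 (by rw [← MulAction.orbit_eq_iff.2 hx, MulAction.orbit_smul]) :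
    x ∈ MulAction.orbit G q)

/-- The rank is below `n` because the orbit is not open. The normal form parametrizes the orbit near
`q` by the range of `σ`, whose dimension is at most this rank. Properness ensures that no further
sheets of the orbit approach `q`. -/
theorem exists_null_of_not_isOpen_orbit [ContMDiffSMul (𝓡 d) (𝓡 n) ∞ G Q] [ProperSMul G Q]
    {c q : Q} (hq : q ∈ (extChartAt (𝓡 n) c).source) (ho : ¬ IsOpen (MulAction.orbit G q)) :
    ∃ Z : Set (EuclideanSpace ℝ (Fin n)), volume Z = 0 ∧
      ∀ᶠ x in 𝓝 q, x ∈ MulAction.orbit G q → extChartAt (𝓡 n) c x ∈ Z := by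
  have := topologicalGroup_of_lieGroup (G := G) (𝓡 d) ∞
  obtain ⟨σ, k, hσ1, hσ2, hk1, hk0, -, hnf, -⟩ := exists_orbit_normalForm d n (G := G) hq
  have hf := contDiffAt_orbitMapInCharts d n (G := G) hq
  set f := orbitMapInCharts d n G c q with hfdef
  set B := fderiv ℝ f (unitCoord d G) with hB
  have hBn : finrank ℝ B.range < n := by
    have : B.range ≠ ⊤ := fun h => ho (isOpen_orbit_of_surjective d n hq h)
    simpa using Submodule.finrank_lt this
  have hσn : finrank ℝ σ.range < n := by
    refine lt_of_le_of_lt (le_trans (Submodule.finrank_mono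
      (t := Submodule.map σ.toLinearMap B.range) ?_) (Submodule.finrank_map_le _ _)) hBn
    rintro _ ⟨y, rfl⟩
    exact ⟨B (σ y), ⟨σ y, rfl⟩, hσ2 y⟩
  let J : σ.range → EuclideanSpace ℝ (Fin n) := fun ρ => f (k ρ)
  have hJ : ContDiffAt ℝ 1 J 0 := by
    have h1 : ContDiffAt ℝ 1 (fun ρ : σ.range => (ρ : EuclideanSpace ℝ (Fin d))) 0 :=
      σ.range.subtypeL.contDiff.contDiffAt
    have h2 : ContDiffAt ℝ 1 (fun ρ : σ.range => k ρ) 0 := ContDiffAt.comp (0 : σ.range) hk1 h1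
    refine ContDiffAt.comp (g := f) (0 : σ.range) ?_ h2
    rw [Submodule.coe_zero, hk0]
    exact hf.of_le (by exact_mod_cast le_top)
  obtain ⟨ε, hε, hb⟩ := Metric.eventually_nhds_iff_ball.1 (hJ.eventually (by simp))
  refine ⟨J '' Metric.ball 0 ε, volume_image_eq_zero_of_finrank_lt hσn (convex_ball _ _)
    fun ρ hρ => (hb ρ hρ).contDiffWithinAt, ?_⟩
  have h1 : ∀ᶠ g in 𝓝 (1 : G), extChartAt (𝓡 n) c (g • q) ∈ J '' Metric.ball 0 ε := by
    rw [← map_unitChartSymm d, eventually_map]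
    have ht : ∀ᶠ u in 𝓝 (unitCoord d G), ‖σ (f u - f (unitCoord d G))‖ < ε := by
      have hc : ContinuousAt (fun u => ‖σ (f u - f (unitCoord d G))‖) (unitCoord d G) :=
        (σ.continuous.continuousAt.comp (hf.continuousAt.sub continuousAt_const)).norm
      refine hc.eventually_lt continuousAt_const ?_
      simpa using hε
    filter_upwards [hnf, ht] with u h1 h2
    refine ⟨⟨σ (f u - f (unitCoord d G)), ⟨_, rfl⟩⟩, ?_, h1.symm⟩
    rw [mem_ball_zero_iff]
    exact h2
  refine eventually_of_forall_stabilizer (G := G) fun h hh => ?_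
  have hc : Tendsto (fun g : G => g * h⁻¹) (𝓝 h) (𝓝 1) := by
    have : Continuous fun g : G => g * h⁻¹ := by fun_prop
    simpa using this.tendsto h
  filter_upwards [hc.eventually h1] with g hg
  have hq' : h⁻¹ • q = q := inv_smul_eq_iff.2 hh.symm
  rwa [mul_smul, hq'] at hg

/-- Locally all points with non-trivial isotropy lie in one non-open orbit; countably many such
neighbourhoods suffice. -/
theorem isNullInManifold_of_isotropyFixesNoVector [SecondCountableTopology Q]
    [ContMDiffSMul (𝓡 d) (𝓡 n) ∞ G Q] [ProperSMul G Q] (H : IsotropyFixesNoVector n G Q)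
    (hopen : ∀ q : Q, MulAction.stabilizer G q ≠ ⊥ → ¬ IsOpen (MulAction.orbit G q)) :
    IsNullInManifold n {q : Q | MulAction.stabilizer G q ≠ ⊥} := by
  intro c
  set T := (chartAt (EuclideanSpace ℝ (Fin n)) c).source ∩
    {q : Q | MulAction.stabilizer G q ≠ ⊥} with hT
  have hloc : ∀ q ∈ T, ∃ N ∈ 𝓝 q, volume (chartAt (EuclideanSpace ℝ (Fin n)) c '' (T ∩ N)) = 0 := by
    intro q hq
    have hqs : q ∈ (extChartAt (𝓡 n) c).source := by
      rw [extChartAt_source]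
      exact hq.1
    obtain ⟨Z, hZ, hev⟩ := exists_null_of_not_isOpen_orbit d n (G := G) hqs (hopen q hq.2)
    refine ⟨_, inter_mem hev (eventually_stabilizer_eq_bot_of_notMem_orbit d n H q),
      measure_mono_null ?_ hZ⟩
    rintro _ ⟨x, ⟨hx1, hx2, hx3⟩, rfl⟩
    exact hx2 (hx3 hx1.2)
  choose! N hN hNv using hloc
  obtain ⟨t, htT, htc, hcov⟩ := TopologicalSpace.countable_cover_nhdsWithin (f := N)
    fun q hq => mem_nhdsWithin_of_mem_nhds (hN q hq)
  refine measure_mono_null (t := ⋃ q ∈ t, chartAt (EuclideanSpace ℝ (Fin n)) c '' (T ∩ N q)) ?_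
    ((measure_biUnion_null_iff htc).2 fun q hq => hNv q (htT hq))
  rintro _ ⟨x, hx, rfl⟩
  obtain ⟨q, hq, hxq⟩ := Set.mem_iUnion₂.1 (hcov hx)
  exact Set.mem_iUnion₂.2 ⟨q, hq, x, ⟨hx, hxq⟩, rfl⟩

end NullOrbits

/-! ### Linearization at a point and curves of fixed points -/

section FixedPoints

open Filter Topology Module MeasureTheory

variable (d n : ℕ) {G Q : Type*} [Group G] [TopologicalSpace G]
  [ChartedSpace (EuclideanSpace ℝ (Fin d)) G] [TopologicalSpace Q]
  [ChartedSpace (EuclideanSpace ℝ (Fin n)) Q] [MulAction G Q]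
  [LieGroup (𝓡 d) ∞ G] [IsManifold (𝓡 n) ∞ Q]

omit [IsManifold (𝓡 n) ∞ Q] in
theorem eventually_forall_stabilizer_smul_mem_source [ProperSMul G Q] (q : Q) :
    ∀ᶠ y in 𝓝 (extChartAt (𝓡 n) q q), ∀ k : MulAction.stabilizer G q,
      k • (extChartAt (𝓡 n) q).symm y ∈ (extChartAt (𝓡 n) q).source := by
  have hK : CompactSpace (MulAction.stabilizer G q) :=
    isCompact_iff_compactSpace.1 (isCompact_stabilizer_of_properSMul q)
  have h := isCompact_univ.eventually_forall_of_forall_eventually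
    (x₀ := extChartAt (𝓡 n) q q) (K := (Set.univ : Set (MulAction.stabilizer G q)))
    (P := fun y k => k • (extChartAt (𝓡 n) q).symm y ∈ (extChartAt (𝓡 n) q).source) (by
      intro k _
      have ht : Tendsto (fun z : EuclideanSpace ℝ (Fin n) × MulAction.stabilizer G q =>
          (z.2 : G) • (extChartAt (𝓡 n) q).symm z.1) (𝓝 (extChartAt (𝓡 n) q q, k)) (𝓝 q) := by
        have h1 := (continuous_subtype_val.comp continuous_snd).tendsto
          (extChartAt (𝓡 n) q q, k)
        have h2 := (tendsto_extChartAt_symm (mem_extChartAt_source (I := 𝓡 n) q)).comp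
          (continuous_fst.tendsto (extChartAt (𝓡 n) q q, k))
        have h3 := h1.smul h2
        have hk : (k : G) • q = q := k.2
        simpa [hk] using h3
      exact ht (extChartAt_source_mem_nhds (I := 𝓡 n) q))
  exact h.mono fun y hy k => hy k trivial

/-- Compactness makes the estimate uniform over the isotropy group. One half of `ε` pays for the
action near `k`, the other for the change of the isotropy representation. -/
theorem eventually_forall_stabilizer_norm_sub_le [ContMDiffSMul (𝓡 d) (𝓡 n) ∞ G Q]
    [ProperSMul G Q] (q : Q) {ε : ℝ} (hε : 0 < ε) :
    ∀ᶠ p in 𝓝 (extChartAt (𝓡 n) q q, extChartAt (𝓡 n) q q), ∀ k : MulAction.stabilizer G q,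
      ‖extChartAt (𝓡 n) q ((k : G) • (extChartAt (𝓡 n) q).symm p.1) -
          extChartAt (𝓡 n) q ((k : G) • (extChartAt (𝓡 n) q).symm p.2) -
          isotropyDiff n q (k : G) (p.1 - p.2)‖ ≤ ε * ‖p.1 - p.2‖ := by
  have hK : CompactSpace (MulAction.stabilizer G q) :=
    isCompact_iff_compactSpace.1 (isCompact_stabilizer_of_properSMul q)
  have h := isCompact_univ.eventually_forall_of_forall_eventually
    (x₀ := (extChartAt (𝓡 n) q q, extChartAt (𝓡 n) q q))
    (K := (Set.univ : Set (MulAction.stabilizer G q)))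
    (P := fun p k => ‖extChartAt (𝓡 n) q ((k : G) • (extChartAt (𝓡 n) q).symm p.1) -
          extChartAt (𝓡 n) q ((k : G) • (extChartAt (𝓡 n) q).symm p.2) -
          isotropyDiff n q (k : G) (p.1 - p.2)‖ ≤ ε * ‖p.1 - p.2‖) (by
      intro k _
      have h1 := eventually_norm_smul_inCharts_sub_le d n
        (MulAction.mem_stabilizer_iff.1 k.2) (half_pos hε)
      have c1 : Tendsto (fun z : (EuclideanSpace ℝ (Fin n) × EuclideanSpace ℝ (Fin n)) ×
          MulAction.stabilizer G q => ((z.2 : G), z.1))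
          (𝓝 ((extChartAt (𝓡 n) q q, extChartAt (𝓡 n) q q), k))
          (𝓝 ((k : G), (extChartAt (𝓡 n) q q, extChartAt (𝓡 n) q q))) :=
        (by fun_prop : Continuous (fun z : (EuclideanSpace ℝ (Fin n) ×
          EuclideanSpace ℝ (Fin n)) × MulAction.stabilizer G q => ((z.2 : G), z.1))).tendsto _
      have h2 : ∀ᶠ z : (EuclideanSpace ℝ (Fin n) × EuclideanSpace ℝ (Fin n)) ×
          MulAction.stabilizer G q in 𝓝 ((extChartAt (𝓡 n) q q, extChartAt (𝓡 n) q q), k),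
          ‖isotropyDiff n q (z.2 : G) - isotropyDiff n q (k : G)‖ < ε / 2 := by
        have := ((continuous_isotropyDiff d n (G := G) q).comp continuous_snd).tendsto
          ((extChartAt (𝓡 n) q q, extChartAt (𝓡 n) q q), k)
        have h3 := Metric.tendsto_nhds.1 this _ (half_pos hε)
        simpa [dist_eq_norm] using h3
      filter_upwards [c1.eventually h1, h2] with z h1 h2
      set a := extChartAt (𝓡 n) q ((z.2 : G) • (extChartAt (𝓡 n) q).symm z.1.1) -
          extChartAt (𝓡 n) q ((z.2 : G) • (extChartAt (𝓡 n) q).symm z.1.2) with ha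
      have h3 : ‖(isotropyDiff n q (z.2 : G) - isotropyDiff n q (k : G)) (z.1.1 - z.1.2)‖ ≤
          ε / 2 * ‖z.1.1 - z.1.2‖ :=
        (ContinuousLinearMap.le_opNorm _ _).trans (by gcongr)
      have h4 : ‖a - isotropyDiff n q (k : G) (z.1.1 - z.1.2)‖ ≤ ε / 2 * ‖z.1.1 - z.1.2‖ := h1
      calc _ = ‖(a - isotropyDiff n q (k : G) (z.1.1 - z.1.2)) -
            (isotropyDiff n q (z.2 : G) - isotropyDiff n q (k : G)) (z.1.1 - z.1.2)‖ := by
            congr 1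
            rw [sub_apply]
            abel
        _ ≤ _ := norm_sub_le _ _
        _ ≤ ε / 2 * ‖z.1.1 - z.1.2‖ + ε / 2 * ‖z.1.1 - z.1.2‖ := add_le_add h4 h3
        _ = _ := by ring)
  exact h.mono fun y hy k => hy k trivial

/-- Near a point the action of its isotropy group is conjugate to the isotropy representation. -/
theorem exists_linearization [ContMDiffSMul (𝓡 d) (𝓡 n) ∞ G Q] [ProperSMul G Q] (q : Q) :
    ∃ Φ : EuclideanSpace ℝ (Fin n) → EuclideanSpace ℝ (Fin n),
      HasStrictFDerivAt Φ (ContinuousLinearMap.id ℝ (EuclideanSpace ℝ (Fin n)))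
        (extChartAt (𝓡 n) q q) ∧
      ∀ᶠ y in 𝓝 (extChartAt (𝓡 n) q q), ∀ h : G, h • q = q →
        Φ (extChartAt (𝓡 n) q (h • (extChartAt (𝓡 n) q).symm y)) = isotropyDiff n q h (Φ y) := by
  have := topologicalGroup_of_lieGroup (G := G) (𝓡 d) ∞
  have hK : CompactSpace (MulAction.stabilizer G q) :=
    isCompact_iff_compactSpace.1 (isCompact_stabilizer_of_properSMul q)
  let _ : MeasurableSpace (MulAction.stabilizer G q) := borel _
  have : BorelSpace (MulAction.stabilizer G q) := ⟨rfl⟩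
  let μ : Measure (MulAction.stabilizer G q) := Measure.haarMeasure ⊤
  have hμ : IsProbabilityMeasure μ := ⟨Measure.haarMeasure_self (K₀ := ⊤)⟩
  -- The chart is conjugated by each `k` and averaged over Haar measure. Each conjugate has
  -- derivative the identity at the base point, so the average does too.
  let F : EuclideanSpace ℝ (Fin n) → MulAction.stabilizer G q → EuclideanSpace ℝ (Fin n) :=
    fun y k => isotropyDiff n q (k : G)
      (extChartAt (𝓡 n) q ((k⁻¹ : G) • (extChartAt (𝓡 n) q).symm y))
  let Φ : EuclideanSpace ℝ (Fin n) → EuclideanSpace ℝ (Fin n) := fun y => ∫ k, F y k ∂μ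
  have hsrc := eventually_forall_stabilizer_smul_mem_source n (G := G) q
  have hFi : ∀ y, (∀ k : MulAction.stabilizer G q,
      k • (extChartAt (𝓡 n) q).symm y ∈ (extChartAt (𝓡 n) q).source) → Integrable (F y) μ := by
    intro y hy
    have h1 : Continuous fun k : MulAction.stabilizer G q =>
        extChartAt (𝓡 n) q ((k⁻¹ : G) • (extChartAt (𝓡 n) q).symm y) := by
      have h2 : Continuous fun k : MulAction.stabilizer G q =>
          (k⁻¹ : G) • (extChartAt (𝓡 n) q).symm y := by fun_prop
      exact (continuousOn_extChartAt q).comp_continuous h2 fun k => hy k⁻¹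
    have h3 : Continuous (F y) := (continuous_isotropyDiff d n (G := G) q).clm_apply h1
    exact h3.integrable_of_hasCompactSupport (HasCompactSupport.of_compactSpace _)
  obtain ⟨C, hC0, hC⟩ := exists_norm_isotropyDiff_le d n (G := G) q
  refine ⟨Φ, .of_isLittleO (Asymptotics.isLittleO_iff.2 fun ε hε => ?_), ?_⟩
  · have hδ : 0 < ε / (C + 1) := by positivity
    have hsrc2 : ∀ᶠ p : EuclideanSpace ℝ (Fin n) × EuclideanSpace ℝ (Fin n) in
        𝓝 (extChartAt (𝓡 n) q q, extChartAt (𝓡 n) q q), Integrable (F p.1) μ ∧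
          Integrable (F p.2) μ :=
      ((continuous_fst.tendsto (extChartAt (𝓡 n) q q, extChartAt (𝓡 n) q q)).eventually
        (hsrc.mono hFi)).and
      ((continuous_snd.tendsto (extChartAt (𝓡 n) q q, extChartAt (𝓡 n) q q)).eventually
        (hsrc.mono hFi))
    filter_upwards [eventually_forall_stabilizer_norm_sub_le d n (G := G) q hδ, hsrc2]
      with p h1 ⟨h2, h3⟩
    have e : Φ p.1 - Φ p.2 - ContinuousLinearMap.id ℝ (EuclideanSpace ℝ (Fin n)) (p.1 - p.2) =
        ∫ k, (F p.1 k - F p.2 k - (p.1 - p.2)) ∂μ := by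
      have h4 : Integrable (fun k => F p.1 k - F p.2 k) μ := h2.sub h3
      rw [integral_sub h4 (integrable_const _), integral_sub h2 h3, integral_const]
      simp [Φ]
    rw [e]
    have hb : ∀ k, ‖F p.1 k - F p.2 k - (p.1 - p.2)‖ ≤ ε * ‖p.1 - p.2‖ := by
      intro k
      have hk : (k : G) • q = q := k.2
      have h4 := h1 k⁻¹
      rw [Subgroup.coe_inv] at h4
      have e2 : F p.1 k - F p.2 k - (p.1 - p.2) = isotropyDiff n q (k : G)
          (extChartAt (𝓡 n) q ((k⁻¹ : G) • (extChartAt (𝓡 n) q).symm p.1) -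
            extChartAt (𝓡 n) q ((k⁻¹ : G) • (extChartAt (𝓡 n) q).symm p.2) -
            isotropyDiff n q (k⁻¹ : G) (p.1 - p.2)) := by
        rw [map_sub, map_sub, isotropyDiff_apply_inv_apply d n hk]
      rw [e2]
      calc _ ≤ C * (ε / (C + 1) * ‖p.1 - p.2‖) :=
            (ContinuousLinearMap.le_opNorm _ _).trans (by gcongr; exact hC _ hk)
        _ ≤ (C + 1) * (ε / (C + 1) * ‖p.1 - p.2‖) := by gcongr; linarith
        _ = _ := by field_simp
    simpa using norm_integral_le_of_norm_le_const (μ := μ) (Eventually.of_forall hb)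
  · filter_upwards [hsrc] with y hy h hh
    let h' : MulAction.stabilizer G q := ⟨h, hh⟩
    have e : ∀ k, F (extChartAt (𝓡 n) q (h • (extChartAt (𝓡 n) q).symm y)) k =
        isotropyDiff n q h (F y (h'⁻¹ * k)) := by
      intro k
      have hs : (extChartAt (𝓡 n) q).symm (extChartAt (𝓡 n) q
          (h • (extChartAt (𝓡 n) q).symm y)) = h • (extChartAt (𝓡 n) q).symm y :=
        (extChartAt (𝓡 n) q).left_inv (hy h')
      have h1 : isotropyDiff n q (k : G) =
          (isotropyDiff n q h).comp (isotropyDiff n q (h⁻¹ * k : G)) := by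
        have hk : (h⁻¹ * k : G) • q = q := (h'⁻¹ * k).2
        rw [← isotropyDiff_mul d n hh hk, mul_inv_cancel_left]
      simp only [F, hs]
      rw [h1, ContinuousLinearMap.comp_apply]
      simp [h', mul_smul]
    calc ∫ k, F (extChartAt (𝓡 n) q (h • (extChartAt (𝓡 n) q).symm y)) k ∂μ
        = ∫ k, isotropyDiff n q h (F y (h'⁻¹ * k)) ∂μ := by simp_rw [e]
      _ = ∫ k, isotropyDiff n q h (F y k) ∂μ :=
          integral_mul_left_eq_self (fun k => isotropyDiff n q h (F y k)) h'⁻¹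
      _ = isotropyDiff n q h (∫ k, F y k ∂μ) := ContinuousLinearMap.integral_comp_comm _ (hFi y hy)

/-- In linearizing coordinates the fixed points of `h` are the fixed vectors of its differential, so
the line through the base point in direction `v` consists of them. -/
theorem exists_curve_of_fixedPoints [ContMDiffSMul (𝓡 d) (𝓡 n) ∞ G Q] [ProperSMul G Q] {q : Q}
    {h : G} (hq : h • q = q) {v : EuclideanSpace ℝ (Fin n)} (hv : isotropyDiff n q h v = v) :
    ∃ c : ℝ → EuclideanSpace ℝ (Fin n), c 0 = extChartAt (𝓡 n) q q ∧ HasDerivAt c v 0 ∧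
      ∀ᶠ t in 𝓝 (0 : ℝ), h • (extChartAt (𝓡 n) q).symm (c t) = (extChartAt (𝓡 n) q).symm (c t) := by
  have e0 : (extChartAt (𝓡 n) q).symm (extChartAt (𝓡 n) q q) = q := extChartAt_to_inv q
  obtain ⟨Φ, hΦ, hequi⟩ := exists_linearization d n (G := G) q
  set y₀ := extChartAt (𝓡 n) q q with hy₀
  have hΦ' : HasStrictFDerivAt Φ ((ContinuousLinearEquiv.refl ℝ (EuclideanSpace ℝ (Fin n)) :
    EuclideanSpace ℝ (Fin n) ≃L[ℝ] EuclideanSpace ℝ (Fin n)) :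
      EuclideanSpace ℝ (Fin n) →L[ℝ] EuclideanSpace ℝ (Fin n)) y₀ := hΦ
  let g := hΦ'.localInverse Φ _ y₀
  have hg0 : g (Φ y₀) = y₀ := hΦ'.localInverse_apply_image
  have hgd : HasFDerivAt g (ContinuousLinearMap.id ℝ (EuclideanSpace ℝ (Fin n))) (Φ y₀) :=
    hΦ'.to_localInverse.hasFDerivAt
  -- The charts are not centred, so `Φ y₀` need not be zero; equivariance still makes it a fixed
  -- vector, which is all the line needs.
  have hΦ0 : isotropyDiff n q h (Φ y₀) = Φ y₀ := by
    have := hequi.self_of_nhds h hq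
    rw [e0, hq] at this
    exact this.symm
  have hl : HasDerivAt (fun t : ℝ => Φ y₀ + t • v) v 0 := by
    simpa using ((hasDerivAt_id (0 : ℝ)).smul_const v).const_add (Φ y₀)
  have hl0 : Tendsto (fun t : ℝ => Φ y₀ + t • v) (𝓝 0) (𝓝 (Φ y₀)) := by
    have := hl.continuousAt.tendsto
    simpa using this
  have hgd' : HasFDerivAt g (ContinuousLinearMap.id ℝ (EuclideanSpace ℝ (Fin n)))
      (Φ y₀ + (0 : ℝ) • v) := by
    rwa [zero_smul, add_zero]
  have hcd : HasDerivAt (fun t : ℝ => g (Φ y₀ + t • v)) v 0 :=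
    HasFDerivAt.comp_hasDerivAt (f := fun t : ℝ => Φ y₀ + t • v) (0 : ℝ) hgd' hl
  have hc0 : g (Φ y₀ + (0 : ℝ) • v) = y₀ := by rw [zero_smul, add_zero, hg0]
  have hct : Tendsto (fun t : ℝ => g (Φ y₀ + t • v)) (𝓝 0) (𝓝 y₀) := by
    have := hcd.continuousAt.tendsto
    rwa [hc0] at this
  refine ⟨fun t => g (Φ y₀ + t • v), hc0, hcd, ?_⟩
  have hN : Tendsto (fun t : ℝ => h • (extChartAt (𝓡 n) q).symm (g (Φ y₀ + t • v))) (𝓝 0)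
      (𝓝 q) := by
    have h1 := (tendsto_extChartAt_symm (mem_extChartAt_source (I := 𝓡 n) q)).comp hct
    have h2 := h1.const_smul h
    rwa [hq] at h2
  have hN' := (tendsto_extChartAt (mem_extChartAt_source (I := 𝓡 n) q)).comp hN
  filter_upwards [hct.eventually hequi, hct.eventually hΦ'.eventually_left_inverse,
    hN'.eventually hΦ'.eventually_left_inverse, hl0.eventually hΦ'.eventually_right_inverse,
    hN.eventually (eventually_extChartAt_symm_extChartAt (mem_extChartAt_source (I := 𝓡 n) q))]
    with t h1 h2 h3 h4 h5
  have h6 := h1 h hq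
  have h4' : Φ (g (Φ y₀ + t • v)) = Φ y₀ + t • v := h4
  rw [h4', map_add, map_smul, hΦ0, hv] at h6
  -- The point of the curve and its image under `h` have the same value under `Φ`, which is
  -- injective near `y₀`.
  have h7 : extChartAt (𝓡 n) q (h • (extChartAt (𝓡 n) q).symm (g (Φ y₀ + t • v))) =
      g (Φ y₀ + t • v) := by
    refine Eq.trans ?_ h2
    refine Eq.trans h3.symm ?_
    exact congrArg (hΦ'.localInverse Φ _ y₀) (h6.trans h4'.symm)
  exact h5.symm.trans (congrArg (extChartAt (𝓡 n) q).symm h7)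

end FixedPoints

/-! ### From isolated orbit components to the absence of fixed vectors -/

section FixedVectors

open Filter Topology Module

variable (d n : ℕ) {G Q : Type*} [Group G] [TopologicalSpace G]
  [ChartedSpace (EuclideanSpace ℝ (Fin d)) G] [TopologicalSpace Q]
  [ChartedSpace (EuclideanSpace ℝ (Fin n)) Q] [MulAction G Q]
  [LieGroup (𝓡 d) ∞ G] [IsManifold (𝓡 n) ∞ Q]

/-- Displacements within the orbit are tangent to the range of `orbitDiff` up to `ε` times their
length. Dividing by `t` and letting `t` tend to `0` puts `v` within `ε ‖v‖` of the range for every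
`ε`. -/
theorem mem_range_orbitDiff_of_curve [ContMDiffSMul (𝓡 d) (𝓡 n) ∞ G Q] [ProperSMul G Q] {q : Q}
    {c : ℝ → EuclideanSpace ℝ (Fin n)} {v : EuclideanSpace ℝ (Fin n)}
    (hc0 : c 0 = extChartAt (𝓡 n) q q) (hc : HasDerivAt c v 0)
    (ho : ∀ᶠ t in 𝓝 (0 : ℝ), (extChartAt (𝓡 n) q).symm (c t) ∈ MulAction.orbit G q) :
    v ∈ (orbitDiff d n G q).range := by
  obtain ⟨σ, k, -, -, -, hk0, hkd, hnf, -⟩ :=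
    exists_orbit_normalForm d n (G := G) (mem_extChartAt_source (I := 𝓡 n) q)
  have hct : Tendsto c (𝓝 0) (𝓝 (extChartAt (𝓡 n) q q)) := by
    have := hc.continuousAt.tendsto
    rwa [hc0] at this
  have hxt := (tendsto_extChartAt_symm (mem_extChartAt_source (I := 𝓡 n) q)).comp hct
  have hslope : Tendsto (fun t : ℝ => t⁻¹ • (c t - extChartAt (𝓡 n) q q)) (𝓝[≠] 0) (𝓝 v) := by
    simpa [hc0] using hc.tendsto_slope_zero
  let P := ContinuousLinearMap.id ℝ (EuclideanSpace ℝ (Fin n)) - (orbitDiff d n G q).comp σ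
  have hP : ∀ v, P v = v - orbitDiff d n G q (σ v) := fun v => rfl
  have key : ∀ ε : ℝ, 0 < ε → ‖P v‖ ≤ ε * ‖v‖ := by
    intro ε hε
    have h1 := eventually_of_forall_stabilizer (G := G) (x := q)
      (P := fun x => ‖extChartAt (𝓡 n) q x - extChartAt (𝓡 n) q q -
          orbitDiff d n G q (σ (extChartAt (𝓡 n) q x - extChartAt (𝓡 n) q q))‖ ≤
        ε * ‖extChartAt (𝓡 n) q x - extChartAt (𝓡 n) q q‖)
      fun g hg => eventually_tangent_orbit d n hk0 hkd hnf hg hε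
    have h2 : ∀ᶠ t in 𝓝 (0 : ℝ), ‖P (t⁻¹ • (c t - extChartAt (𝓡 n) q q))‖ ≤
        ε * ‖t⁻¹ • (c t - extChartAt (𝓡 n) q q)‖ := by
      filter_upwards [hxt.eventually h1, ho, hct.eventually (eventually_extChartAt_extChartAt_symm
        (mem_extChartAt_source (I := 𝓡 n) q))] with t h1 h2 h3
      have h4 := h1 h2
      simp only [Function.comp, h3] at h4
      rw [map_smul, norm_smul, norm_smul, mul_left_comm]
      gcongr
      exact h4
    exact le_of_tendsto_of_tendsto ((P.continuous.tendsto v).comp hslope).norm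
      (hslope.norm.const_mul ε) (h2.filter_mono nhdsWithin_le_nhds)
  have hP0 : ‖P v‖ ≤ 0 := by
    refine le_of_forall_pos_le_add fun δ hδ => ?_
    have hpos : 0 < ‖v‖ + 1 := by positivity
    calc ‖P v‖ ≤ δ / (‖v‖ + 1) * ‖v‖ := key _ (by positivity)
      _ ≤ δ / (‖v‖ + 1) * (‖v‖ + 1) := by gcongr; linarith
      _ = 0 + δ := by field_simp; ring
  have := norm_le_zero_iff.1 hP0
  rw [hP, sub_eq_zero] at this
  exact ⟨σ v, this.symm⟩

theorem isotropyFixesNoVector_of_isolated [ContMDiffSMul (𝓡 d) (𝓡 n) ∞ G Q] [ProperSMul G Q]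
    (H : IsAlmostSemifree d n G Q) : IsotropyFixesNoVector n G Q := by
  intro q h hq h1 v hv
  have hS : MulAction.stabilizer G q ≠ ⊥ := fun hbot => h1 (by
    rw [Subgroup.eq_bot_iff_forall] at hbot
    exact hbot h hq)
  obtain ⟨c, hc0, hcd, hfix⟩ := exists_curve_of_fixedPoints d n hq hv
  obtain ⟨U, hU, hCU, hUS⟩ := H.isolated q hS
  have hct : Tendsto c (𝓝 0) (𝓝 (extChartAt (𝓡 n) q q)) := by
    have := hcd.continuousAt.tendsto
    rwa [hc0] at this
  have hxt := (tendsto_extChartAt_symm (mem_extChartAt_source (I := 𝓡 n) q)).comp hct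
  have hqU : U ∈ 𝓝 q :=
    hU.mem_nhds (hCU (mem_connectedComponentIn (MulAction.mem_orbit_self q)))
  -- Points fixed by `h ≠ 1` have non-trivial isotropy, so isolation confines the curve to the
  -- orbit.
  have ho : ∀ᶠ t in 𝓝 (0 : ℝ), (extChartAt (𝓡 n) q).symm (c t) ∈ MulAction.orbit G q := by
    filter_upwards [hxt hqU, hfix] with t ht1 ht2
    refine connectedComponentIn_subset _ _ (hUS ⟨ht1, fun hbot => h1 ?_⟩)
    rw [Subgroup.eq_bot_iff_forall] at hbot
    exact hbot h ht2
  obtain ⟨ξ, rfl⟩ := mem_range_orbitDiff_of_curve d n hc0 hcd ho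
  refine (quotientAd_fixes_only_zero_iff d n (⟨h, hq⟩ : MulAction.stabilizer G q)).1 ?_ ξ hv
  intro x hx
  by_contra hx0
  exact h1 (congrArg Subtype.val (H.free_quotient q hS ⟨h, hq⟩ x hx0 hx))

theorem free_quotient_of_isotropyFixesNoVector [ContMDiffSMul (𝓡 d) (𝓡 n) ∞ G Q]
    (H : IsotropyFixesNoVector n G Q) (q : Q) (h : MulAction.stabilizer G q)
    (x : GroupLieAlgebra (𝓡 d) G ⧸ subgroupLieAlgebra d (MulAction.stabilizer G q))
    (hx : x ≠ 0) (hhx : quotientAd d (MulAction.stabilizer G q) h x = x) : h = 1 := by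
  by_contra h1
  refine hx ((quotientAd_fixes_only_zero_iff d n h).2 (fun ξ hξ => ?_) x hhx)
  exact H q h h.2 (fun e => h1 (Subtype.ext e)) _ hξ

end FixedVectors

/-! ### Elements of a connected group whose adjoint action fixes only zero -/

section Adjoint

open Filter Topology Module

variable (d : ℕ) {G : Type*} [Group G] [TopologicalSpace G]
  [ChartedSpace (EuclideanSpace ℝ (Fin d)) G]

/-- The adjoint action in the chart at the identity. -/
noncomputable def adjointInChart (g : G) :
    EuclideanSpace ℝ (Fin d) →L[ℝ] EuclideanSpace ℝ (Fin d) :=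
  Ad d g

variable [LieGroup (𝓡 d) ∞ G]

theorem contMDiff_conj_of_lieGroup (g : G) :
    ContMDiff (𝓡 d) (𝓡 d) ∞ (fun x : G => g * x * g⁻¹) :=
  (contMDiff_mul_right (I := 𝓡 d) (n := ∞) (a := g⁻¹)).comp
    (contMDiff_mul_left (I := 𝓡 d) (n := ∞) (a := g))

theorem hasFDerivAt_conj_inCharts (g : G) :
    HasFDerivAt (fun u => extChartAt (𝓡 d) (1 : G) (g * unitChartSymm d G u * g⁻¹))
      (adjointInChart d g) (unitCoord d G) :=
  MDifferentiableAt.hasFDerivAt_inCharts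
    ((contMDiff_conj_of_lieGroup d g).mdifferentiable (by simp) (1 : G)) (by simp)

theorem adjointInChart_one : adjointInChart d (1 : G) = ContinuousLinearMap.id ℝ _ := by
  have h := hasFDerivAt_conj_inCharts d (1 : G)
  refine h.unique ((hasFDerivAt_id (unitCoord d G)).congr_of_eventuallyEq ?_)
  filter_upwards [eventually_extChartAt_extChartAt_symm
    (mem_extChartAt_source (I := 𝓡 d) (1 : G))] with u hu
  simpa [unitChartSymm] using hu

theorem adjointInChart_mul (a b : G) :
    adjointInChart d (a * b) = (adjointInChart d a).comp (adjointInChart d b) := by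
  have := topologicalGroup_of_lieGroup (G := G) (𝓡 d) ∞
  have hb := hasFDerivAt_conj_inCharts d b
  have hb0 : extChartAt (𝓡 d) (1 : G) (b * unitChartSymm d G (unitCoord d G) * b⁻¹) =
      unitCoord d G := by
    rw [unitChartSymm_unitCoord, mul_one, mul_inv_cancel]
    rfl
  have ha : HasFDerivAt (fun u => extChartAt (𝓡 d) (1 : G) (a * unitChartSymm d G u * a⁻¹))
      (adjointInChart d a)
      (extChartAt (𝓡 d) (1 : G) (b * unitChartSymm d G (unitCoord d G) * b⁻¹)) := by
    rw [hb0]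
    exact hasFDerivAt_conj_inCharts d a
  have hab := ha.comp (f := fun u => extChartAt (𝓡 d) (1 : G) (b * unitChartSymm d G u * b⁻¹))
    _ hb
  refine (hasFDerivAt_conj_inCharts d (a * b)).unique (hab.congr_of_eventuallyEq ?_)
  have ht : Tendsto (fun u => b * unitChartSymm d G u * b⁻¹) (𝓝 (unitCoord d G)) (𝓝 1) := by
    have := ((tendsto_unitChartSymm d (G := G)).const_mul b).mul_const b⁻¹
    simpa using this
  filter_upwards [ht.eventually (eventually_extChartAt_symm_extChartAt
    (mem_extChartAt_source (I := 𝓡 d) (1 : G)))] with u hu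
  have e : unitChartSymm d G (extChartAt (𝓡 d) (1 : G) (b * unitChartSymm d G u * b⁻¹)) =
    b * unitChartSymm d G u * b⁻¹ := hu
  simp only [Function.comp, e]
  congr 1
  group

/-- Near `a` the adjoint map is a partial derivative of a jointly smooth function, and so depends
continuously on the group element. -/
theorem continuous_adjointInChart : Continuous (adjointInChart d (G := G)) := by
  have := topologicalGroup_of_lieGroup (G := G) (𝓡 d) ∞
  rw [continuous_iff_continuousAt]
  intro a
  let F : EuclideanSpace ℝ (Fin d) × EuclideanSpace ℝ (Fin d) → EuclideanSpace ℝ (Fin d) :=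
    fun p => extChartAt (𝓡 d) (1 : G)
      ((unitChartSymm d G p.1 * a) * unitChartSymm d G p.2 * (unitChartSymm d G p.1 * a)⁻¹)
  have hF : ContDiffAt ℝ ∞ F (unitCoord d G, unitCoord d G) := by
    refine ContMDiffAt.contDiffAt ?_
    have h1 : ContMDiffAt 𝓘(ℝ, EuclideanSpace ℝ (Fin d) × EuclideanSpace ℝ (Fin d)) (𝓡 d) ∞
        (fun p : EuclideanSpace ℝ (Fin d) × EuclideanSpace ℝ (Fin d) =>
          unitChartSymm d G p.1 * a) (unitCoord d G, unitCoord d G) :=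
      ((contMDiff_mul_right (I := 𝓡 d) (n := ∞) (a := a)) _).comp _
        ((contMDiffAt_unitChartSymm d (G := G)).comp (unitCoord d G, unitCoord d G)
          contDiff_fst.contMDiff.contMDiffAt)
    have h2 : ContMDiffAt 𝓘(ℝ, EuclideanSpace ℝ (Fin d) × EuclideanSpace ℝ (Fin d)) (𝓡 d) ∞
        (fun p : EuclideanSpace ℝ (Fin d) × EuclideanSpace ℝ (Fin d) =>
          unitChartSymm d G p.2) (unitCoord d G, unitCoord d G) :=
      (contMDiffAt_unitChartSymm d (G := G)).comp (unitCoord d G, unitCoord d G)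
        contDiff_snd.contMDiff.contMDiffAt
    refine ContMDiffAt.comp _ ?_ ((h1.mul h2).mul h1.inv)
    refine contMDiffAt_extChartAt_of_mem ?_
    simp [unitChartSymm_unitCoord]
  have hFc : ContinuousAt (fun w => (fderiv ℝ F (w, unitCoord d G)).comp
      (ContinuousLinearMap.inr ℝ _ _)) (unitCoord d G) := by
    have h1 : ContinuousAt (fderiv ℝ F) (unitCoord d G, unitCoord d G) :=
      (hF.fderiv_right (m := 0) (by simp)).continuousAt
    have h2 : ContinuousAt (fun w => fderiv ℝ F (w, unitCoord d G)) (unitCoord d G) :=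
      ContinuousAt.comp (g := fderiv ℝ F) (f := fun w => (w, unitCoord d G)) h1 (by fun_prop)
    exact h2.clm_comp continuousAt_const
  have hFe : (fun w => adjointInChart d (unitChartSymm d G w * a)) =ᶠ[𝓝 (unitCoord d G)]
      fun w => (fderiv ℝ F (w, unitCoord d G)).comp (ContinuousLinearMap.inr ℝ _ _) := by
    have h1 : ∀ᶠ p in 𝓝 (unitCoord d G, unitCoord d G), DifferentiableAt ℝ F p :=
      ((hF.of_le (m := 1) (by exact_mod_cast le_top)).eventually (by simp)).mono
        fun p hp => hp.differentiableAt one_ne_zero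
    have h2 : Tendsto (fun w => (w, unitCoord d G)) (𝓝 (unitCoord d G))
        (𝓝 (unitCoord d G, unitCoord d G)) :=
      (by fun_prop : Continuous fun w : EuclideanSpace ℝ (Fin d) =>
        (w, unitCoord d G)).tendsto _
    filter_upwards [h2.eventually h1] with w hw
    exact (hasFDerivAt_conj_inCharts d (unitChartSymm d G w * a)).unique
      (hw.hasFDerivAt.comp (f := fun y => (w, y)) (unitCoord d G) (hasFDerivAt_prodMk_right _ _))
  have h3 := hFc.congr hFe.symm
  have h4 : Tendsto (adjointInChart d) (map (fun w => unitChartSymm d G w * a)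
      (𝓝 (unitCoord d G))) (𝓝 (adjointInChart d a)) := by
    have := h3.tendsto
    rw [unitChartSymm_unitCoord, one_mul] at this
    exact tendsto_map'_iff.2 this
  have h5 : map (fun w => unitChartSymm d G w * a) (𝓝 (unitCoord d G)) = 𝓝 a := by
    rw [← map_mul_right_nhds_one a, ← map_unitChartSymm d, map_map]
    rfl
  rwa [h5] at h4

/-- The commutator map `x ↦ x * h * x⁻¹ * h⁻¹` has the invertible derivative `1 - Ad_h` at `1`, so
it covers a neighbourhood of `1`; multiply by `h` on the right. -/
theorem conjClass_mem_nhds (h : G) (hh : ∀ ξ, adjointInChart d h ξ = ξ → ξ = 0) :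
    {y : G | ∃ x : G, y = x * h * x⁻¹} ∈ 𝓝 h := by
  have := topologicalGroup_of_lieGroup (G := G) (𝓡 d) ∞
  let c : G → G := fun x => x * (h * x⁻¹ * h⁻¹)
  have hc : ContMDiff (𝓡 d) (𝓡 d) ∞ c :=
    contMDiff_id.mul (((contMDiff_conj_of_lieGroup d h)).comp (contMDiff_inv (𝓡 d) ∞))
  have hc1 : c 1 = 1 := by simp [c]
  have hcm : MDifferentiableAt (𝓡 d) (𝓡 d) c 1 := hc.mdifferentiable (by simp) _
  have hjm : MDifferentiableAt (𝓡 d) (𝓡 d) (fun x : G => h * x * h⁻¹) 1 :=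
    (contMDiff_conj_of_lieGroup d h).mdifferentiable (by simp) _
  let T : EuclideanSpace ℝ (Fin d) →L[ℝ] EuclideanSpace ℝ (Fin d) := mfderiv (𝓡 d) (𝓡 d) c 1
  have hTd : HasFDerivAt (fun u => extChartAt (𝓡 d) (1 : G) (c (unitChartSymm d G u))) T
      (unitCoord d G) := MDifferentiableAt.hasFDerivAt_inCharts hcm hc1
  -- Differentiating `c x * (h * x * h⁻¹) = x` gives `T + Ad_h = id` without computing the
  -- derivative of inversion.
  have hT : ∀ v, T v + adjointInChart d h v = v := by
    intro v
    have hm : MDifferentiableAt ((𝓡 d).prod (𝓡 d)) (𝓡 d) (fun p : G × G => p.1 * p.2)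
        (c 1, h * 1 * h⁻¹) := (contMDiff_mul (𝓡 d) ∞).mdifferentiable (by simp) _
    have h1 := DFunLike.congr_fun (mfderiv_comp (I' := (𝓡 d).prod (𝓡 d))
      (f := fun x : G => (c x, h * x * h⁻¹)) (1 : G) hm (hcm.prodMk hjm)) v
    rw [mfderiv_prodMk hcm hjm] at h1
    have h2 := h1.trans (mfderiv_mul_at_one d hc1 (by simp) _ _)
    have e : ((fun p : G × G => p.1 * p.2) ∘ fun x : G => (c x, h * x * h⁻¹)) = id := by
      funext x
      simp [c, mul_assoc]
    rw [e, mfderiv_id] at h2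
    exact h2.symm
  have hcd : ContDiffAt ℝ ∞ (fun u => extChartAt (𝓡 d) (1 : G) (c (unitChartSymm d G u)))
      (unitCoord d G) :=
    ContMDiffAt.contDiffAt_inCharts (mem_extChartAt_source (1 : G)) (by simp [hc1]) (hc 1)
  have hst := hcd.hasStrictFDerivAt' hTd (by simp)
  have hTi : Function.Injective T.toLinearMap := by
    rw [← LinearMap.ker_eq_bot, LinearMap.ker_eq_bot']
    intro v hv
    have h1 : T v = 0 := hv
    have h2 := hT v
    rw [h1, zero_add] at h2
    exact hh v h2
  have hm := hst.map_nhds_eq_of_surj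
    (LinearMap.range_eq_top.2 (LinearMap.injective_iff_surjective.1 hTi))
  rw [unitChartSymm_unitCoord, hc1] at hm
  have hct : Tendsto (fun u => c (unitChartSymm d G u)) (𝓝 (unitCoord d G)) (𝓝 1) := by
    have := (hc.continuous.tendsto 1).comp (tendsto_unitChartSymm d (G := G))
    rwa [hc1] at this
  have h1 : map (fun u => c (unitChartSymm d G u)) (𝓝 (unitCoord d G)) = 𝓝 1 := by
    rw [← map_extChartAt_symm_nhds_of_boundaryless (mem_extChartAt_source (I := 𝓡 d) (1 : G)),
      ← hm, map_map]
    refine map_congr ?_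
    filter_upwards [hct.eventually (eventually_extChartAt_symm_extChartAt
      (mem_extChartAt_source (I := 𝓡 d) (1 : G)))] with u hu
    exact hu.symm
  rw [← map_mul_right_nhds_one h, ← h1, map_map, mem_map]
  refine Filter.univ_mem' fun u => ⟨unitChartSymm d G u, ?_⟩
  simp [c, mul_assoc]

/-- The function `δ x = det (Ad_x - 1)` is continuous and constant on conjugacy classes. Where it is
non-zero, those classes are neighbourhoods of their points, so the level set of `δ h` is clopen and
contains `1`. But `δ 1` is the determinant of the zero map, non-zero only in dimension zero, where a
connected group is trivial. -/
theorem eq_one_of_adjoint_fixes_only_zero [T2Space G] [ConnectedSpace G] {h : G}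
    (hh : ∀ ξ, adjointInChart d h ξ = ξ → ξ = 0) : h = 1 := by
  let δ : G → ℝ := fun x => (adjointInChart d x - ContinuousLinearMap.id ℝ _).det
  have hδc : Continuous δ := ContinuousLinearMap.continuous_det.comp
    ((continuous_adjointInChart d).sub continuous_const)
  have hδ0 : ∀ x : G, δ x ≠ 0 ↔ ∀ ξ, adjointInChart d x ξ = ξ → ξ = 0 := by
    intro x
    have h1 : δ x ≠ 0 ↔ LinearMap.ker (adjointInChart d x -
        ContinuousLinearMap.id ℝ (EuclideanSpace ℝ (Fin d))).toLinearMap = ⊥ := by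
      rw [← isUnit_iff_ne_zero]
      exact (LinearMap.isUnit_iff_isUnit_det _).symm.trans (LinearMap.isUnit_iff_ker_eq_bot _)
    rw [h1, LinearMap.ker_eq_bot']
    refine forall_congr' fun ξ => imp_congr_left ?_
    exact sub_eq_zero
  have hδconj : ∀ x y : G, δ (x * y * x⁻¹) = δ y := by
    intro x y
    have e1 : (adjointInChart d x).comp (adjointInChart d x⁻¹) = ContinuousLinearMap.id ℝ _ := by
      rw [← adjointInChart_mul, mul_inv_cancel, adjointInChart_one]
    have e2 : adjointInChart d (x * y * x⁻¹) - ContinuousLinearMap.id ℝ _ =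
        (adjointInChart d x).comp ((adjointInChart d y - ContinuousLinearMap.id ℝ _).comp
          (adjointInChart d x⁻¹)) := by
      rw [adjointInChart_mul, adjointInChart_mul, ContinuousLinearMap.sub_comp,
        ContinuousLinearMap.comp_sub, ContinuousLinearMap.id_comp, e1,
        ContinuousLinearMap.comp_assoc]
    have e3 : LinearMap.det (adjointInChart d x).toLinearMap *
        LinearMap.det (adjointInChart d x⁻¹).toLinearMap = 1 := by
      rw [← LinearMap.det_comp]
      exact (congrArg ContinuousLinearMap.det e1).trans LinearMap.det_id
    calc δ (x * y * x⁻¹) = LinearMap.det (adjointInChart d x).toLinearMap *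
          (δ y * LinearMap.det (adjointInChart d x⁻¹).toLinearMap) := by
          change ContinuousLinearMap.det _ = _
          rw [e2]
          exact (LinearMap.det_comp _ _).trans (congrArg _ (LinearMap.det_comp _ _))
      _ = δ y * (LinearMap.det (adjointInChart d x).toLinearMap *
          LinearMap.det (adjointInChart d x⁻¹).toLinearMap) := by ring
      _ = δ y := by rw [e3, mul_one]
  have hh0 : δ h ≠ 0 := (hδ0 h).2 hh
  have hclopen : IsClopen {x | δ x = δ h} := by
    refine ⟨isClosed_eq hδc continuous_const, isOpen_iff_mem_nhds.2 fun x hx => ?_⟩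
    have hx' : δ x = δ h := hx
    filter_upwards [conjClass_mem_nhds d x ((hδ0 x).1 (hx' ▸ hh0))] with y ⟨z, hz⟩
    change δ y = δ h
    rw [hz, hδconj, hx']
  have huniv := hclopen.eq_univ ⟨h, rfl⟩
  have h1 : δ 1 = δ h := by
    have : (1 : G) ∈ {x | δ x = δ h} := huniv ▸ Set.mem_univ (1 : G)
    exact this
  have hd : ∀ ξ : EuclideanSpace ℝ (Fin d), ξ = 0 := fun ξ =>
    (hδ0 1).1 (h1 ▸ hh0) ξ (by rw [adjointInChart_one]; rfl)
  have hsub : Subsingleton (EuclideanSpace ℝ (Fin d)) := ⟨fun a b => (hd a).trans (hd b).symm⟩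
  have hone : IsOpen ({1} : Set G) := by
    have : ({1} : Set G) = (extChartAt (𝓡 d) (1 : G)).source := by
      refine Set.Subset.antisymm (Set.singleton_subset_iff.2 (mem_extChartAt_source _)) ?_
      intro x hx
      exact (extChartAt (𝓡 d) (1 : G)).injOn hx (mem_extChartAt_source _) (Subsingleton.elim _ _)
    rw [this]
    exact isOpen_extChartAt_source 1
  have huniv' := IsClopen.eq_univ (s := ({1} : Set G)) ⟨isClosed_singleton, hone⟩ ⟨1, rfl⟩
  exact (huniv'.symm ▸ Set.mem_univ h : h ∈ ({1} : Set G))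

end Adjoint

/-! ### Orbit dimension and isotropy Lie algebras -/

section OrbitDimension

open Module

variable (d : ℕ) {G : Type*} [Group G] [TopologicalSpace G]
  [ChartedSpace (EuclideanSpace ℝ (Fin d)) G]

theorem finiteDimensional_groupLieAlgebra : FiniteDimensional ℝ (GroupLieAlgebra (𝓡 d) G) :=
  inferInstanceAs (FiniteDimensional ℝ (EuclideanSpace ℝ (Fin d)))

theorem finrank_groupLieAlgebra : finrank ℝ (GroupLieAlgebra (𝓡 d) G) = d :=
  finrank_euclideanSpace_fin (𝕜 := ℝ) (n := d)

variable [LieGroup (𝓡 d) ∞ G]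

theorem subgroupLieAlgebra_bot : subgroupLieAlgebra d (⊥ : Subgroup G) = ⊥ := by
  rw [Submodule.eq_bot_iff]
  rintro ξ ⟨γ, -, hγ, -, rfl⟩
  obtain rfl : γ = fun _ => 1 := funext fun t => Subgroup.mem_bot.1 (hγ t)
  rw [mfderiv_const]
  rfl

variable {Q : Type*} [MulAction G Q]

theorem orbitDim_add_finrank (q : Q) :
    orbitDim d G q + finrank ℝ (subgroupLieAlgebra d (MulAction.stabilizer G q)) = d := by
  have := finiteDimensional_groupLieAlgebra d (G := G)
  exact (Submodule.finrank_quotient_add_finrank _).trans (finrank_groupLieAlgebra d)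

theorem orbitDim_eq_iff (q : Q) :
    orbitDim d G q = d ↔ subgroupLieAlgebra d (MulAction.stabilizer G q) = ⊥ := by
  have := finiteDimensional_groupLieAlgebra d (G := G)
  have h := orbitDim_add_finrank d (G := G) q
  rw [← Submodule.finrank_eq_zero (R := ℝ)]
  omega

theorem orbitDim_le (q : Q) : orbitDim d G q ≤ d :=
  (Nat.le_add_right _ _).trans_eq (orbitDim_add_finrank d q)

theorem orbitDim_of_stabilizer_eq_bot {q : Q} (hq : MulAction.stabilizer G q = ⊥) :
    orbitDim d G q = d := by
  rw [orbitDim_eq_iff, hq, subgroupLieAlgebra_bot]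

theorem OrbitHasNonMaximalDim.stabilizer_ne_bot {q : Q} (h : OrbitHasNonMaximalDim d G q) :
    MulAction.stabilizer G q ≠ ⊥ := by
  obtain ⟨q', hq'⟩ := h
  intro hq
  rw [orbitDim_of_stabilizer_eq_bot d hq] at hq'
  exact absurd (orbitDim_le d q') hq'.not_ge

end OrbitDimension

theorem HasIsolatedOrbitComponents.anti {G Q : Type*} [Group G] [TopologicalSpace Q]
    [MulAction G Q] {S S' : Set Q} (h : HasIsolatedOrbitComponents G S) (hS : S' ⊆ S) :
    HasIsolatedOrbitComponents G S' := fun q hq =>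
  let ⟨U, hU, hCU, hUS⟩ := h q (hS hq)
  ⟨U, hU, hCU, (Set.inter_subset_inter_right U hS).trans hUS⟩

/-- Otherwise a chart target, which is open and non-empty, would have measure zero. The point `q`
only ensures that there is a chart. -/
theorem IsNullInManifold.exists_notMem {n : ℕ} {Q : Type*} [TopologicalSpace Q]
    [ChartedSpace (EuclideanSpace ℝ (Fin n)) Q] {S : Set Q} (h : IsNullInManifold n S) (q : Q) :
    ∃ q', q' ∉ S := by
  by_contra! hS
  have h1 := h q
  rw [Set.inter_eq_left.2 (fun x _ => hS x), OpenPartialHomeomorph.image_source_eq_target] at h1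
  exact ((chartAt (EuclideanSpace ℝ (Fin n)) q).open_target.measure_pos MeasureTheory.volume
    ⟨_, mem_chart_target _ q⟩).ne' h1

/-! ### Comparison of the two isolation conditions and conclusion -/

section AlmostSemifreeLift

variable (d n : ℕ) {G : Type*} [Group G] [TopologicalSpace G]
  [ChartedSpace (EuclideanSpace ℝ (Fin d)) G] [LieGroup (𝓡 d) ∞ G]
  {Q : Type*} [TopologicalSpace Q]
  [ChartedSpace (EuclideanSpace ℝ (Fin n)) Q] [MulAction G Q]

/-- For a connected group whose isotropy groups act freely on the punctured isotropy quotients, a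
non-trivial isotropy group is not discrete. -/
theorem subgroupLieAlgebra_stabilizer_ne_bot [T2Space G] [ConnectedSpace G] {S : Set Q}
    (H : IsAlmostSemifreeAlong d n G Q S) {q : Q} (hq : MulAction.stabilizer G q ≠ ⊥) :
    subgroupLieAlgebra d (MulAction.stabilizer G q) ≠ ⊥ := by
  intro hbot
  refine hq ((Subgroup.eq_bot_iff_forall _).2 fun h hh => ?_)
  by_contra h1
  -- If `𝔥 = 0`, then `𝔤 / 𝔥` is `𝔤` itself, so condition (c) says that `Ad_h` fixes no non-zero
  -- vector.
  refine h1 (eq_one_of_adjoint_fixes_only_zero d (h := h) fun ξ hξ => ?_)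
  by_contra hξ0
  refine h1 (congrArg Subtype.val (H.free_quotient q hq ⟨h, hh⟩
    (Submodule.Quotient.mk (ξ : GroupLieAlgebra (𝓡 d) G)) (fun e => hξ0 ?_)
    (congrArg (fun η : GroupLieAlgebra (𝓡 d) G => Submodule.Quotient.mk η) hξ)))
  have h2 := (Submodule.Quotient.mk_eq_zero _).1 e
  rw [hbot] at h2
  exact (Submodule.mem_bot ℝ).1 h2

/-- Condition (a) supplies a free orbit, of dimension `d`, while non-trivial isotropy is not
discrete and so lowers the dimension below `d`. Hence every orbit with non-trivial isotropy is among
those isolated by (b'). -/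
theorem isAlmostSemifree_of_isAlmostSemifreeDim [T2Space G] [ConnectedSpace G]
    (H : IsAlmostSemifreeDim d n G Q) : IsAlmostSemifree d n G Q where
  free_ae := H.free_ae
  free_quotient := H.free_quotient
  isolated := by
    refine HasIsolatedOrbitComponents.anti H.isolated fun q hq => ?_
    obtain ⟨q', hq'⟩ := H.free_ae.exists_notMem q
    refine ⟨q', ?_⟩
    rw [orbitDim_of_stabilizer_eq_bot d (not_not.1 hq')]
    exact (orbitDim_le d q).lt_of_ne fun e =>
      subgroupLieAlgebra_stabilizer_ne_bot d n H hq ((orbitDim_eq_iff d q).1 e)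

variable [IsManifold (𝓡 n) ∞ Q] [ContMDiffSMul (𝓡 d) (𝓡 n) ∞ G Q] [ProperSMul G Q]
  [SecondCountableTopology Q]

theorem isAlmostSemifree_of_isotropyFixesNoVector (H : IsotropyFixesNoVector n G Q)
    (hopen : ∀ q : Q, MulAction.stabilizer G q ≠ ⊥ → ¬ IsOpen (MulAction.orbit G q)) :
    IsAlmostSemifree d n G Q where
  free_ae := isNullInManifold_of_isotropyFixesNoVector d n H hopen
  isolated := hasIsolatedOrbitComponents_of_isotropyFixesNoVector d n H
  free_quotient q _ h x hx hhx := free_quotient_of_isotropyFixesNoVector d n H q h x hx hhx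

end AlmostSemifreeLift

theorem mainTheorem7 (d n : ℕ)
    {G : Type*} [Group G] [TopologicalSpace G] [T2Space G]
    [ChartedSpace (EuclideanSpace ℝ (Fin d)) G] [LieGroup (𝓡 d) ∞ G]
    {Q : Type*} [TopologicalSpace Q] [T2Space Q] [SecondCountableTopology Q]
    [ChartedSpace (EuclideanSpace ℝ (Fin n)) Q] [IsManifold (𝓡 n) ∞ Q]
    [MulAction G Q] [ContMDiffSMul (𝓡 d) (𝓡 n) ∞ G Q] [ProperSMul G Q]
    (hopen : ∀ q : Q, MulAction.stabilizer G q ≠ ⊥ → ¬ IsOpen (MulAction.orbit G q)) :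
    (CosphereLiftIsFree d n G Q ↔ IsAlmostSemifree d n G Q) ∧
      (CosphereLiftIsFree d n G Q → IsAlmostSemifreeDim d n G Q) ∧
      (ConnectedSpace G → (CosphereLiftIsFree d n G Q ↔ IsAlmostSemifreeDim d n G Q)) := by
  have h1 : CosphereLiftIsFree d n G Q ↔ IsAlmostSemifree d n G Q := by
    rw [cosphereLiftIsFree_iff_isotropyFixesNoVector]
    exact ⟨fun H => isAlmostSemifree_of_isotropyFixesNoVector d n H hopen,
      isotropyFixesNoVector_of_isolated d n⟩
  have h2 : CosphereLiftIsFree d n G Q → IsAlmostSemifreeDim d n G Q := fun H =>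
    have H' := h1.1 H
    ⟨H'.free_ae, H'.isolated.anti fun _ hq => hq.stabilizer_ne_bot, H'.free_quotient⟩
  exact ⟨h1, h2, fun _ => ⟨h2, fun H => h1.2 (isAlmostSemifree_of_isAlmostSemifreeDim d n H)⟩⟩
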